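/- Let $M$ be a smooth ($C^\infty$, Hausdorff, $\sigma$-compact) manifold of dimension $n$, without boundary, and let $E\to M$ be a smooth complex vector bundle of rank $N$. Let $\mathbb O_n=\mathbb C[[\hat x_1,\dots,\hat x_n]]$ and let $M_N(\mathbb O_n)$ carry the adic topology of the ideal generated by the elements of degree $\ge 1$. Let $G$ be the group of continuous $\mathbb C$-algebra automorphisms of $M_N(\mathbb O_n)$ with continuous inverse whose restriction to the centre $\mathbb O_n$ is induced by an automorphism of $\mathbb R[[\hat x_1,\dots,\hat x_n]]$. For $m\in M$ let $I_m\subset\Gamma(\mathrm{End}(E))$ be the ideal of the smooth sections vanishing at $m$, let $J_m\mathrm{End}(E)=\varprojlim_k\Gamma(\mathrm{End}(E))/I_m^k$, and let $J_m\gamma$ denote the jet of a section $\gamma$. The frame bundle $\tilde M_E$ consists of the pairs $(m,\Phi)$, where $\Phi:M_N(\mathbb O_n)\to J_m\mathrm{End}(E)$ is an isomorphism of topological algebras that identifies $\mathbb R[[\hat x_1,\dots,\hat x_n]]\cdot 1$ with the jets of real scalar sections; $G$ acts on it by $\Phi\mapsto\Phi\circ g$. A local section $\sigma$ of $\tilde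 M_E$, $\sigma(m)=(m,\Phi_m)$, is smooth if for every $\gamma\in\Gamma(\mathrm{End}(E))$ all coefficients of $\Phi_m^{-1}(J_m\gamma)$ depend smoothly on $m$. The canonical one-form $\omega$ on $\tilde M_E$, with values in $\mathrm{Der}(M_N(\mathbb O_n))$, is defined as follows. For a path $(m_t,\Phi_t)$ in $\tilde M_E$, lift it to a smooth path of local trivializations $\tilde\Phi_t:M_N(C^\infty(V))\to\Gamma(\mathrm{End}(E)|_{U_t})$, $0\in V\subset\mathbb R^n$, that map $0$ to $m_t$ and induce $\Phi_t$ on jets. The value of $\omega$ on the velocity of the path at $t=0$ is the derivation $J_0(a)\mapsto J_0\big(\tfrac{d}{dt}\big|_{t=0}\tilde\Phi_0^{-1}\tilde\Phi_t(a)\big)$. Let $JE=\tilde M_E\times_G M_N(\mathbb O_n)$ be the bundle of jets of $\mathrm{End}(E)$, and let $\Omega^k(M,JE)$ be the space of $JE$-valued $k$-forms that have smooth coefficients in the trivialization of $JE$ given by any smooth local section of $\tilde M_E$. Then every fibre of $\tilde M_E\to M$ is non-empty, and there is exactly one family of $\mathbb C$-linear maps $\nabla:\Omega^k(M,JE)\to\Omega^{k+1}(M,JE)$,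 $k\ge 0$, that in the trivialization of $JE$ given by any smooth local section $\sigma$ of $\tilde M_E$ has the form $\nabla=d+\sigma^*\omega$. This connection is flat, that is, $\nabla^2=0$. The complex $(\Omega^*(M,JE),\nabla)$ has cohomology only in degree $0$: for every $k\ge1$ the kernel of $\nabla$ on $\Omega^k(M,JE)$ equals $\nabla(\Omega^{k-1}(M,JE))$. In degree $0$, Taylor expansion $$\gamma\longmapsto\big(m\mapsto[(m,\Phi),\Phi^{-1}(J_m\gamma)]\big)$$ is a $\mathbb C$-linear isomorphism of $\Gamma(\mathrm{End}(E))$ onto $\ker\big(\nabla:\Omega^0(M,JE)\to\Omega^1(M,JE)\big)$. -/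

import Mathlib

open scoped Manifold ContDiff Topology Bundle
open Bundle

noncomputable section

namespace EndJet

/-! ### The algebra `M_N(𝕆_n)` of matrices of formal power series -/

/-- `𝕆_n = ℂ[[x̂₁, …, x̂ₙ]]`. -/
abbrev PS (n : ℕ) : Type := MvPowerSeries (Fin n) ℂ

/-- `M_N(𝕆_n)`. -/
abbrev MatPS (n N : ℕ) : Type := Matrix (Fin N) (Fin N) (PS n)

/-- The real scalar series `ℝ[[x̂₁, …, x̂ₙ]] · 1`, as a map into `M_N(𝕆_n)`. -/
def realScalar (n N : ℕ) (r : MvPowerSeries (Fin n) ℝ) : MatPS n N :=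
  Matrix.scalar (Fin N) (MvPowerSeries.map (algebraMap ℝ ℂ) r)

/-- The `k`-th power of the ideal generated by the elements of degree `≥ 1`: all entries have
order at least `k`.  These are the basic neighbourhoods of `0` in the adic topology. -/
def adicNhd (n N k : ℕ) : Set (MatPS n N) :=
  {f | ∀ i j, (k : ℕ∞) ≤ (f i j).order}

/-- Continuity at `0` (hence continuity, for additive maps) for the adic topology. -/
def AdicContinuous {n N : ℕ} (g : MatPS n N → MatPS n N) : Prop :=
  ∀ k, ∃ l, ∀ f ∈ adicNhd n N l, g f ∈ adicNhd n N k

/-- The group `G` of (bi)continuous automorphisms of `M_N(𝕆_n)` whose restriction to the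
centre `𝕆_n` is induced by an automorphism `θ` of `ℝ[[x̂₁, …, x̂ₙ]]`. -/
def G (n N : ℕ) : Subgroup (MatPS n N ≃ₐ[ℂ] MatPS n N) where
  carrier := {g | AdicContinuous g ∧ AdicContinuous g.symm ∧
    ∃ θ : MvPowerSeries (Fin n) ℝ ≃ₐ[ℝ] MvPowerSeries (Fin n) ℝ,
      ∀ r, g (realScalar n N r) = realScalar n N (θ r)}
  mul_mem' := by
    rintro a b ⟨ha, ha', θ, hθ⟩ ⟨hb, hb', η, hη⟩
    refine ⟨fun k => ?_, fun k => ?_, η.trans θ, fun r => ?_⟩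
    · obtain ⟨l, hl⟩ := ha k
      obtain ⟨p, hp⟩ := hb l
      exact ⟨p, fun f hf => hl _ (hp _ hf)⟩
    · obtain ⟨l, hl⟩ := hb' k
      obtain ⟨p, hp⟩ := ha' l
      exact ⟨p, fun f hf => hl _ (hp _ hf)⟩
    · simp [AlgEquiv.mul_apply, hη, hθ]
  one_mem' := ⟨fun k => ⟨k, fun _ hf => hf⟩, fun k => ⟨k, fun _ hf => hf⟩,
    AlgEquiv.refl, fun _ => rfl⟩
  inv_mem' := by
    rintro a ⟨ha, ha', θ, hθ⟩
    refine ⟨ha', ha, θ.symm, fun r => ?_⟩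
    change a.symm _ = _
    rw [AlgEquiv.symm_apply_eq, hθ, AlgEquiv.apply_symm_apply]

/-- `Der(M_N(𝕆_n))`. -/
def Der (n N : ℕ) : Submodule ℂ (MatPS n N →ₗ[ℂ] MatPS n N) where
  carrier := {D | ∀ a b, D (a * b) = D a * b + a * D b}
  add_mem' := by
    intro D D' h h' a b
    simp only [LinearMap.add_apply, h a b, h' a b, add_mul, mul_add]
    abel
  zero_mem' := by intro a b; simp
  smul_mem' := by
    intro c D h a b
    simp only [LinearMap.smul_apply, h a b, smul_add, smul_mul_assoc, mul_smul_comm]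

/-- The coefficient of `x̂^I` in the `(i, j)` entry, as an `ℝ`-linear form on `M_N(𝕆_n)`. -/
def coeffEntry {n N : ℕ} (I : Fin n →₀ ℕ) (i j : Fin N) : MatPS n N →ₗ[ℝ] ℂ where
  toFun f := MvPowerSeries.coeff I (f i j)
  map_add' f g := by simp
  map_smul' c f := by
    rw [Matrix.smul_apply]
    rfl

/-! ### Taylor expansion of matrix valued functions on `ℝⁿ` -/

/-- `ℝⁿ`. -/
abbrev Eucl (n : ℕ) : Type := EuclideanSpace ℝ (Fin n)

abbrev Mat (N : ℕ) : Type := Matrix (Fin N) (Fin N) ℂ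

/-- `∂f / ∂xᵢ`. -/
def partialDeriv {n : ℕ} (i : Fin n) (f : Eucl n → ℂ) : Eucl n → ℂ :=
  fun y => fderiv ℝ f y (EuclideanSpace.single i 1)

/-- `∂^{|I|} f / ∂x^I`. -/
def multiDeriv {n : ℕ} (I : Fin n →₀ ℕ) (f : Eucl n → ℂ) : Eucl n → ℂ :=
  (List.finRange n).foldr (fun i g => (partialDeriv i)^[I i] g) f

/-- The Taylor series `∑_I (1 / I!) (∂^{|I|} a / ∂x^I)(y) x̂^I` of `a` at `y`. -/
def taylor {n N : ℕ} (a : Eucl n → Mat N) (y : Eucl n) : MatPS n N :=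
  Matrix.of fun i j => (fun I : Fin n →₀ ℕ =>
    (((∏ s, (I s).factorial : ℕ) : ℂ)⁻¹ * multiDeriv I (fun z => a z i j) y) : PS n)

/-! ### Completion of a not necessarily commutative algebra at a two-sided ideal -/

section InvLimit

variable {A : Type*} [Ring A] [Algebra ℂ A] (J : Ideal A) [J.IsTwoSided]

/-- The inverse limit over `k` of the algebras `A / J^k`. -/
def invLimit : Subalgebra ℂ (∀ k : ℕ, A ⧸ J ^ k) where
  carrier := {a | ∀ k l (h : k ≤ l),
    Ideal.Quotient.factorₐ ℂ (Ideal.pow_le_pow_right (I := J) h) (a l) = a k}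
  mul_mem' := by
    intro a b ha hb k l h
    rw [Pi.mul_apply, map_mul, ha k l h, hb k l h, Pi.mul_apply]
  add_mem' := by
    intro a b ha hb k l h
    rw [Pi.add_apply, map_add, ha k l h, hb k l h, Pi.add_apply]
  algebraMap_mem' := by
    intro c k l h
    rw [Pi.algebraMap_apply, AlgHom.commutes, Pi.algebraMap_apply]

/-- The canonical map from `A` to the inverse limit of the `A / J^k`. -/
def toInvLimit : A →ₐ[ℂ] invLimit J :=
  (AlgHom.pi fun k => Ideal.Quotient.mkₐ ℂ (J ^ k)).codRestrict (invLimit J)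
    (fun _ _ _ _ => rfl)

end InvLimit

/-! ### Smooth sections of `End(E)` and their jets -/

/-- The model fibre `ℂ^N`. -/
abbrev Fib (N : ℕ) : Type := Fin N → ℂ

section Bundle

variable {n N : ℕ} {M : Type*} [TopologicalSpace M] [ChartedSpace (Eucl n) M]
  (E : M → Type*) [∀ x, AddCommGroup (E x)] [∀ x, Module ℂ (E x)]
  [∀ x, TopologicalSpace (E x)] [TopologicalSpace (TotalSpace (Fib N) E)]
  [FiberBundle (Fib N) E] [VectorBundle ℂ (Fib N) E]

/-- The complex vector bundle `E` over the real manifold `M` is smooth: the coordinate changes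
between trivializations of its atlas are smooth functions with values in `End_ℂ(ℂ^N)`. -/
def IsSmoothBundle (n N : ℕ) {M : Type*} [TopologicalSpace M] [ChartedSpace (Eucl n) M]
    (E : M → Type*) [∀ x, AddCommGroup (E x)] [∀ x, Module ℂ (E x)]
    [∀ x, TopologicalSpace (E x)] [TopologicalSpace (TotalSpace (Fib N) E)]
    [FiberBundle (Fib N) E] [VectorBundle ℂ (Fib N) E] : Prop :=
  ∀ (e e' : Trivialization (Fib N) (π (Fib N) E))
    [MemTrivializationAtlas e] [MemTrivializationAtlas e'],
    ContMDiffOn (𝓡 n) 𝓘(ℝ, Fib N →L[ℂ] Fib N) ∞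
      (fun b : M => (e.coordChangeL ℂ e' b : Fib N →L[ℂ] Fib N)) (e.baseSet ∩ e'.baseSet)

variable [∀ x, IsTopologicalAddGroup (E x)] [∀ x, ContinuousSMul ℂ (E x)]

/-- The fibre of `End(E)` at `x`. -/
abbrev EndFib (x : M) : Type _ := E x →L[ℂ] E x

/-- Smoothness of a section of `End(E)`, as a map into the total space of Mathlib's bundle of
continuous linear maps. -/
def IsSmoothSection (n N : ℕ) {M : Type*} [TopologicalSpace M] [ChartedSpace (Eucl n) M]
    {E : M → Type*} [∀ x, AddCommGroup (E x)] [∀ x, Module ℂ (E x)]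
    [∀ x, TopologicalSpace (E x)] [TopologicalSpace (TotalSpace (Fib N) E)]
    [FiberBundle (Fib N) E] [VectorBundle ℂ (Fib N) E]
    [∀ x, IsTopologicalAddGroup (E x)] [∀ x, ContinuousSMul ℂ (E x)]
    (s : ∀ x, EndFib E x) : Prop :=
  ContMDiff (𝓡 n) ((𝓡 n).prod 𝓘(ℝ, Fib N →L[ℂ] Fib N)) ∞
    (fun x => TotalSpace.mk' (Fib N →L[ℂ] Fib N) (E := fun x => EndFib E x) x (s x))

variable {E} in
theorem isSmoothSection_iff (s : ∀ x, EndFib E x) :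
    IsSmoothSection n N s ↔ ∀ x₀ : M, ContMDiffAt (𝓡 n) 𝓘(ℝ, Fib N →L[ℂ] Fib N) ∞
      (fun x => ContinuousLinearMap.inCoordinates (Fib N) E (Fib N) E x₀ x x₀ x (s x)) x₀ := by
  unfold IsSmoothSection ContMDiff
  refine forall_congr' fun x₀ => ?_
  rw [Bundle.contMDiffAt_section]
  rfl

variable {E} in
theorem inCoordinates_mul (x₀ x : M) (hx : x ∈ (trivializationAt (Fib N) E x₀).baseSet)
    (s t : EndFib E x) :
    ContinuousLinearMap.inCoordinates (Fib N) E (Fib N) E x₀ x x₀ x (s * t) =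
      (ContinuousLinearMap.inCoordinates (Fib N) E (Fib N) E x₀ x x₀ x s).comp
        (ContinuousLinearMap.inCoordinates (Fib N) E (Fib N) E x₀ x x₀ x t) := by
  ext v : 1
  simp only [ContinuousLinearMap.inCoordinates, ContinuousLinearMap.comp_apply,
    mul_apply_eq_comp]
  rw [Trivialization.symmL_continuousLinearMapAt _ hx]

variable {E} in
theorem inCoordinates_algebraMap (x₀ x : M)
    (hx : x ∈ (trivializationAt (Fib N) E x₀).baseSet) (c : ℂ) :
    ContinuousLinearMap.inCoordinates (Fib N) E (Fib N) E x₀ x x₀ x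
      (algebraMap ℂ (EndFib E x) c) = algebraMap ℂ (Fib N →L[ℂ] Fib N) c := by
  ext v : 1
  simp [ContinuousLinearMap.inCoordinates, Algebra.algebraMap_eq_smul_one,
    Trivialization.continuousLinearMapAt_symmL _ hx]

variable (n N) in
/-- The algebra `Γ(End(E))` of smooth sections of `End(E)`. -/
def Sec : Subalgebra ℂ (∀ x, EndFib E x) where
  carrier := {s | IsSmoothSection n N s}
  mul_mem' := by
    intro s t hs ht
    rw [Set.mem_ofPred_eq, isSmoothSection_iff] at *
    intro x₀
    have h : ContMDiffAt (𝓡 n) 𝓘(ℝ, Fib N →L[ℂ] Fib N) ∞ (fun x =>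
        (ContinuousLinearMap.inCoordinates (Fib N) E (Fib N) E x₀ x x₀ x (s x)) *
        (ContinuousLinearMap.inCoordinates (Fib N) E (Fib N) E x₀ x x₀ x (t x))) x₀ :=
      (contDiff_mul.contDiffAt.contMDiffAt).comp x₀ ((hs x₀).prodMk_space (ht x₀))
    refine h.congr_of_eventuallyEq ?_
    filter_upwards [(trivializationAt (Fib N) E x₀).open_baseSet.mem_nhds
      (FiberBundle.mem_baseSet_trivializationAt (Fib N) E x₀)] with x hx
    exact inCoordinates_mul x₀ x hx (s x) (t x)
  add_mem' := by
    intro s t hs ht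
    rw [Set.mem_ofPred_eq, isSmoothSection_iff] at *
    intro x₀
    refine ((hs x₀).add (ht x₀)).congr_of_eventuallyEq (Filter.Eventually.of_forall fun x => ?_)
    ext v : 1
    simp [ContinuousLinearMap.inCoordinates]
  algebraMap_mem' := by
    intro c
    rw [Set.mem_ofPred_eq, isSmoothSection_iff]
    intro x₀
    refine (contMDiffAt_const (c := algebraMap ℂ (Fib N →L[ℂ] Fib N) c)).congr_of_eventuallyEq ?_
    filter_upwards [(trivializationAt (Fib N) E x₀).open_baseSet.mem_nhds
      (FiberBundle.mem_baseSet_trivializationAt (Fib N) E x₀)] with x hx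
    exact inCoordinates_algebraMap x₀ x hx c

variable (n N) in
/-- The ideal `I_m` of the sections of `End(E)` that vanish at `m`. -/
def vanIdeal (m : M) : Ideal (Sec n N E) :=
  RingHom.ker ((Pi.evalRingHom (EndFib E) m).comp (Sec n N E).subtype)

instance (m : M) : (vanIdeal n N E m).IsTwoSided := by
  unfold vanIdeal
  infer_instance

variable (n N) in
/-- `J_m End(E)`, the inverse limit over `k` of the algebras `Γ(End(E)) / I_m^k`. -/
abbrev Jet (m : M) : Subalgebra ℂ (∀ k : ℕ, Sec n N E ⧸ vanIdeal n N E m ^ k) :=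
  invLimit (vanIdeal n N E m)

variable (n N) in
/-- The quotient map `J_m : Γ(End(E)) → J_m End(E)`. -/
def jet (m : M) : Sec n N E →ₐ[ℂ] Jet n N E m :=
  toInvLimit (vanIdeal n N E m)

variable (n N) in
/-- The jets of the real scalar sections `h · 1`, `h : M → ℝ`. -/
def realJets (m : M) : Set (Jet n N E m) :=
  {a | ∀ k, ∃ γ : Sec n N E, (∃ h : M → ℝ, ∀ x, γ.1 x = (h x : ℂ) • (1 : EndFib E x)) ∧
    Ideal.Quotient.mk (vanIdeal n N E m ^ k) γ = a.1 k}

/-! ### The frame bundle -/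

variable (n N) in
/-- The fibre over `m` of the frame bundle `M̃_E`: isomorphisms `Φ : M_N(𝕆_n) ≃ J_m End(E)` of
topological algebras (adic topology, inverse limit topology), compatible with the real forms
`ℝ[[x̂]] · 1` and `{jets of real functions} · 1` of the centres. -/
structure Frame (m : M) where
  toEquiv : MatPS n N ≃ₐ[ℂ] Jet n N E m
  continuous : ∀ k, ∃ l, ∀ f ∈ adicNhd n N l, (toEquiv f).1 k = 0
  continuous_symm : ∀ k, ∃ l, ∀ a : Jet n N E m, a.1 l = 0 → toEquiv.symm a ∈ adicNhd n N k
  real : ∀ f, f ∈ Set.range (realScalar n N) ↔ toEquiv f ∈ realJets n N E m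

variable (n N) in
/-- The frame bundle `M̃_E = {(m, Φ)}`. -/
abbrev FrameBundle : Type _ := Σ m : M, Frame n N E m

theorem mem_range_realScalar_iff {g : MatPS n N ≃ₐ[ℂ] MatPS n N} (hg : g ∈ G n N)
    (f : MatPS n N) :
    g f ∈ Set.range (realScalar n N) ↔ f ∈ Set.range (realScalar n N) := by
  obtain ⟨-, -, θ, hθ⟩ := hg
  constructor
  · rintro ⟨r, hr⟩
    refine ⟨θ.symm r, g.injective ?_⟩
    rw [hθ, AlgEquiv.apply_symm_apply, hr]
  · rintro ⟨r, rfl⟩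
    exact ⟨θ r, (hθ r).symm⟩

variable {E} in
/-- The right action `Φ ↦ Φ ∘ g` of `G` on frames. -/
def Frame.comp {m : M} (Φ : Frame n N E m) (g : G n N) : Frame n N E m where
  toEquiv := g.1.trans Φ.toEquiv
  continuous k := by
    obtain ⟨l, hl⟩ := Φ.continuous k
    obtain ⟨p, hp⟩ := g.2.1 l
    exact ⟨p, fun f hf => hl _ (hp f hf)⟩
  continuous_symm k := by
    obtain ⟨l, hl⟩ := g.2.2.1 k
    obtain ⟨p, hp⟩ := Φ.continuous_symm l
    exact ⟨p, fun a ha => hl _ (hp a ha)⟩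
  real f := by
    rw [← mem_range_realScalar_iff g.2 f, Φ.real]
    rfl

variable (n N) in
/-- A local frame field `x ↦ (x, σ x)` is smooth on `U`: the profinite smooth structure of
`M̃_E` is the one whose coordinates, besides those of the base point, are the coefficients of
the series `Φ⁻¹(J_m γ)`, `γ ∈ Γ(End(E))`. -/
def SmoothFrameOn (σ : ∀ x : M, Frame n N E x) (U : Set M) : Prop :=
  ∀ (γ : Sec n N E) (I : Fin n →₀ ℕ) (i j : Fin N),
    ContMDiffOn (𝓡 n) 𝓘(ℝ, ℂ) ∞
      (fun x => coeffEntry I i j ((σ x).toEquiv.symm (jet n N E x γ))) U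

/-! ### The connection form `ω` -/

variable (n N) in
/-- A local trivialization `Φ̃ : M_N(C^∞(V)) → Γ(End(E)|_U)`: a chart `U ≃ V ⊆ ℝⁿ` together with
a smooth family of algebra isomorphisms `End(E_x) ≃ M_N(ℂ)`, `x ∈ U`. -/
structure LocalTriv where
  chart : OpenPartialHomeomorph M (Eucl n)
  chart_mem : chart ∈ IsManifold.maximalAtlas (𝓡 n) ∞ M
  fibre : ∀ x : M, EndFib E x ≃ₐ[ℂ] Mat N
  smooth : ∀ (γ : Sec n N E) (i j : Fin N),
    ContMDiffOn (𝓡 n) 𝓘(ℝ, ℂ) ∞ (fun x => fibre x (γ.1 x) i j) chart.source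

variable {E} in
/-- `Φ̃⁻¹(γ)`: the section `γ` read in the trivialization. -/
def LocalTriv.pull (Ψ : LocalTriv n N E) (γ : Sec n N E) : Eucl n → Mat N :=
  fun y => Ψ.fibre (Ψ.chart.symm y) (γ.1 (Ψ.chart.symm y))

variable {E} in
/-- The function `Φ̃⁻¹(Φ̃'(a))`, `a ∈ M_N(C^∞)`. -/
def LocalTriv.transition (Ψ Ψ' : LocalTriv n N E) (a : Eucl n → Mat N) : Eucl n → Mat N :=
  fun y => Ψ.fibre (Ψ.chart.symm y)
    ((Ψ'.fibre (Ψ.chart.symm y)).symm (a (Ψ'.chart (Ψ.chart.symm y))))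

variable {E} in
/-- The path of local trivializations `Φ̃_t` is smooth for `t` near `0`, maps `0` to `m_t`, and
lifts the path `c t = (m_t, Φ_t)` of frames: `Φ_t⁻¹(J_{m_t} γ) = J_0(Φ̃_t⁻¹ γ)`. -/
def IsLift (Ψ : ℝ → LocalTriv n N E) (c : ℝ → FrameBundle n N E) : Prop :=
  ∃ W : Set (ℝ × Eucl n), IsOpen W ∧ (0, 0) ∈ W ∧
    (∀ p ∈ W, p.2 ∈ (Ψ p.1).chart.target) ∧
    ContMDiffOn 𝓘(ℝ, ℝ × Eucl n) (𝓡 n) ∞ (fun p => (Ψ p.1).chart.symm p.2) W ∧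
    (∀ (γ : Sec n N E) (i j : Fin N),
      ContDiffOn ℝ ∞ (fun p : ℝ × Eucl n => (Ψ p.1).pull γ p.2 i j) W) ∧
    ∀ t : ℝ, (t, (0 : Eucl n)) ∈ W → (Ψ t).chart.symm 0 = (c t).1 ∧
      ∀ γ : Sec n N E,
        (c t).2.toEquiv.symm (jet n N E (c t).1 γ) = taylor ((Ψ t).pull γ) 0

variable {E} in
/-- `D = ω(ċ(0))`: for some lift `Φ̃_t` of the path `c` in `M̃_E`, `D` is the derivation
`J_0(a) ↦ J_0(d/dt|_{t = 0} Φ̃_0⁻¹(Φ̃_t(a)))`. -/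
def IsOmega (c : ℝ → FrameBundle n N E) (D : Der n N) : Prop :=
  ∃ Ψ : ℝ → LocalTriv n N E, IsLift Ψ c ∧
    ∀ a : Eucl n → Mat N, (∀ i j, ContDiff ℝ ∞ fun y => a y i j) →
      D.1 (taylor a 0) = taylor (fun y => Matrix.of fun i j =>
        deriv (fun t => (Ψ 0).transition (Ψ t) a y i j) 0) 0

variable {E} in
/-- `D = (σ^*ω)_x(v)` for a local frame field `σ`: `D = ω(d/dt|_{t = 0} σ(m_t))` for some path
`m_t` with `m_0 = x` and velocity `v` at `t = 0`. -/
def IsPullbackOmega (σ : ∀ x : M, Frame n N E x) (x : M) (v : TangentSpace (𝓡 n) x)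
    (D : Der n N) : Prop :=
  ∃ c : ℝ → M, ∃ h : c 0 = x,
    HasMFDerivAt 𝓘(ℝ, ℝ) (𝓡 n) c 0
      ((1 : ℝ →L[ℝ] ℝ).smulRight (h ▸ v : TangentSpace (𝓡 n) (c 0))) ∧
    IsOmega (fun t => ⟨c t, σ (c t)⟩) D

/-! ### The jet bundle and the forms with values in it -/

variable (n N) in
/-- The fibre over `m` of the associated bundle `JE = M̃_E ×_G M_N(𝕆_n)`.  The class
`[Φ, f] = [Φ ∘ g, g⁻¹ f]` is represented by the `G`-equivariant function `Φ ∘ g ↦ g⁻¹ f` on the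
frames at `m`. -/
def JE (m : M) : Subalgebra ℂ (Frame n N E m → MatPS n N) where
  carrier := {s | ∀ (Φ : Frame n N E m) (g : G n N), s (Φ.comp g) = g.1.symm (s Φ)}
  mul_mem' := by
    intro a b ha hb Φ g
    rw [Pi.mul_apply, ha, hb, Pi.mul_apply, map_mul]
  add_mem' := by
    intro a b ha hb Φ g
    rw [Pi.add_apply, ha, hb, Pi.add_apply, map_add]
  algebraMap_mem' := by
    intro c Φ g
    rw [Pi.algebraMap_apply, Pi.algebraMap_apply, AlgEquiv.commutes]

variable (n N) in
/-- The fibre over `m` of `M̃_E ×_G M_N(𝕆_n)` as a quotient set: pairs `(Φ, f)` modulo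
`(Φ, f) ∼ (Φ ∘ g, g⁻¹ f)`. -/
def BalancedFibre (m : M) : Type _ :=
  Quot fun p q : Frame n N E m × MatPS n N => ∃ g : G n N, q = (p.1.comp g, g.1.symm p.2)

variable (n N) in
/-- The comparison map `[Φ, f] ↦ (Φ' ↦ (Φ'⁻¹ ∘ Φ) f)`. -/
def BalancedFibre.toJE (m : M) : BalancedFibre n N E m → JE n N E m :=
  Quot.lift (fun p => ⟨fun Φ' => Φ'.toEquiv.symm (p.1.toEquiv p.2), fun _ _ => rfl⟩) (by
    rintro ⟨Φ, f⟩ _ ⟨g, rfl⟩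
    refine Subtype.ext (funext fun Φ' => ?_)
    change Φ'.toEquiv.symm (Φ.toEquiv f) = Φ'.toEquiv.symm (Φ.toEquiv (g.1 (g.1.symm f)))
    rw [AlgEquiv.apply_symm_apply])

theorem realScalar_injective (hN : 0 < N) : Function.Injective (realScalar n N) := by
  intro r s h
  have h0 := congrFun (congrFun h ⟨0, hN⟩) ⟨0, hN⟩
  simp only [realScalar, Matrix.scalar_apply, Matrix.diagonal_apply_eq] at h0
  ext I
  have h1 := congrArg (MvPowerSeries.coeff I) h0
  simpa using h1

variable {E} in
/-- `G` acts transitively on the frames at a point. -/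
theorem Frame.exists_comp_eq {m : M} (Φ Φ' : Frame n N E m) : ∃ g : G n N, Φ.comp g = Φ' := by
  let g : MatPS n N ≃ₐ[ℂ] MatPS n N := Φ'.toEquiv.trans Φ.toEquiv.symm
  have hmem : ∀ f, f ∈ Set.range (realScalar n N) ↔ g f ∈ Set.range (realScalar n N) := by
    intro f
    rw [Φ'.real, Φ.real]
    simp [g]
  have hg : g ∈ G n N := by
    refine ⟨fun k => ?_, fun k => ?_, ?_⟩
    · obtain ⟨l, hl⟩ := Φ.continuous_symm k
      obtain ⟨p, hp⟩ := Φ'.continuous l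
      exact ⟨p, fun f hf => hl _ (hp f hf)⟩
    · obtain ⟨l, hl⟩ := Φ'.continuous_symm k
      obtain ⟨p, hp⟩ := Φ.continuous l
      exact ⟨p, fun f hf => hl _ (hp f hf)⟩
    · rcases Nat.eq_zero_or_pos N with rfl | hN
      · exact ⟨AlgEquiv.refl, fun r => Subsingleton.elim _ _⟩
      · have hinj := realScalar_injective (n := n) hN
        choose θ hθ using fun r => (hmem (realScalar n N r)).1 ⟨r, rfl⟩
        let θ' : MvPowerSeries (Fin n) ℝ →ₐ[ℝ] MvPowerSeries (Fin n) ℝ :=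
          { toFun := θ
            map_one' := by
              apply hinj
              rw [hθ]
              simp [realScalar]
            map_mul' := fun r s => by
              apply hinj
              have h : ∀ r s, realScalar n N (r * s) = realScalar n N r * realScalar n N s := by
                intro r s
                simp [realScalar]
              rw [hθ, h, h, map_mul, hθ, hθ]
            map_zero' := by
              apply hinj
              rw [hθ]
              simp [realScalar]
            map_add' := fun r s => by
              apply hinj
              have h : ∀ r s, realScalar n N (r + s) = realScalar n N r + realScalar n N s := by
                intro r s
                simp [realScalar]
              rw [hθ, h, h, map_add, hθ, hθ]
            commutes' := fun c => by
              apply hinj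
              rw [hθ]
              have h : realScalar n N (algebraMap ℝ _ c) = algebraMap ℂ (MatPS n N) c := by
                ext i j : 2
                simp [realScalar, Matrix.algebraMap_matrix_apply, Matrix.diagonal_apply,
                  MvPowerSeries.algebraMap_apply]
              rw [h, AlgEquiv.commutes] }
        refine ⟨AlgEquiv.ofBijective θ' ⟨fun r s hrs => ?_, fun s => ?_⟩, fun r => (hθ r).symm⟩
        · apply hinj
          apply g.injective
          rw [← hθ, ← hθ]
          exact congrArg _ hrs
        · obtain ⟨r, hr⟩ := (hmem (g.symm (realScalar n N s))).2
            ⟨s, (AlgEquiv.apply_symm_apply _ _).symm⟩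
          refine ⟨r, hinj ?_⟩
          change realScalar n N (θ r) = _
          rw [hθ, hr, AlgEquiv.apply_symm_apply]
  refine ⟨⟨g, hg⟩, ?_⟩
  cases Φ'
  simp only [Frame.comp, Frame.mk.injEq]
  ext f : 1
  exact AlgEquiv.apply_symm_apply _ _

/-- As soon as there is a frame at `m`, the equivariant functions on the frames at `m` are the
same thing as the elements of the fibre over `m` of `M̃_E ×_G M_N(𝕆_n)`. -/
theorem BalancedFibre.toJE_bijective (m : M) [Nonempty (Frame n N E m)] :
    Function.Bijective (BalancedFibre.toJE n N E m) := by
  constructor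
  · rintro ⟨Φ, f⟩ ⟨Φ', f'⟩ h
    obtain ⟨g, rfl⟩ := Φ.exists_comp_eq Φ'
    have h1 := congrFun (congrArg Subtype.val h) Φ
    change Φ.toEquiv.symm (Φ.toEquiv f) = Φ.toEquiv.symm (Φ.toEquiv (g.1 f')) at h1
    rw [AlgEquiv.symm_apply_apply, AlgEquiv.symm_apply_apply] at h1
    refine Quot.sound ⟨g, ?_⟩
    rw [h1, AlgEquiv.symm_apply_apply]
  · intro s
    obtain ⟨Φ⟩ := ‹Nonempty (Frame n N E m)›
    refine ⟨Quot.mk _ (Φ, s.1 Φ), Subtype.ext (funext fun Φ' => ?_)⟩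
    obtain ⟨g, rfl⟩ := Φ.exists_comp_eq Φ'
    rw [s.2 Φ g]
    change g.1.symm (Φ.toEquiv.symm (Φ.toEquiv (s.1 Φ))) = _
    rw [AlgEquiv.symm_apply_apply]

variable (n) in
/-- Differential forms of degree `k` on `M`, without smoothness, with values in a family of
real vector spaces. -/
abbrev RoughForm {M : Type*} [TopologicalSpace M] [ChartedSpace (Eucl n) M]
    (V : M → Type*) [∀ x, AddCommGroup (V x)] [∀ x, Module ℝ (V x)] (k : ℕ) : Type _ :=
  ∀ x : M, (TangentSpace (𝓡 n) x) [⋀^Fin k]→ₗ[ℝ] V x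

end Bundle

/-- Alternating forms on `ℝⁿ` are continuous. -/
theorem continuous_alternating {n k : ℕ} (f : (Eucl n) [⋀^Fin k]→ₗ[ℝ] ℂ) : Continuous f := by
  have h : ∀ v : Fin k → Eucl n, f v = ∑ r : Fin k → Fin n, (∏ a, (v a) (r a)) •
      f (fun a => EuclideanSpace.single (r a) (1 : ℝ)) := by
    intro v
    have hv : v = fun a => ∑ s : Fin n, (v a) s • EuclideanSpace.single s (1 : ℝ) := by
      funext a
      ext t
      simp [Finset.sum_apply, Pi.single_apply]
    calc f v = f.toMultilinearMap
          (fun a => ∑ s : Fin n, (v a) s • EuclideanSpace.single s (1 : ℝ)) := by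
            rw [← hv]; rfl
      _ = _ := by
        rw [MultilinearMap.map_sum]
        refine Finset.sum_congr rfl fun r _ => ?_
        rw [MultilinearMap.map_smul_univ]
        rfl
  have h' : (f : (Fin k → Eucl n) → ℂ) = fun v => ∑ r : Fin k → Fin n,
      (∏ a, (v a) (r a)) • f (fun a => EuclideanSpace.single (r a) (1 : ℝ)) := funext h
  rw [h']
  fun_prop

/-- An alternating form on `ℝⁿ` as a continuous one. -/
def toCont {n k : ℕ} (f : (Eucl n) [⋀^Fin k]→ₗ[ℝ] ℂ) : (Eucl n) [⋀^Fin k]→L[ℝ] ℂ :=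
  { f with cont := continuous_alternating f }

section Forms

variable {n N : ℕ} {M : Type*} [TopologicalSpace M] [ChartedSpace (Eucl n) M]

/-- The complex valued form `β` in the chart at `x₀`, i.e. its pullback to `ℝⁿ` by the inverse
of the chart. -/
def chartForm {k : ℕ} (β : RoughForm n (fun _ : M => ℂ) k) (x₀ : M) (y : Eucl n) :
    (Eucl n) [⋀^Fin k]→L[ℝ] ℂ :=
  toCont ((β ((extChartAt (𝓡 n) x₀).symm y)).compLinearMap
    (mfderiv 𝓘(ℝ, Eucl n) (𝓡 n) (extChartAt (𝓡 n) x₀).symm y).toLinearMap)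

/-- Smoothness on the open set `U` of a complex valued form. -/
def SmoothFormOn {k : ℕ} (β : RoughForm n (fun _ : M => ℂ) k) (U : Set M) : Prop :=
  ∀ x₀ : M, ContDiffOn ℝ ∞ (chartForm β x₀)
    ((extChartAt (𝓡 n) x₀).target ∩ (extChartAt (𝓡 n) x₀).symm ⁻¹' U)

/-- The exterior derivative of a complex valued form, computed at `x` in the chart at `x`. -/
def extD {k : ℕ} (β : RoughForm n (fun _ : M => ℂ) k) : RoughForm n (fun _ : M => ℂ) (k + 1) :=
  fun x => (extDeriv (chartForm β x) (extChartAt (𝓡 n) x x)).toAlternatingMap.compLinearMap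
    (mfderiv (𝓡 n) 𝓘(ℝ, Eucl n) (extChartAt (𝓡 n) x) x).toLinearMap

variable (E : M → Type*) [∀ x, AddCommGroup (E x)] [∀ x, Module ℂ (E x)]
  [∀ x, TopologicalSpace (E x)] [TopologicalSpace (TotalSpace (Fib N) E)]
  [FiberBundle (Fib N) E] [VectorBundle ℂ (Fib N) E]
  [∀ x, IsTopologicalAddGroup (E x)] [∀ x, ContinuousSMul ℂ (E x)]

variable {E} in
/-- The `JE`-valued form `α` in the trivialization of `JE` given by the local frame field `σ`:
the coefficient of `x̂^I` in the `(i, j)` entry of this `M_N(𝕆_n)`-valued form. -/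
def coeffForm {k : ℕ} (α : RoughForm n (fun x => JE n N E x) k) (σ : ∀ x : M, Frame n N E x)
    (I : Fin n →₀ ℕ) (i j : Fin N) : RoughForm n (fun _ : M => ℂ) k :=
  fun x => (coeffEntry I i j ∘ₗ LinearMap.proj (R := ℝ) (σ x) ∘ₗ
    ((JE n N E x).val.toLinearMap.restrictScalars ℝ)).compAlternatingMap (α x)

theorem chartForm_add {k : ℕ} (β β' : RoughForm n (fun _ : M => ℂ) k) (x₀ : M) :
    chartForm (β + β') x₀ = chartForm β x₀ + chartForm β' x₀ := rfl

theorem chartForm_smul {k : ℕ} (c : ℂ) (β : RoughForm n (fun _ : M => ℂ) k) (x₀ : M) :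
    chartForm (c • β) x₀ = c • chartForm β x₀ := rfl

variable {E} in
theorem coeffForm_smul {k : ℕ} (c : ℂ) (α : RoughForm n (fun x => JE n N E x) k)
    (σ : ∀ x : M, Frame n N E x) (I : Fin n →₀ ℕ) (i j : Fin N) :
    coeffForm (c • α) σ I i j = c • coeffForm α σ I i j := rfl

variable (n N) in
/-- `Ω^k(M, JE)`: the `JE`-valued `k`-forms that are smooth, coefficient by coefficient, in
every smooth local trivialization of `JE`. -/
def Omega (k : ℕ) : Submodule ℂ (RoughForm n (fun x => JE n N E x) k) where
  carrier := {α | ∀ (U : Set M) (σ : ∀ x : M, Frame n N E x), IsOpen U →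
    SmoothFrameOn n N E σ U → ∀ I i j, SmoothFormOn (coeffForm α σ I i j) U}
  add_mem' := by
    intro α β hα hβ U σ hU hσ I i j x₀
    exact (hα U σ hU hσ I i j x₀).add (hβ U σ hU hσ I i j x₀)
  zero_mem' := by
    intro U σ hU hσ I i j x₀
    have h : chartForm (coeffForm (0 : RoughForm n (fun x => JE n N E x) k) σ I i j) x₀ =
        fun _ => 0 := by
      funext y
      ext v
      exact map_zero (coeffEntry I i j)
    rw [h]
    exact contDiffOn_const
  smul_mem' := by
    intro c α hα U σ hU hσ I i j x₀
    rw [coeffForm_smul, chartForm_smul]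
    exact contDiffOn_const.smul (hα U σ hU hσ I i j x₀)

variable {E} in
/-- The value on tangent vectors `v₀, …, v_k` of `σ^*ω ∧ α_σ`, where `A x = (σ^*ω)_x` and `α_σ`
is the `JE`-valued `k`-form `α` in the trivialization of `JE` given by `σ`. -/
def wedge {k : ℕ} (A : ∀ x : M, TangentSpace (𝓡 n) x → Der n N)
    (α : RoughForm n (fun x => JE n N E x) k) (σ : ∀ x : M, Frame n N E x) (x : M)
    (v : Fin (k + 1) → TangentSpace (𝓡 n) x) : MatPS n N :=
  ∑ a : Fin (k + 1), (-1 : ℂ) ^ (a : ℕ) •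
    (A x (v a)).1 ((α x fun b => v (a.succAbove b)).1 (σ x))

variable (n N) in
/-- `∇` is the connection on `JE` induced by `ω`, extended to `JE`-valued forms: in the
trivialization of `JE` given by any smooth local frame field `σ` on an open set `U`,
`∇ = d + σ^*ω`. -/
def IsInducedConnection (nabla : ∀ k : ℕ, Omega n N E k →ₗ[ℂ] Omega n N E (k + 1)) : Prop :=
  ∀ (k : ℕ) (α : Omega n N E k) (U : Set M) (σ : ∀ x : M, Frame n N E x)
    (A : ∀ x : M, TangentSpace (𝓡 n) x → Der n N),
    IsOpen U → SmoothFrameOn n N E σ U → (∀ x ∈ U, ∀ v, IsPullbackOmega σ x v (A x v)) →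
    ∀ x ∈ U, ∀ (v : Fin (k + 1) → TangentSpace (𝓡 n) x) (I : Fin n →₀ ℕ) (i j : Fin N),
      coeffEntry I i j (((nabla k α).1 x v).1 (σ x)) =
        extD (coeffForm α.1 σ I i j) x v + coeffEntry I i j (wedge A α.1 σ x v)

end Forms

end EndJet

end

noncomputable section

namespace EndJet

/-! ### Matrices of power series -/

section Series

variable {n N : ℕ}

/-! Near a point, a chart and a trivialization of `E` give a smooth frame field: Taylor expansion at
the moving base point (`stdFrame`). A path in it is lifted by translating the chart, and
differentiating the lift gives `σ^*ω(v) = -∂_v` in the formal variables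
(`isPullbackOmega_stdFrame`). In this frame field the connection is therefore `∇ = ∑_s dx_s (∂/∂x_s
- ∂/∂x̂_s)`. A section of `JE` is parallel when its derivative in the base point equals its
derivative in the formal variables, and then it is the family of Taylor series of its constant terms
(`IsParallelOn.eq_taylor`). This gives the statement in degree 0.

That Taylor expansion provides frames at all rests on Hadamard's lemma: `I_m ^ k` consists exactly
of the sections whose Taylor series at `m` has order at least `k` (`mem_vanIdeal_pow_iff`). Since
Taylor expansion is also onto modulo every order, it identifies the completion with `M_N(𝕆_n)`
(`exists_equiv_invLimit`).

Independence of the frame field comes from one fact: for every smooth frame field and every lift,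
`σ^*ω(v)` maps the jet of a section to minus the `v`-derivative of its coefficients
(`IsPullbackOmega.apply_jet`). Hence `d + σ^*ω` kills jets of sections. Modulo terms of degree at
least `d`, a smooth form is locally a finite sum `∑ β_r ⊗ J(γ_r)` with scalar forms `β_r` and global
sections `γ_r` (`locDecomp_of_mem_omega`), and `d + σ^*ω` maps it to `∑ dβ_r ⊗ J(γ_r)`. Only one
degree of precision is lost, because derivations lower the order by at most one (`Der.map_adicSub`).
As `G` preserves the adic filtration (`map_adicSub_of_mem_G`), this description does not involve the
frame. Smoothness, linearity and `∇² = 0` are read off from it with `d` arbitrarily large, since a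
series of infinite order is zero. Uniqueness holds because the standard frame fields, in which
`σ^*ω` is known, cover `M`.

For exactness, write `∇ = d - K` locally, with `K = ∑_s dx_s ∂/∂x̂_s` the Koszul (formal de Rham)
differential. Contraction with the Euler field inverts `K` on `K`-closed forms of positive degree
(`koszul_koszulHom`), so `dβ - Kβ = α` can be solved degree by degree in `x̂` (`exists_primitive`).
Local primitives are glued with a partition of unity acting through its jets. Jets are parallel, so
no correction terms appear (`LocDecomp.nabRough_mulForm`). -/

theorem mem_adicNhd {k : ℕ} {f : MatPS n N} :
    f ∈ adicNhd n N k ↔ ∀ i j (I : Fin n →₀ ℕ), I.degree < k →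
      MvPowerSeries.coeff I (f i j) = 0 := by
  constructor
  · intro h i j I hI
    exact MvPowerSeries.coeff_of_lt_order (lt_of_lt_of_le (by exact_mod_cast hI) (h i j))
  · intro h i j
    exact MvPowerSeries.nat_le_order (h i j)

variable (n N) in
/-- The neighbourhood `adicNhd n N k` as a submodule. -/
def adicSub (k : ℕ) : Submodule ℂ (MatPS n N) where
  carrier := adicNhd n N k
  add_mem' := by
    intro f g hf hg
    rw [mem_adicNhd] at *
    intro i j I hI
    rw [Matrix.add_apply, map_add, hf i j I hI, hg i j I hI, add_zero]
  zero_mem' := by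
    rw [mem_adicNhd]
    intro i j I hI
    simp
  smul_mem' := by
    intro c f hf
    rw [mem_adicNhd] at *
    intro i j I hI
    rw [Matrix.smul_apply, MvPowerSeries.coeff_smul, hf i j I hI, mul_zero]

theorem mem_adicSub {k : ℕ} {f : MatPS n N} : f ∈ adicSub n N k ↔ f ∈ adicNhd n N k := Iff.rfl

theorem mem_adicSub_iff {k : ℕ} {f : MatPS n N} :
    f ∈ adicSub n N k ↔ ∀ i j (I : Fin n →₀ ℕ), I.degree < k →
      MvPowerSeries.coeff I (f i j) = 0 := mem_adicNhd

theorem adicSub_anti {k l : ℕ} (h : k ≤ l) : adicSub n N l ≤ adicSub n N k := by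
  intro f hf
  rw [mem_adicSub_iff] at *
  exact fun i j I hI => hf i j I (hI.trans_le h)

theorem mem_adicSub_zero (f : MatPS n N) : f ∈ adicSub n N 0 := by
  rw [mem_adicSub_iff]
  exact fun i j I hI => absurd hI (Nat.not_lt_zero _)

theorem eq_zero_of_forall_mem_adicSub {f : MatPS n N} (h : ∀ k, f ∈ adicSub n N k) : f = 0 := by
  ext i j I
  exact mem_adicSub_iff.1 (h (I.degree + 1)) i j I (Nat.lt_succ_self _)

theorem mul_mem_adicSub {k l : ℕ} {f g : MatPS n N} (hf : f ∈ adicSub n N k)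
    (hg : g ∈ adicSub n N l) : f * g ∈ adicSub n N (k + l) := by
  intro i j
  rw [Matrix.mul_apply]
  refine MvPowerSeries.nat_le_order fun I hI => ?_
  rw [map_sum]
  refine Finset.sum_eq_zero fun a _ => MvPowerSeries.coeff_of_lt_order ?_
  refine lt_of_lt_of_le ?_ (MvPowerSeries.le_order_mul (f := f i a) (g := g a j))
  refine lt_of_lt_of_le ?_ (add_le_add (hf i a) (hg a j))
  exact_mod_cast hI

theorem mul_mem_adicSub_left {k : ℕ} {f g : MatPS n N} (hf : f ∈ adicSub n N k) :
    f * g ∈ adicSub n N k := mul_mem_adicSub hf (mem_adicSub_zero g)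

theorem mul_mem_adicSub_right {k : ℕ} {f g : MatPS n N} (hg : g ∈ adicSub n N k) :
    f * g ∈ adicSub n N k := by
  simpa using mul_mem_adicSub (mem_adicSub_zero f) hg

theorem realScalar_X_mul_apply (s : Fin n) (f : MatPS n N) (i j : Fin N) :
    (realScalar n N (MvPowerSeries.X s) * f) i j = MvPowerSeries.X s * f i j := by
  simp [realScalar, Matrix.diagonal_mul]

theorem realScalar_X_mem (s : Fin n) :
    realScalar n N (MvPowerSeries.X s) ∈ adicSub n N 1 := by
  rw [mem_adicSub_iff]
  intro i j I hI
  have hI : I = 0 := by rw [← Finsupp.degree_eq_zero_iff]; omega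
  subst hI
  simp only [realScalar, MvPowerSeries.map_X, Matrix.scalar_apply, Matrix.diagonal_apply]
  split_ifs <;> simp

/-- The power series with given coefficients. -/
def mkPS {R : Type*} (c : (Fin n →₀ ℕ) → R) : MvPowerSeries (Fin n) R := c

theorem coeff_mkPS {R : Type*} [Semiring R] (c : (Fin n →₀ ℕ) → R) (I : Fin n →₀ ℕ) :
    MvPowerSeries.coeff I (mkPS c) = c I := rfl

/-- Hadamard's lemma for power series. -/
theorem exists_eq_sum_X_mul {k : ℕ} {f : MatPS n N} (hf : f ∈ adicSub n N (k + 1)) :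
    ∃ h : Fin n → MatPS n N, (∀ s, h s ∈ adicSub n N k) ∧
      f = ∑ s, realScalar n N (MvPowerSeries.X s) * h s := by
  classical
  -- Each non-constant monomial is assigned to the first variable occurring in it: `p I s` says that
  -- `s` is that variable. The series `h s` collects the monomials assigned to `s`, divided by
  -- `x̂_s`, so no monomial is counted twice.
  let p : (Fin n →₀ ℕ) → Fin n → Prop := fun I s => I s ≠ 0 ∧ ∀ t < s, I t = 0
  refine ⟨fun s => Matrix.of fun i j => mkPS fun J => if p (J + Finsupp.single s 1) s then
    MvPowerSeries.coeff (J + Finsupp.single s 1) (f i j) else 0, fun s => ?_, ?_⟩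
  · rw [mem_adicSub_iff]
    intro i j I hI
    change (if _ then _ else _) = (0 : ℂ)
    split_ifs
    · refine mem_adicSub_iff.1 hf i j _ ?_
      simp [hI]
    · rfl
  · ext i j I
    rw [Matrix.sum_apply, map_sum]
    simp only [realScalar_X_mul_apply]
    have hco : ∀ s : Fin n, MvPowerSeries.coeff I (MvPowerSeries.X s *
        mkPS fun J => if p (J + Finsupp.single s 1) s then
        MvPowerSeries.coeff (J + Finsupp.single s 1) (f i j) else 0) =
        if p I s then MvPowerSeries.coeff I (f i j) else 0 := by
      intro s
      rw [MvPowerSeries.X, MvPowerSeries.coeff_monomial_mul]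
      by_cases hs : Finsupp.single s 1 ≤ I
      · rw [if_pos hs, one_mul]
        change (if p (I - Finsupp.single s 1 + Finsupp.single s 1) s then
          MvPowerSeries.coeff (I - Finsupp.single s 1 + Finsupp.single s 1) (f i j) else 0) = _
        rw [tsub_add_cancel_of_le hs]
      · rw [if_neg hs, if_neg]
        intro h
        apply hs
        rw [Finsupp.single_le_iff]
        exact Nat.one_le_iff_ne_zero.2 h.1
    simp only [Matrix.of_apply]
    rw [Finset.sum_congr rfl fun s _ => hco s]
    by_cases hI : I = 0
    · subst hI
      have h0 : MvPowerSeries.coeff 0 (f i j) = 0 := mem_adicSub_iff.1 hf i j 0 (by simp)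
      simp [h0]
    · obtain ⟨s, hs⟩ : ∃ s, p I s := by
        have hne : ∃ s, I s ≠ 0 := by
          by_contra hcon
          push Not at hcon
          exact hI (Finsupp.ext hcon)
        let S : Finset (Fin n) := Finset.univ.filter fun s => I s ≠ 0
        have hS : S.Nonempty := by
          obtain ⟨s, hs⟩ := hne
          exact ⟨s, by simp [S, hs]⟩
        refine ⟨S.min' hS, ?_, fun t ht => ?_⟩
        · have := S.min'_mem hS
          simpa [S] using this
        · by_contra hcon
          have : S.min' hS ≤ t := S.min'_le t (by simp [S, hcon])
          exact absurd ht (not_lt.2 this)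
      rw [Finset.sum_eq_single s]
      · rw [if_pos hs]
      · intro t _ hts
        rw [if_neg]
        intro ht
        rcases lt_trichotomy t s with h | h | h
        · exact ht.1 (hs.2 t h)
        · exact hts h
        · exact hs.1 (ht.2 s h)
      · simp

/-! ### The adic filtration under derivations and automorphisms -/

/-- Derivations lower the adic filtration by at most one. -/
theorem Der.map_adicSub (D : Der n N) {k : ℕ} {f : MatPS n N} (hf : f ∈ adicSub n N (k + 1)) :
    D.1 f ∈ adicSub n N k := by
  -- In `D(x̂_s h) = D(x̂_s) h + x̂_s D(h)` the first term keeps the order of `h`, and in the second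
  -- the factor `x̂_s` makes up for the order lost by `D(h)`. Continuity of `D` is not needed.
  induction k generalizing f with
  | zero => exact mem_adicSub_zero _
  | succ k ih =>
    obtain ⟨h, hh, rfl⟩ := exists_eq_sum_X_mul hf
    rw [map_sum]
    refine Submodule.sum_mem _ fun s _ => ?_
    rw [D.2]
    refine Submodule.add_mem _ (mul_mem_adicSub_right (hh s)) ?_
    rw [add_comm k 1]
    exact mul_mem_adicSub (realScalar_X_mem s) (ih (hh s))

theorem realScalar_pow (r : MvPowerSeries (Fin n) ℝ) (k : ℕ) :
    realScalar n N r ^ k = realScalar n N (r ^ k) := by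
  simp [realScalar, Matrix.diagonal_pow, Pi.pow_def]

theorem realScalar_mem_adicSub_one {r : MvPowerSeries (Fin n) ℝ}
    (h : MvPowerSeries.coeff 0 r = 0) : realScalar n N r ∈ adicSub n N 1 := by
  rw [mem_adicSub_iff]
  intro i j I hI
  have hI : I = 0 := by rw [← Finsupp.degree_eq_zero_iff]; omega
  subst hI
  simp only [realScalar, Matrix.scalar_apply, Matrix.diagonal_apply]
  split_ifs
  · rw [MvPowerSeries.coeff_map, h, map_zero]
  · simp

/-- Elements of `G` preserve the adic filtration. -/
theorem map_adicSub_of_mem_G {g : MatPS n N ≃ₐ[ℂ] MatPS n N} (hg : g ∈ G n N) {k : ℕ}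
    {f : MatPS n N} (hf : f ∈ adicSub n N k) : g f ∈ adicSub n N k := by
  obtain ⟨hc, -, θ, hθ⟩ := hg
  -- By continuity some power of `g(x̂_s)` has zero constant term. That term is a power of the real
  -- constant term of `θ(x̂_s)`, which therefore vanishes.
  have hX : ∀ s, g (realScalar n N (MvPowerSeries.X s)) ∈ adicSub n N 1 := by
    intro s
    rcases Nat.eq_zero_or_pos N with rfl | hN
    · rw [mem_adicSub_iff]
      exact fun i => i.elim0
    rw [hθ]
    apply realScalar_mem_adicSub_one
    obtain ⟨l, hl⟩ := hc 1
    have h1 : realScalar n N (MvPowerSeries.X s) ^ l ∈ adicSub n N l := by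
      clear hl
      induction l with
      | zero => exact mem_adicSub_zero _
      | succ l ih => rw [pow_succ]; exact mul_mem_adicSub ih (realScalar_X_mem s)
    have h2 : g (realScalar n N (MvPowerSeries.X s) ^ l) ∈ adicSub n N 1 := hl _ h1
    rw [map_pow, hθ, realScalar_pow] at h2
    have h3 := mem_adicSub_iff.1 h2 ⟨0, hN⟩ ⟨0, hN⟩ 0 (by simp)
    simp only [realScalar, Matrix.scalar_apply, Matrix.diagonal_apply_eq,
      MvPowerSeries.coeff_map] at h3
    simp only [MvPowerSeries.coeff_zero_eq_constantCoeff, map_pow, Complex.coe_algebraMap] at h3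
    have h4 : (MvPowerSeries.constantCoeff (θ (MvPowerSeries.X s))) ^ l = (0 : ℝ) := by
      exact_mod_cast h3
    simpa using eq_zero_of_pow_eq_zero h4
  induction k generalizing f with
  | zero => exact mem_adicSub_zero _
  | succ k ih =>
    obtain ⟨h, hh, rfl⟩ := exists_eq_sum_X_mul hf
    rw [map_sum]
    refine Submodule.sum_mem _ fun s _ => ?_
    rw [map_mul, add_comm k 1]
    exact mul_mem_adicSub (hX s) (ih (hh s))

/-! ### Monomials and truncation -/

/-- The multi-indices of degree less than `k`. -/
def degLT (n k : ℕ) : Finset (Fin n →₀ ℕ) :=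
  (Finset.range k).biUnion fun d => Finset.finsuppAntidiag Finset.univ d

theorem mem_degLT {k : ℕ} {I : Fin n →₀ ℕ} : I ∈ degLT n k ↔ I.degree < k := by
  simp [degLT, Finset.mem_finsuppAntidiag, Finsupp.degree_eq_sum]

/-- The matrix unit `(a, b)` times `x̂^J`. -/
def unitMonomial (J : Fin n →₀ ℕ) (a b : Fin N) : MatPS n N :=
  Matrix.single a b (MvPowerSeries.monomial J 1)

theorem coeff_unitMonomial (J I : Fin n →₀ ℕ) (a b i j : Fin N) :
    MvPowerSeries.coeff I ((unitMonomial J a b : MatPS n N) i j) =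
      if I = J ∧ a = i ∧ b = j then 1 else 0 := by
  classical
  simp only [unitMonomial, Matrix.single_apply]
  split_ifs with h1 h2 h2 <;> simp_all [MvPowerSeries.coeff_monomial]

/-- The truncation of `f`. -/
def truncMat (k : ℕ) (f : MatPS n N) : MatPS n N :=
  ∑ J ∈ degLT n k, ∑ a, ∑ b, MvPowerSeries.coeff J (f a b) • unitMonomial J a b

theorem coeff_truncMat (k : ℕ) (f : MatPS n N) (I : Fin n →₀ ℕ) (i j : Fin N) :
    MvPowerSeries.coeff I (truncMat k f i j) =
      if I.degree < k then MvPowerSeries.coeff I (f i j) else 0 := by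
  classical
  simp only [truncMat, Matrix.sum_apply, map_sum, Matrix.smul_apply, MvPowerSeries.coeff_smul,
    coeff_unitMonomial]
  have h1 : ∀ J : Fin n →₀ ℕ, ∑ a, ∑ b, MvPowerSeries.coeff J (f a b) *
      (if I = J ∧ a = i ∧ b = j then (1 : ℂ) else 0) =
      if I = J then MvPowerSeries.coeff I (f i j) else 0 := by
    intro J
    rw [Finset.sum_eq_single i, Finset.sum_eq_single j]
    · by_cases h : I = J
      · subst h; simp
      · simp [h]
    · intro b _ hb; simp [hb]
    · simp
    · intro a _ ha; simp [ha]
    · simp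
  rw [Finset.sum_congr rfl fun J _ => h1 J, Finset.sum_ite_eq]
  simp only [mem_degLT]

theorem sub_truncMat_mem (k : ℕ) (f : MatPS n N) : f - truncMat k f ∈ adicSub n N k := by
  rw [mem_adicSub_iff]
  intro i j I hI
  rw [Matrix.sub_apply, map_sub, coeff_truncMat, if_pos hI, sub_self]

/-! ### Formal partial derivatives -/

/-- `∂ / ∂x̂_s`, entry by entry. -/
def matPderiv (s : Fin n) : MatPS n N →ₗ[ℂ] MatPS n N where
  toFun f := Matrix.of fun i j => MvPowerSeries.pderiv ℂ s (f i j)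
  map_add' f g := Matrix.ext fun i j => by simp
  map_smul' c f := Matrix.ext fun i j => (MvPowerSeries.pderiv ℂ s).map_smul c (f i j)

theorem coeff_matPderiv (s : Fin n) (f : MatPS n N) (I : Fin n →₀ ℕ) (i j : Fin N) :
    MvPowerSeries.coeff I (matPderiv s f i j) =
      ((I s : ℂ) + 1) * MvPowerSeries.coeff (I + Finsupp.single s 1) (f i j) := by
  change MvPowerSeries.coeff I (MvPowerSeries.pderiv ℂ s (f i j)) = _
  rw [MvPowerSeries.coeff_pderiv, mul_comm]

theorem matPderiv_mul (s : Fin n) (f g : MatPS n N) :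
    matPderiv s (f * g) = matPderiv s f * g + f * matPderiv s g := by
  refine Matrix.ext fun i j => ?_
  change MvPowerSeries.pderiv ℂ s ((f * g) i j) = (matPderiv s f * g) i j + (f * matPderiv s g) i j
  simp only [Matrix.mul_apply, map_sum, Derivation.leibniz]
  rw [← Finset.sum_add_distrib]
  refine Finset.sum_congr rfl fun a _ => ?_
  change f i a * MvPowerSeries.pderiv ℂ s (g a j) + g a j * MvPowerSeries.pderiv ℂ s (f i a) =
    MvPowerSeries.pderiv ℂ s (f i a) * g a j + f i a * MvPowerSeries.pderiv ℂ s (g a j)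
  ring

/-- The derivation `-∂_v`. -/
def negDirDer (n N : ℕ) (v : Eucl n) : Der n N :=
  ⟨-∑ s, (v s : ℂ) • matPderiv s, by
    intro a b
    simp only [LinearMap.neg_apply, LinearMap.sum_apply, LinearMap.smul_apply, matPderiv_mul,
      smul_add, Finset.sum_add_distrib, neg_add, neg_mul, mul_neg, Finset.sum_mul,
      Finset.mul_sum, smul_mul_assoc, mul_smul_comm]⟩

theorem coeff_negDirDer (v : Eucl n) (f : MatPS n N) (I : Fin n →₀ ℕ) (i j : Fin N) :
    MvPowerSeries.coeff I ((negDirDer n N v).1 f i j) =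
      -∑ s, (v s : ℂ) * (((I s : ℂ) + 1) *
        MvPowerSeries.coeff (I + Finsupp.single s 1) (f i j)) := by
  have h : (negDirDer n N v).1 f = -∑ s, (v s : ℂ) • matPderiv s f := by
    simp [negDirDer, LinearMap.sum_apply]
  rw [h, Matrix.neg_apply, map_neg, Matrix.sum_apply, map_sum]
  congr 1
  refine Finset.sum_congr rfl fun s _ => ?_
  rw [Matrix.smul_apply, MvPowerSeries.coeff_smul, coeff_matPderiv]

theorem coeffEntry_apply (I : Fin n →₀ ℕ) (i j : Fin N) (f : MatPS n N) :
    coeffEntry I i j f = MvPowerSeries.coeff I (f i j) := rfl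

theorem matPS_ext {f g : MatPS n N} (h : ∀ I i j, coeffEntry I i j f = coeffEntry I i j g) :
    f = g := by
  ext i j I
  exact h I i j

theorem coeffEntry_smul (c : ℂ) (I : Fin n →₀ ℕ) (i j : Fin N) (f : MatPS n N) :
    coeffEntry I i j (c • f) = c * coeffEntry I i j f := by
  rw [coeffEntry_apply, Matrix.smul_apply, MvPowerSeries.coeff_smul]
  rfl

theorem coeffEntry_eq_of_sub_mem {k : ℕ} {f g : MatPS n N} (h : f - g ∈ adicSub n N k)
    {I : Fin n →₀ ℕ} (hI : I.degree < k) (i j : Fin N) :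
    coeffEntry I i j f = coeffEntry I i j g := by
  have := mem_adicSub_iff.1 h i j I hI
  rw [Matrix.sub_apply, map_sub, sub_eq_zero] at this
  exact this

end Series

/-! ### Identification of a completion with the matrices of power series -/

section Completion

variable {n N : ℕ} {A : Type*} [Ring A] [Algebra ℂ A] (J : Ideal A) [J.IsTwoSided]
  (T : A →ₐ[ℂ] MatPS n N)

/-- If `T : A → M_N(𝕆_n)` has dense image and `J ^ k` is the preimage of the `k`-th power of the
maximal ideal, then `T` identifies the completion of `A` with `M_N(𝕆_n)`. -/
theorem exists_equiv_invLimit (hT : ∀ k a, T a ∈ adicSub n N k ↔ a ∈ J ^ k)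
    (hd : ∀ k f, ∃ a, T a - f ∈ adicSub n N k) :
    ∃ e : MatPS n N ≃ₐ[ℂ] invLimit J,
      (∀ a, e (T a) = toInvLimit J a) ∧
      (∀ k f a, T a - f ∈ adicSub n N k ↔ (e f).1 k = Ideal.Quotient.mk (J ^ k) a) ∧
      ∀ k f, (e f).1 k = 0 ↔ f ∈ adicSub n N k := by
  choose r hr using hd
  have hmk : ∀ k a b, Ideal.Quotient.mk (J ^ k) a = Ideal.Quotient.mk (J ^ k) b ↔
      T a - T b ∈ adicSub n N k := by
    intro k a b
    rw [Ideal.Quotient.eq, ← hT, map_sub]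
  -- The class of `r k f` in `A / J ^ k` does not depend on the choice of an element approximating
  -- `f` to order `k`. All algebraic properties of the map `F` follow by exhibiting another such
  -- element.
  have key : ∀ k f a, T a - f ∈ adicSub n N k →
      Ideal.Quotient.mk (J ^ k) (r k f) = Ideal.Quotient.mk (J ^ k) a := by
    intro k f a ha
    rw [hmk]
    have := Submodule.sub_mem _ (hr k f) ha
    rwa [sub_sub_sub_cancel_right] at this
  let F : MatPS n N →ₐ[ℂ] invLimit J :=
    { toFun := fun f => ⟨fun k => Ideal.Quotient.mk (J ^ k) (r k f), fun k l h => by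
        change Ideal.Quotient.mk (J ^ k) (r l f) = _
        exact (key k f _ (adicSub_anti h (hr l f))).symm⟩
      map_one' := by
        refine Subtype.ext (funext fun k => ?_)
        refine (key k 1 1 ?_).trans rfl
        simp
      map_mul' := fun f g => by
        refine Subtype.ext (funext fun k => ?_)
        refine (key k (f * g) (r k f * r k g) ?_).trans rfl
        have : T (r k f * r k g) - f * g = (T (r k f) - f) * T (r k g) + f * (T (r k g) - g) := by
          rw [map_mul]; noncomm_ring
        rw [this]
        exact Submodule.add_mem _ (mul_mem_adicSub_left (hr k f)) (mul_mem_adicSub_right (hr k g))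
      map_zero' := by
        refine Subtype.ext (funext fun k => ?_)
        refine (key k 0 0 ?_).trans (map_zero _)
        simp
      map_add' := fun f g => by
        refine Subtype.ext (funext fun k => ?_)
        refine (key k (f + g) (r k f + r k g) ?_).trans (map_add _ _ _)
        rw [map_add, add_sub_add_comm]
        exact Submodule.add_mem _ (hr k f) (hr k g)
      commutes' := fun c => by
        refine Subtype.ext (funext fun k => ?_)
        refine (key k _ (algebraMap ℂ A c) ?_).trans rfl
        simp }
  have hF : ∀ k f, (F f).1 k = Ideal.Quotient.mk (J ^ k) (r k f) := fun _ _ => rfl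
  have hF0 : ∀ k f, (F f).1 k = 0 ↔ f ∈ adicSub n N k := by
    intro k f
    rw [hF, ← map_zero (Ideal.Quotient.mk (J ^ k)), hmk, map_zero, sub_zero]
    constructor
    · intro h
      have := Submodule.sub_mem _ h (hr k f)
      rwa [sub_sub_cancel] at this
    · intro h
      have := Submodule.add_mem _ (hr k f) h
      rwa [sub_add_cancel] at this
  refine ⟨AlgEquiv.ofBijective F ⟨?_, ?_⟩, fun a => ?_, fun k f a => ⟨key k f a, fun h => ?_⟩, hF0⟩
  · rw [injective_iff_map_eq_zero]
    intro f hf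
    refine eq_zero_of_forall_mem_adicSub fun k => (hF0 k f).1 ?_
    rw [hf]
    rfl
  · intro a
    choose γ hγ using fun k => Ideal.Quotient.mk_surjective (a.1 k)
    have hcomp : ∀ k l, k ≤ l → T (γ l) - T (γ k) ∈ adicSub n N k := by
      intro k l h
      rw [← hmk, hγ k, ← a.2 k l h, ← hγ l]
      rfl
    -- The coefficients of `T (γ k)` in degree less than `k` do not change for larger indices. The
    -- one at `I` is read at index `|I| + 1`, the first where it is settled.
    let f : MatPS n N := Matrix.of fun i j => mkPS fun I =>
      MvPowerSeries.coeff I (T (γ (I.degree + 1)) i j)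
    refine ⟨f, Subtype.ext (funext fun k => ?_)⟩
    change (F f).1 k = _
    rw [hF, ← hγ k]
    refine key k f _ ?_
    rw [mem_adicSub_iff]
    intro i j I hI
    have := mem_adicSub_iff.1 (hcomp (I.degree + 1) k hI) i j I (Nat.lt_succ_self _)
    rw [Matrix.sub_apply, map_sub] at this ⊢
    exact this
  · refine Subtype.ext (funext fun k => ?_)
    exact key k _ a (by simp)
  · have h1 := (hmk k _ _).1 ((hF k f).symm.trans h)
    have := Submodule.sub_mem _ (hr k f) h1
    rwa [sub_sub_sub_cancel_left] at this

end Completion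

/-! ### Taylor calculus -/

section Taylor

variable {n N : ℕ}

/-- A relation between families of functions that is stable under partial derivatives is stable
under iterated partial derivatives. -/
theorem multiDeriv_rel {α β : Type*} (R : (α → Eucl n → ℂ) → (β → Eucl n → ℂ) → Prop)
    (hR : ∀ i f g, R f g → R (fun a => partialDeriv i (f a)) (fun b => partialDeriv i (g b)))
    (I : Fin n →₀ ℕ) {f : α → Eucl n → ℂ} {g : β → Eucl n → ℂ} (h : R f g) :
    R (fun a => multiDeriv I (f a)) (fun b => multiDeriv I (g b)) := by
  unfold multiDeriv
  induction List.finRange n with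
  | nil => exact h
  | cons i l ih =>
    simp only [List.foldr_cons]
    generalize hm : I i = m
    clear hm
    induction m with
    | zero => exact ih
    | succ m ihm =>
      simp only [Function.iterate_succ_apply']
      exact hR i _ _ ihm

theorem partialDeriv_congr {f g : Eucl n → ℂ} {y : Eucl n} (h : f =ᶠ[𝓝 y] g) (i : Fin n) :
    partialDeriv i f =ᶠ[𝓝 y] partialDeriv i g :=
  h.fderiv.mono fun z hz => by unfold partialDeriv; rw [hz]

theorem multiDeriv_congr {f g : Eucl n → ℂ} {y : Eucl n} (h : f =ᶠ[𝓝 y] g) (I : Fin n →₀ ℕ) :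
    multiDeriv I f =ᶠ[𝓝 y] multiDeriv I g :=
  multiDeriv_rel (α := Unit) (β := Unit) (fun f g => f () =ᶠ[𝓝 y] g ())
    (fun i _ _ h => partialDeriv_congr h i) I (f := fun _ => f) (g := fun _ => g) h

theorem coeffEntry_taylor (a : Eucl n → Mat N) (y : Eucl n) (I : Fin n →₀ ℕ) (i j : Fin N) :
    coeffEntry I i j (taylor a y) =
      ((∏ s, (I s).factorial : ℕ) : ℂ)⁻¹ * multiDeriv I (fun z => a z i j) y := rfl

theorem taylor_congr {a b : Eucl n → Mat N} {y : Eucl n} (h : a =ᶠ[𝓝 y] b) :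
    taylor a y = taylor b y := by
  refine matPS_ext fun I i j => ?_
  rw [coeffEntry_taylor, coeffEntry_taylor]
  congr 1
  refine (multiDeriv_congr (h.mono fun z hz => ?_) I).self_of_nhds
  simp only [hz]

theorem partialDeriv_translate (f : Eucl n → ℂ) (w : Eucl n) (i : Fin n) :
    partialDeriv i (fun z => f (z + w)) = fun z => partialDeriv i f (z + w) := by
  funext z
  unfold partialDeriv
  rw [fderiv_comp_add_right]

theorem taylor_translate (a : Eucl n → Mat N) (w y : Eucl n) :
    taylor (fun z => a (z + w)) y = taylor a (y + w) := by
  refine matPS_ext fun I i j => ?_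
  rw [coeffEntry_taylor, coeffEntry_taylor]
  congr 1
  have h := multiDeriv_rel (α := Unit) (β := Unit)
    (fun f g => f () = fun z => g () (z + w)) (fun i f g h => by
      simp only at h ⊢
      rw [h, partialDeriv_translate]) I
    (f := fun _ z => a (z + w) i j) (g := fun _ z => a z i j) rfl
  exact congrFun h y

/-- Conjugation is real-linear, so it commutes with partial derivatives; invariance under it is
inherited by every derivative. -/
theorem multiDeriv_conj {f : Eucl n → ℂ} (hf : ∀ y, (starRingEnd ℂ) (f y) = f y)
    (I : Fin n →₀ ℕ) (y : Eucl n) : (starRingEnd ℂ) (multiDeriv I f y) = multiDeriv I f y := by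
  refine multiDeriv_rel (α := Unit) (β := Unit)
    (fun f _ => ∀ y, (starRingEnd ℂ) (f () y) = f () y) (fun i f _ h => ?_) I
    (f := fun _ => f) (g := fun _ => f) hf y
  intro z
  have h1 : f () = Complex.conjCLE ∘ f () := funext fun y => (h y).symm
  have h2 := congrArg (fun g => fderiv ℝ g z (EuclideanSpace.single i 1)) h1
  simp only [ContinuousLinearEquiv.comp_fderiv] at h2
  exact h2.symm

/-- Taylor series of real scalar functions are real scalar. -/
theorem taylor_real {a : Eucl n → Mat N} {h : Eucl n → ℝ} {y : Eucl n}
    (ha : a =ᶠ[𝓝 y] fun z => (h z : ℂ) • (1 : Mat N)) :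
    taylor a y ∈ Set.range (realScalar n N) := by
  rw [taylor_congr ha]
  refine ⟨mkPS fun I => ((∏ s, (I s).factorial : ℕ) : ℝ)⁻¹ *
    (multiDeriv I (fun z => (h z : ℂ)) y).re, ?_⟩
  refine matPS_ext fun I i j => ?_
  rw [coeffEntry_taylor, coeffEntry_apply]
  have hre : ((multiDeriv I (fun z => (h z : ℂ)) y).re : ℂ) =
      multiDeriv I (fun z => (h z : ℂ)) y :=
    Complex.conj_eq_iff_re.1 (multiDeriv_conj (fun z => Complex.conj_ofReal _) I y)
  have h0 : multiDeriv I (fun _ : Eucl n => (0 : ℂ)) y = 0 := by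
    have := multiDeriv_rel (α := Unit) (β := Unit) (fun f _ => f () = fun _ => 0)
      (fun i f _ h => by
        funext z
        simp [h, partialDeriv]) I (f := fun _ _ => 0) (g := fun _ _ => 0) rfl
    exact congrFun this y
  simp only [realScalar, Matrix.scalar_apply, Matrix.diagonal_apply, Matrix.smul_apply,
    Matrix.one_apply]
  split_ifs with hij
  · rw [MvPowerSeries.coeff_map, coeff_mkPS, map_mul]
    simp only [Complex.coe_algebraMap]
    rw [hre]
    simp
  · simp [h0]

theorem partialDeriv_const_mul {f : Eucl n → ℂ} {y : Eucl n} (hf : DifferentiableAt ℝ f y)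
    (c : ℂ) (i : Fin n) : partialDeriv i (fun z => c * f z) y = c * partialDeriv i f y := by
  unfold partialDeriv
  rw [fderiv_const_mul hf]
  rfl

theorem ContDiffOn.partialDeriv {f : Eucl n → ℂ} {B : Set (Eucl n)} (hB : IsOpen B)
    (hf : ContDiffOn ℝ ∞ f B) (i : Fin n) : ContDiffOn ℝ ∞ (partialDeriv i f) B :=
  (hf.fderiv_of_isOpen hB (m := ∞) (by simp)).clm_apply contDiffOn_const

theorem partialDeriv_comm {f : Eucl n → ℂ} {B : Set (Eucl n)} (hB : IsOpen B)
    (hf : ContDiffOn ℝ ∞ f B) (i j : Fin n) {y : Eucl n} (hy : y ∈ B) :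
    partialDeriv i (partialDeriv j f) y = partialDeriv j (partialDeriv i f) y := by
  have hfa : ContDiffAt ℝ ∞ f y := hf.contDiffAt (hB.mem_nhds hy)
  have hd : DifferentiableAt ℝ (fderiv ℝ f) y :=
    ((hf.fderiv_of_isOpen hB (m := ∞) (by simp)).contDiffAt (hB.mem_nhds hy)).differentiableAt
      (by simp)
  have hs : IsSymmSndFDerivAt ℝ f y := hfa.isSymmSndFDerivAt
    (by rw [minSmoothness_of_isRCLikeNormedField]; exact WithTop.coe_le_coe.2 (le_top : (2 : ℕ∞) ≤ ⊤))
  have key : ∀ a b : Fin n, EndJet.partialDeriv a (EndJet.partialDeriv b f) y =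
      fderiv ℝ (fderiv ℝ f) y (EuclideanSpace.single a 1) (EuclideanSpace.single b 1) := by
    intro a b
    unfold EndJet.partialDeriv
    rw [fderiv_clm_apply hd (differentiableAt_const _)]
    simp
  rw [key, key]
  exact hs _ _

theorem partialDeriv_eqOn {f g : Eucl n → ℂ} {B : Set (Eucl n)} (hB : IsOpen B)
    (h : Set.EqOn f g B) (i : Fin n) : Set.EqOn (partialDeriv i f) (partialDeriv i g) B :=
  fun _ hy => (partialDeriv_congr (h.eventuallyEq_of_mem (hB.mem_nhds hy)) i).self_of_nhds

theorem iterate_partialDeriv_eqOn {f g : Eucl n → ℂ} {B : Set (Eucl n)} (hB : IsOpen B)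
    (h : Set.EqOn f g B) (i : Fin n) (m : ℕ) :
    Set.EqOn ((partialDeriv i)^[m] f) ((partialDeriv i)^[m] g) B := by
  induction m with
  | zero => exact h
  | succ m ih =>
    simp only [Function.iterate_succ_apply']
    exact partialDeriv_eqOn hB ih i

theorem ContDiffOn.iterate_partialDeriv {f : Eucl n → ℂ} {B : Set (Eucl n)} (hB : IsOpen B)
    (hf : ContDiffOn ℝ ∞ f B) (i : Fin n) (m : ℕ) :
    ContDiffOn ℝ ∞ ((EndJet.partialDeriv i)^[m] f) B := by
  induction m with
  | zero => exact hf
  | succ m ih =>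
    simp only [Function.iterate_succ_apply']
    exact ContDiffOn.partialDeriv hB ih i

theorem ContDiffOn.multiDeriv {f : Eucl n → ℂ} {B : Set (Eucl n)} (hB : IsOpen B)
    (hf : ContDiffOn ℝ ∞ f B) (I : Fin n →₀ ℕ) : ContDiffOn ℝ ∞ (multiDeriv I f) B :=
  multiDeriv_rel (α := Unit) (β := Unit) (fun f _ => ContDiffOn ℝ ∞ (f ()) B)
    (fun i _ _ h => ContDiffOn.partialDeriv hB h i) I (f := fun _ => f) (g := fun _ => f) hf

theorem partialDeriv_iterate_comm {f : Eucl n → ℂ} {B : Set (Eucl n)} (hB : IsOpen B)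
    (hf : ContDiffOn ℝ ∞ f B) (i j : Fin n) (m : ℕ) :
    Set.EqOn (partialDeriv i ((partialDeriv j)^[m] f)) ((partialDeriv j)^[m] (partialDeriv i f))
      B := by
  induction m with
  | zero => exact fun _ _ => rfl
  | succ m ih =>
    simp only [Function.iterate_succ_apply']
    intro y hy
    rw [partialDeriv_comm hB (ContDiffOn.iterate_partialDeriv hB hf j m) i j hy]
    exact partialDeriv_eqOn hB ih j hy

/-- `multiDeriv` differentiates in a fixed order of the variables. The extra derivative is first
moved to the innermost place by symmetry of second derivatives (`h1`), and from there into the block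
of its own variable (`h2`); the blocks of other variables are unaffected (`h3`). -/
theorem partialDeriv_multiDeriv {f : Eucl n → ℂ} {B : Set (Eucl n)} (hB : IsOpen B)
    (hf : ContDiffOn ℝ ∞ f B) (I : Fin n →₀ ℕ) (s : Fin n) :
    Set.EqOn (partialDeriv s (multiDeriv I f)) (multiDeriv (I + Finsupp.single s 1) f) B := by
  let F : List (Fin n) → (Fin n →₀ ℕ) → (Eucl n → ℂ) → Eucl n → ℂ := fun l I f =>
    l.foldr (fun i g => (partialDeriv i)^[I i] g) f
  have hsm : ∀ l I f, ContDiffOn ℝ ∞ f B → ContDiffOn ℝ ∞ (F l I f) B := by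
    intro l I f hf
    induction l with
    | nil => exact hf
    | cons i l ih => exact ContDiffOn.iterate_partialDeriv hB ih i _
  have h1 : ∀ l, Set.EqOn (partialDeriv s (F l I f)) (F l I (partialDeriv s f)) B := by
    intro l
    induction l with
    | nil => exact fun _ _ => rfl
    | cons i l ih =>
      intro y hy
      change partialDeriv s ((partialDeriv i)^[I i] (F l I f)) y = _
      rw [partialDeriv_iterate_comm hB (hsm l I f hf) s i _ hy]
      exact iterate_partialDeriv_eqOn hB ih i _ hy
  have h3 : ∀ l, s ∉ l → F l (I + Finsupp.single s 1) f = F l I f := by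
    intro l hl
    induction l with
    | nil => rfl
    | cons i l ih =>
      rw [List.mem_cons, not_or] at hl
      change (partialDeriv i)^[(I + Finsupp.single s 1 : Fin n →₀ ℕ) i] (F l _ f) =
        (partialDeriv i)^[I i] (F l I f)
      rw [ih hl.2]
      simp [hl.1]
  have h2 : ∀ l : List (Fin n), l.Nodup → s ∈ l →
      Set.EqOn (F l (I + Finsupp.single s 1) f) (F l I (partialDeriv s f)) B := by
    intro l hl hs
    induction l with
    | nil => simp at hs
    | cons i l ih =>
      rw [List.nodup_cons] at hl
      intro y hy
      change (partialDeriv i)^[(I + Finsupp.single s 1 : Fin n →₀ ℕ) i] (F l _ f) y =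
        (partialDeriv i)^[I i] (F l I (partialDeriv s f)) y
      by_cases his : i = s
      · subst his
        rw [h3 l hl.1]
        simp only [Finsupp.add_apply, Finsupp.single_eq_same, Function.iterate_add_apply,
          Function.iterate_one]
        exact iterate_partialDeriv_eqOn hB (h1 l) i _ hy
      · have hs' : s ∈ l := by
          rcases List.mem_cons.1 hs with h | h
          · exact absurd h.symm his
          · exact h
        simp only [Finsupp.add_apply, Finsupp.single_apply, Ne.symm his, if_false, add_zero]
        exact iterate_partialDeriv_eqOn hB (ih hl.2 hs') i _ hy
  intro y hy
  change partialDeriv s (F _ I f) y = F _ _ f y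
  rw [h1 _ hy, h2 _ (List.nodup_finRange n) (List.mem_finRange s) hy]

/-! ### Parallel families of power series and the algebra of Taylor expansion -/

/-- A family of matrices of power series over `B ⊆ ℝⁿ` that looks like a family of Taylor
series: the derivative in the base point is the derivative in the formal variables. -/
def IsParallelOn (B : Set (Eucl n)) (F : Eucl n → MatPS n N) : Prop :=
  ∀ I i j, ContDiffOn ℝ ∞ (fun z => coeffEntry I i j (F z)) B ∧ ∀ y ∈ B, ∀ s,
    partialDeriv s (fun z => coeffEntry I i j (F z)) y = coeffEntry I i j (matPderiv s (F y))

/-- The factor `1 / I!` turns `∂_s` of the coefficient at `I` into `I_s + 1` times the coefficient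
at `I + e_s`, which is how the formal derivative acts on coefficients. -/
theorem isParallelOn_taylor {a : Eucl n → Mat N} {B : Set (Eucl n)} (hB : IsOpen B)
    (ha : ∀ i j, ContDiffOn ℝ ∞ (fun z => a z i j) B) : IsParallelOn B (taylor a) := by
  intro I i j
  constructor
  · simp only [coeffEntry_taylor]
    exact contDiffOn_const.mul (ContDiffOn.multiDeriv hB (ha i j) I)
  · intro y hy s
    rw [coeffEntry_apply, coeff_matPderiv]
    simp only [coeffEntry_taylor]
    rw [← coeffEntry_apply, coeffEntry_taylor, ← partialDeriv_multiDeriv hB (ha i j) I s hy]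
    have hd : DifferentiableAt ℝ (multiDeriv I fun z => a z i j) y :=
      ((ContDiffOn.multiDeriv hB (ha i j) I).contDiffAt (hB.mem_nhds hy)).differentiableAt
        (by simp)
    have hp : (∏ t, ((I + Finsupp.single s 1 : Fin n →₀ ℕ) t).factorial) =
        (I s + 1) * ∏ t, (I t).factorial := by
      classical
      rw [← Finset.mul_prod_erase _ _ (Finset.mem_univ s),
        ← Finset.mul_prod_erase Finset.univ (fun t => (I t).factorial) (Finset.mem_univ s)]
      rw [Finset.prod_congr rfl (g := fun t => (I t).factorial)]
      · simp [Nat.factorial_succ, mul_assoc]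
      · intro t ht
        simp [(Finset.ne_of_mem_erase ht).symm]
    rw [hp, partialDeriv_const_mul hd]
    have h0 : ((I s : ℂ) + 1) ≠ 0 := by exact_mod_cast Nat.succ_ne_zero (I s)
    push_cast
    rw [mul_inv]
    field_simp

theorem coeffEntry_zero_taylor (a : Eucl n → Mat N) (y : Eucl n) (i j : Fin N) :
    coeffEntry 0 i j (taylor a y) = a y i j := by
  rw [coeffEntry_taylor]
  have : multiDeriv 0 (fun z => a z i j) = fun z => a z i j := by
    unfold multiDeriv
    induction List.finRange n with
    | nil => rfl
    | cons i l ih => simp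
  simp [this]

/-- Parallelism is the recursion `(I_s + 1) c_{I + e_s} = ∂_s c_I`, so the constant coefficients
determine all others by induction on the degree. Identities between Taylor series thus reduce to
parallelism of both sides and a comparison of constant terms. -/
theorem IsParallelOn.eq_of_constCoeff_eq {F F' : Eucl n → MatPS n N} {B : Set (Eucl n)}
    (hB : IsOpen B) (hF : IsParallelOn B F) (hF' : IsParallelOn B F')
    (h : ∀ y ∈ B, ∀ i j, coeffEntry 0 i j (F y) = coeffEntry 0 i j (F' y)) :
    Set.EqOn F F' B := by
  have key : ∀ (d : ℕ) (I : Fin n →₀ ℕ), I.degree = d → ∀ y ∈ B, ∀ i j,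
      coeffEntry I i j (F y) = coeffEntry I i j (F' y) := by
    intro d
    induction d with
    | zero =>
      intro I hI
      rw [Finsupp.degree_eq_zero_iff] at hI
      subst hI
      exact h
    | succ d ih =>
      intro I hI y hy i j
      obtain ⟨s, hs⟩ : ∃ s, I s ≠ 0 := by
        by_contra hcon
        push Not at hcon
        have : I = 0 := Finsupp.ext hcon
        simp [this] at hI
      have hle : Finsupp.single s 1 ≤ I :=
        Finsupp.single_le_iff.2 (Nat.one_le_iff_ne_zero.2 hs)
      obtain ⟨J, rfl⟩ : ∃ J, I = J + Finsupp.single s 1 := ⟨_, (tsub_add_cancel_of_le hle).symm⟩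
      have hJ : J.degree = d := by simpa using hI
      have h1 := (hF J i j).2 y hy s
      rw [partialDeriv_eqOn hB (fun z hz => ih J hJ z hz i j) s hy, (hF' J i j).2 y hy s,
        coeffEntry_apply, coeffEntry_apply, coeff_matPderiv, coeff_matPderiv] at h1
      exact (mul_left_cancel₀ (by exact_mod_cast Nat.succ_ne_zero (J s)) h1).symm
  exact fun y hy => matPS_ext fun I i j => key _ I rfl y hy i j

theorem IsParallelOn.eq_taylor {F : Eucl n → MatPS n N} {B : Set (Eucl n)} (hB : IsOpen B)
    (hF : IsParallelOn B F) {a : Eucl n → Mat N}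
    (h : ∀ y ∈ B, ∀ i j, coeffEntry 0 i j (F y) = a y i j) {y : Eucl n} (hy : y ∈ B) :
    F y = taylor a y := by
  refine IsParallelOn.eq_of_constCoeff_eq hB hF (isParallelOn_taylor hB fun i j => ?_) ?_ hy
  · exact (hF 0 i j).1.congr fun z hz => (h z hz i j).symm
  · intro z hz i j
    rw [h z hz, coeffEntry_zero_taylor]

theorem IsParallelOn.add {F F' : Eucl n → MatPS n N} {B : Set (Eucl n)} (hB : IsOpen B)
    (hF : IsParallelOn B F) (hF' : IsParallelOn B F') :
    IsParallelOn B (fun y => F y + F' y) := by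
  intro I i j
  simp only [map_add]
  refine ⟨(hF I i j).1.add (hF' I i j).1, fun y hy s => ?_⟩
  rw [← (hF I i j).2 y hy s, ← (hF' I i j).2 y hy s]
  unfold partialDeriv
  rw [fderiv_fun_add]
  · rfl
  · exact ((hF I i j).1.contDiffAt (hB.mem_nhds hy)).differentiableAt (by simp)
  · exact ((hF' I i j).1.contDiffAt (hB.mem_nhds hy)).differentiableAt (by simp)

theorem coeffEntry_mul (F F' : MatPS n N) (I : Fin n →₀ ℕ) (i j : Fin N) :
    coeffEntry I i j (F * F') = ∑ l, ∑ p ∈ Finset.HasAntidiagonal.antidiagonal I,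
      coeffEntry p.1 i l F * coeffEntry p.2 l j F' := by
  classical
  rw [coeffEntry_apply, Matrix.mul_apply, map_sum]
  refine Finset.sum_congr rfl fun l _ => ?_
  rw [MvPowerSeries.coeff_mul]
  rfl

/-- Base and formal derivatives satisfy the same Leibniz rule. This yields multiplicativity of
Taylor expansion without a binomial identity for iterated derivatives. -/
theorem IsParallelOn.mul {F F' : Eucl n → MatPS n N} {B : Set (Eucl n)} (hB : IsOpen B)
    (hF : IsParallelOn B F) (hF' : IsParallelOn B F') :
    IsParallelOn B (fun y => F y * F' y) := by
  intro I i j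
  simp only [coeffEntry_mul]
  refine ⟨ContDiffOn.sum fun l _ => ContDiffOn.sum fun p _ =>
    (hF p.1 i l).1.mul (hF' p.2 l j).1, fun y hy s => ?_⟩
  have hd : ∀ I i j, DifferentiableAt ℝ (fun z => coeffEntry I i j (F z)) y := fun I i j =>
    ((hF I i j).1.contDiffAt (hB.mem_nhds hy)).differentiableAt (by simp)
  have hd' : ∀ I i j, DifferentiableAt ℝ (fun z => coeffEntry I i j (F' z)) y := fun I i j =>
    ((hF' I i j).1.contDiffAt (hB.mem_nhds hy)).differentiableAt (by simp)
  rw [matPderiv_mul, map_add, coeffEntry_mul, coeffEntry_mul, ← Finset.sum_add_distrib]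
  unfold partialDeriv
  rw [fderiv_fun_sum fun l _ => DifferentiableAt.fun_sum fun p _ =>
    (hd p.1 i l).fun_mul (hd' p.2 l j), sum_apply]
  refine Finset.sum_congr rfl fun l _ => ?_
  rw [fderiv_fun_sum fun p _ => (hd p.1 i l).fun_mul (hd' p.2 l j),
    sum_apply, ← Finset.sum_add_distrib]
  refine Finset.sum_congr rfl fun p _ => ?_
  rw [fderiv_fun_mul (hd p.1 i l) (hd' p.2 l j), ← (hF p.1 i l).2 y hy s,
    ← (hF' p.2 l j).2 y hy s]
  simp only [add_apply, smul_apply, smul_eq_mul,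
    partialDeriv]
  ring

theorem IsParallelOn.const {C : MatPS n N} (hC : ∀ s, matPderiv s C = 0) (B : Set (Eucl n)) :
    IsParallelOn B (fun _ => C) := by
  intro I i j
  refine ⟨contDiffOn_const, fun y _ s => ?_⟩
  rw [hC, map_zero]
  simp [partialDeriv]

theorem taylor_add {a b : Eucl n → Mat N} {B : Set (Eucl n)} (hB : IsOpen B)
    (ha : ∀ i j, ContDiffOn ℝ ∞ (fun z => a z i j) B)
    (hb : ∀ i j, ContDiffOn ℝ ∞ (fun z => b z i j) B) {y : Eucl n} (hy : y ∈ B) :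
    taylor (fun z => a z + b z) y = taylor a y + taylor b y := by
  refine (((isParallelOn_taylor hB ha).add hB (isParallelOn_taylor hB hb)).eq_taylor hB
    (fun z _ i j => ?_) hy).symm
  rw [map_add, coeffEntry_zero_taylor, coeffEntry_zero_taylor, Matrix.add_apply]

theorem taylor_mul {a b : Eucl n → Mat N} {B : Set (Eucl n)} (hB : IsOpen B)
    (ha : ∀ i j, ContDiffOn ℝ ∞ (fun z => a z i j) B)
    (hb : ∀ i j, ContDiffOn ℝ ∞ (fun z => b z i j) B) {y : Eucl n} (hy : y ∈ B) :
    taylor (fun z => a z * b z) y = taylor a y * taylor b y := by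
  classical
  refine (((isParallelOn_taylor hB ha).mul hB (isParallelOn_taylor hB hb)).eq_taylor hB
    (fun z _ i j => ?_) hy).symm
  rw [coeffEntry_mul, Matrix.mul_apply]
  refine Finset.sum_congr rfl fun l _ => ?_
  simp [coeffEntry_zero_taylor]

/-- Constant matrices. -/
def constMat (n : ℕ) {N : ℕ} (C : Mat N) : MatPS n N := C.map MvPowerSeries.C

theorem matPderiv_constMat (C : Mat N) (s : Fin n) : matPderiv s (constMat n C) = 0 := by
  refine Matrix.ext fun i j => ?_
  change MvPowerSeries.pderiv ℂ s (MvPowerSeries.C (C i j)) = 0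
  simp

theorem coeffEntry_zero_constMat (C : Mat N) (i j : Fin N) :
    coeffEntry 0 i j (constMat n C) = C i j := by
  rw [coeffEntry_apply]
  simp [constMat]

theorem taylor_const (C : Mat N) (y : Eucl n) : taylor (fun _ => C) y = constMat n C :=
  ((IsParallelOn.const (fun s => matPderiv_constMat C s) Set.univ).eq_taylor isOpen_univ
    (fun _ _ i j => coeffEntry_zero_constMat C i j) (Set.mem_univ y)).symm

theorem constMat_single (a b : Fin N) : constMat n (Matrix.single a b 1) = unitMonomial 0 a b := by
  refine matPS_ext fun I i j => ?_
  rw [coeffEntry_apply, coeffEntry_apply, coeff_unitMonomial]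
  simp only [constMat, Matrix.map_apply, Matrix.single_apply]
  split_ifs <;> simp_all [MvPowerSeries.coeff_one]

theorem constMat_algebraMap (c : ℂ) :
    constMat n (algebraMap ℂ (Mat N) c) = algebraMap ℂ (MatPS n N) c := by
  refine Matrix.ext fun i j => ?_
  simp only [constMat, Matrix.map_apply, Matrix.algebraMap_matrix_apply]
  split_ifs
  · rfl
  · simp

theorem unitMonomial_add_single (J : Fin n →₀ ℕ) (s : Fin n) (a b : Fin N) :
    unitMonomial (J + Finsupp.single s 1) a b =
      realScalar n N (MvPowerSeries.X s) * unitMonomial J a b := by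
  refine Matrix.ext fun i j => ?_
  rw [realScalar_X_mul_apply, unitMonomial, unitMonomial, Matrix.single_apply,
    Matrix.single_apply]
  split_ifs
  · rw [MvPowerSeries.X, MvPowerSeries.monomial_mul_monomial, one_mul, add_comm]
  · simp

/-- The right-hand side is parallel in `y`: the derivative of the scalar `y_s - p_s` in the base
direction `t` and the formal derivative of `x̂_s` with respect to `x̂_t` are both `δ_{st}`. -/
theorem taylor_coord (p y : Eucl n) (s : Fin n) :
    taylor (fun z => ((z s - p s : ℝ) : ℂ) • (1 : Mat N)) y =
      algebraMap ℂ (MatPS n N) ((y s - p s : ℝ) : ℂ) + realScalar n N (MvPowerSeries.X s) := by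
  have hpar : IsParallelOn Set.univ fun z : Eucl n =>
      algebraMap ℂ (MatPS n N) ((z s - p s : ℝ) : ℂ) + realScalar n N (MvPowerSeries.X s) := by
    intro I i j
    have h1 : ∀ z : Eucl n, coeffEntry I i j
        (algebraMap ℂ (MatPS n N) ((z s - p s : ℝ) : ℂ) + realScalar n N (MvPowerSeries.X s)) =
        Complex.ofRealCLM (z s - p s) * coeffEntry I i j (1 : MatPS n N) +
          coeffEntry I i j (realScalar n N (MvPowerSeries.X s)) := by
      intro z
      rw [map_add, Algebra.algebraMap_eq_smul_one, coeffEntry_smul]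
      rfl
    simp only [h1]
    constructor
    · fun_prop
    · intro y _ t
      have hc : HasFDerivAt (fun z : Eucl n => z s) (EuclideanSpace.proj s : Eucl n →L[ℝ] ℝ) y :=
        (EuclideanSpace.proj s : Eucl n →L[ℝ] ℝ).hasFDerivAt
      have hd : HasFDerivAt (fun z : Eucl n =>
          Complex.ofRealCLM (z s - p s) * coeffEntry I i j (1 : MatPS n N) +
          coeffEntry I i j (realScalar n N (MvPowerSeries.X s)))
          _ y :=
        (((Complex.ofRealCLM.hasFDerivAt.comp y (hc.sub_const (p s))).mul_const
          (coeffEntry I i j (1 : MatPS n N))).add_const _)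
      unfold partialDeriv
      rw [hd.fderiv]
      rw [map_add]
      have h2 : matPderiv t (algebraMap ℂ (MatPS n N) ((y s - p s : ℝ) : ℂ)) = 0 := by
        rw [← constMat_algebraMap, matPderiv_constMat]
      have h3 : matPderiv t (realScalar n N (MvPowerSeries.X s)) =
          if t = s then (1 : MatPS n N) else 0 := by
        refine Matrix.ext fun a b => ?_
        change MvPowerSeries.pderiv ℂ t _ = _
        by_cases hab : a = b <;> by_cases hts : t = s <;>
          simp [realScalar, hab, hts, MvPowerSeries.pderiv_X, Matrix.one_apply]
      rw [h2, zero_add, h3]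
      by_cases hts : t = s
      · subst hts; simp
      · simp [hts, Ne.symm hts]
  refine (hpar.eq_taylor isOpen_univ (fun z _ i j => ?_) (Set.mem_univ y)).symm
  rw [map_add, mem_adicSub_iff.1 (realScalar_X_mem s) i j 0 (by simp) |> fun h =>
    (coeffEntry_apply _ _ _ _).trans h, add_zero, ← constMat_algebraMap,
    coeffEntry_zero_constMat, Algebra.algebraMap_eq_smul_one]

end Taylor

/-! ### Hadamard's lemma -/

/-- Differentiating under the integral gives an integral of the same kind, with values in `X →L[ℝ]
F`. For this reason the induction on `m` runs over all target spaces `F` at once. -/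
theorem contDiff_intervalIntegral_nat {X : Type} [NormedAddCommGroup X] [NormedSpace ℝ X]
    [ProperSpace X] (m : ℕ) : ∀ {F : Type} [NormedAddCommGroup F] [NormedSpace ℝ F]
    [CompleteSpace F] {g : X → ℝ → F}, ContDiff ℝ ∞ (Function.uncurry g) →
    ContDiff ℝ m (fun y => ∫ t in (0 : ℝ)..1, g y t) := by
  have hder : ∀ {F : Type} [NormedAddCommGroup F] [NormedSpace ℝ F]
      [CompleteSpace F] {g : X → ℝ → F}, ContDiff ℝ ∞ (Function.uncurry g) →
      ∃ g' : X → ℝ → X →L[ℝ] F, ContDiff ℝ ∞ (Function.uncurry g') ∧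
      ∀ y, HasFDerivAt (fun y => ∫ t in (0 : ℝ)..1, g y t) (∫ t in (0 : ℝ)..1, g' y t) y := by
    intro F _ _ _ g hg
    have hg1 : ContDiff ℝ ∞ (fderiv ℝ (Function.uncurry g)) := hg.fderiv_right (by simp)
    let g' : X → ℝ → X →L[ℝ] F := fun y t =>
      (fderiv ℝ (Function.uncurry g) (y, t)).comp (ContinuousLinearMap.inl ℝ X ℝ)
    have hg' : ContDiff ℝ ∞ (Function.uncurry g') := by
      change ContDiff ℝ ∞ fun p : X × ℝ => (fderiv ℝ (Function.uncurry g) (p.1, p.2)).comp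
        (ContinuousLinearMap.inl ℝ X ℝ)
      exact hg1.clm_comp contDiff_const
    refine ⟨g', hg', fun y => ?_⟩
    have hc : ∀ y, Continuous (g y) := fun y =>
      hg.continuous.comp (continuous_const.prodMk continuous_id)
    have hc' : ∀ y, Continuous (g' y) := fun y =>
      hg'.continuous.comp (continuous_const.prodMk continuous_id)
    -- The domination needed for differentiation under the integral is a bound for the derivative on
    -- this compact set.
    have hK : IsCompact (Metric.closedBall y 1 ×ˢ Set.Icc (0 : ℝ) 1) :=
      (isCompact_closedBall y 1).prod isCompact_Icc
    obtain ⟨C, hC⟩ := hK.exists_bound_of_continuousOn hg'.continuous.continuousOn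
    refine intervalIntegral.hasFDerivAt_integral_of_dominated_of_fderiv_le
      (bound := fun _ => C) (s := Metric.closedBall y 1) (Metric.closedBall_mem_nhds y one_pos)
      (Filter.Eventually.of_forall fun z => (hc z).aestronglyMeasurable)
      ((hc y).intervalIntegrable _ _) (hc' y).aestronglyMeasurable ?_
      intervalIntegrable_const ?_
    · refine Filter.Eventually.of_forall fun t ht z hz => hC (z, t) ⟨hz, ?_⟩
      rw [Set.uIoc_of_le zero_le_one] at ht
      exact ⟨ht.1.le, ht.2⟩
    · refine Filter.Eventually.of_forall fun t _ z _ => ?_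
      have h1 : HasFDerivAt (Function.uncurry g) (fderiv ℝ (Function.uncurry g) (z, t)) (z, t) :=
        (hg.differentiable (by simp) _).hasFDerivAt
      exact HasFDerivAt.comp (g := Function.uncurry g) z h1
        (hasFDerivAt_prodMk_left (𝕜 := ℝ) z t)
  induction m with
  | zero =>
    intro F _ _ _ g hg
    obtain ⟨g', -, h⟩ := hder hg
    exact contDiff_zero.2 (continuous_iff_continuousAt.2 fun y => (h y).continuousAt)
  | succ m ih =>
    intro F _ _ _ g hg
    obtain ⟨g', hg', h⟩ := hder hg
    have h1 : fderiv ℝ (fun y => ∫ t in (0 : ℝ)..1, g y t) = fun y => ∫ t in (0 : ℝ)..1, g' y t :=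
      funext fun y => (h y).fderiv
    push_cast
    rw [contDiff_succ_iff_fderiv]
    refine ⟨fun y => (h y).differentiableAt, by simp, ?_⟩
    rw [h1]
    exact ih hg'

/-- Integrals of smooth functions over a compact interval depend smoothly on parameters. -/
theorem contDiff_intervalIntegral {X F : Type} [NormedAddCommGroup X] [NormedSpace ℝ X]
    [ProperSpace X] [NormedAddCommGroup F] [NormedSpace ℝ F]
    [CompleteSpace F] {g : X → ℝ → F} (hg : ContDiff ℝ ∞ (Function.uncurry g)) :
    ContDiff ℝ ∞ (fun y => ∫ t in (0 : ℝ)..1, g y t) :=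
  contDiff_infty.2 fun m => contDiff_intervalIntegral_nat m hg

section Hadamard

variable {n N : ℕ}

theorem fderiv_apply_eq_sum (f : Eucl n → ℂ) (y v : Eucl n) :
    fderiv ℝ f y v = ∑ s, (v s : ℂ) * partialDeriv s f y := by
  have hv : v = ∑ s : Fin n, v s • EuclideanSpace.single s (1 : ℝ) := by
    ext t
    simp [Finset.sum_apply, Pi.single_apply]
  conv_lhs => rw [hv]
  rw [map_sum]
  refine Finset.sum_congr rfl fun s _ => ?_
  rw [map_smul]
  exact Complex.real_smul

/-- Hadamard's lemma. -/
theorem hadamard {a : Eucl n → ℂ} (ha : ContDiff ℝ ∞ a) (p : Eucl n) :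
    ∃ b : Fin n → Eucl n → ℂ, (∀ s, ContDiff ℝ ∞ (b s)) ∧
      ∀ y, a y = a p + ∑ s, ((y s - p s : ℝ) : ℂ) * b s y := by
  have hp : ∀ s, ContDiff ℝ ∞ (partialDeriv s a) := fun s =>
    (ha.fderiv_right (m := ∞) (by simp)).clm_apply contDiff_const
  have hsm : ∀ s, ContDiff ℝ ∞ (Function.uncurry fun (y : Eucl n) (t : ℝ) =>
      partialDeriv s a (p + t • (y - p))) := by
    intro s
    refine (hp s).comp ?_
    change ContDiff ℝ ∞ fun q : Eucl n × ℝ => p + q.2 • (q.1 - p)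
    fun_prop
  -- These are the integral remainders; the identity is the fundamental theorem of calculus along
  -- the segment from `p` to `y`.
  refine ⟨fun s y => ∫ t in (0 : ℝ)..1, partialDeriv s a (p + t • (y - p)),
    fun s => contDiff_intervalIntegral (hsm s), fun y => ?_⟩
  have hder : ∀ t : ℝ, HasDerivAt (fun t : ℝ => a (p + t • (y - p)))
      (∑ s, ((y s - p s : ℝ) : ℂ) * partialDeriv s a (p + t • (y - p))) t := by
    intro t
    have h1 : HasDerivAt (fun t : ℝ => p + t • (y - p)) (y - p) t := by
      simpa using ((hasDerivAt_id t).smul_const (y - p)).const_add p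
    have h2 := (ha.differentiable (by simp) (p + t • (y - p))).hasFDerivAt.comp_hasDerivAt t h1
    rw [fderiv_apply_eq_sum] at h2
    exact h2
  have hcont : ∀ s, Continuous fun t : ℝ => partialDeriv s a (p + t • (y - p)) := fun s =>
    (hsm s).continuous.comp (continuous_const.prodMk continuous_id)
  have h3 := intervalIntegral.integral_eq_sub_of_hasDerivAt (a := 0) (b := 1)
    (fun t _ => hder t) ((continuous_finsetSum _ fun s _ =>
      continuous_const.mul (hcont s)).intervalIntegrable _ _)
  rw [intervalIntegral.integral_finsetSum
    (f := fun s (t : ℝ) => ((y s - p s : ℝ) : ℂ) * partialDeriv s a (p + t • (y - p))) fun s _ =>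
    (continuous_const.mul (hcont s)).intervalIntegrable _ _] at h3
  simp only [intervalIntegral.integral_const_mul, one_smul, zero_smul, add_sub_cancel,
    add_zero] at h3
  rw [h3]
  ring

/-- This is the equation `(d + σ^*ω) F = 0` in a standard frame field, where `σ^*ω(v)` will turn out
to be `negDirDer n N v`. -/
theorem IsParallelOn.fderiv_apply {F : Eucl n → MatPS n N} {B : Set (Eucl n)}
    (hF : IsParallelOn B F) {y : Eucl n} (hy : y ∈ B) (v : Eucl n) (I : Fin n →₀ ℕ)
    (i j : Fin N) : fderiv ℝ (fun z => coeffEntry I i j (F z)) y v =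
      -coeffEntry I i j ((negDirDer n N v).1 (F y)) := by
  rw [fderiv_apply_eq_sum, coeffEntry_apply, coeff_negDirDer, neg_neg]
  refine Finset.sum_congr rfl fun s _ => ?_
  rw [(hF I i j).2 y hy s, coeffEntry_apply, coeff_matPderiv]

/-- A function that is smooth near a point agrees near the point with a smooth function. -/
theorem exists_contDiff_eventuallyEq {F : Type*} [NormedAddCommGroup F] [NormedSpace ℝ F]
    {f : Eucl n → F} {B : Set (Eucl n)} (hB : IsOpen B)
    (hf : ContDiffOn ℝ ∞ f B) {p : Eucl n} (hp : p ∈ B) :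
    ∃ g : Eucl n → F, ContDiff ℝ ∞ g ∧ g =ᶠ[𝓝 p] f := by
  obtain ⟨r, hr, hrB⟩ := Metric.isOpen_iff.1 hB p hp
  -- The outer radius is less than `r`, so the closed support of the bump stays inside `B` and the
  -- product is smooth everywhere.
  let χ : ContDiffBump p := ⟨r / 3, r / 2, by positivity, by linarith⟩
  refine ⟨fun y => χ y • f y, ?_, ?_⟩
  · rw [contDiff_iff_contDiffAt]
    intro y
    by_cases hy : y ∈ B
    · exact χ.contDiff.contDiffAt.smul (hf.contDiffAt (hB.mem_nhds hy))
    · have hy' : y ∉ tsupport χ := by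
        rw [χ.tsupport_eq]
        intro h
        apply hy
        apply hrB
        have : dist y p ≤ r / 2 := h
        rw [Metric.mem_ball]
        linarith
      refine (contDiffAt_const (c := (0 : F))).congr_of_eventuallyEq ?_
      filter_upwards [(isClosed_tsupport χ).isOpen_compl.mem_nhds hy'] with z hz
      rw [image_eq_zero_of_notMem_tsupport hz, zero_smul]
  · filter_upwards [χ.eventuallyEq_one] with y hy
    rw [hy]
    exact one_smul _ _

/-- Derivatives in a parameter commute with partial derivatives. -/
theorem deriv_multiDeriv {G : ℝ → Eucl n → ℂ} {W : Set (ℝ × Eucl n)} (hW : IsOpen W)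
    (hG : ContDiffOn ℝ ∞ (Function.uncurry G) W) (I : Fin n →₀ ℕ) {t : ℝ} {y : Eucl n}
    (h : (t, y) ∈ W) :
    deriv (fun t => multiDeriv I (G t) y) t =
      multiDeriv I (fun y => deriv (fun t => G t y) t) y := by
  -- The relation "`f` is jointly smooth on `W` and `g = ∂_t f` there" is stable under `∂_s`,
  -- because second derivatives in `(t, y)` are symmetric; `multiDeriv_rel` then iterates it.
  let R : (ℝ → Eucl n → ℂ) → (ℝ → Eucl n → ℂ) → Prop := fun f g =>
    ContDiffOn ℝ ∞ (Function.uncurry f) W ∧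
      ∀ t y, (t, y) ∈ W → deriv (fun t => f t y) t = g t y
  have hsec : ∀ (f : ℝ → Eucl n → ℂ), ContDiffOn ℝ ∞ (Function.uncurry f) W →
      ∀ t y, (t, y) ∈ W → ∀ s, partialDeriv s (f t) y =
        fderiv ℝ (Function.uncurry f) (t, y) (0, EuclideanSpace.single s 1) := by
    intro f hf t y hty s
    have h1 := ((hf.contDiffAt (hW.mem_nhds hty)).differentiableAt (by simp)).hasFDerivAt
    have h2 := h1.comp y (hasFDerivAt_prodMk_right t y)
    unfold partialDeriv
    refine (congrArg (fun L => L (EuclideanSpace.single s (1 : ℝ))) h2.fderiv).trans ?_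
    simp
  have hsec' : ∀ (f : ℝ → Eucl n → ℂ), ContDiffOn ℝ ∞ (Function.uncurry f) W →
      ∀ t y, (t, y) ∈ W → deriv (fun t => f t y) t =
        fderiv ℝ (Function.uncurry f) (t, y) (1, 0) := by
    intro f hf t y hty
    have h1 := ((hf.contDiffAt (hW.mem_nhds hty)).differentiableAt (by simp)).hasFDerivAt
    have h2 := (h1.comp t (hasFDerivAt_prodMk_left t y)).hasDerivAt
    exact h2.deriv.trans (by simp)
  have hR : ∀ i f g, R f g → R (fun a => partialDeriv i (f a)) (fun b => partialDeriv i (g b)) := by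
    rintro s f g ⟨hf, hfg⟩
    have hf1 : ContDiffOn ℝ ∞ (fderiv ℝ (Function.uncurry f)) W :=
      hf.fderiv_of_isOpen hW (by simp)
    have hsm : ContDiffOn ℝ ∞ (Function.uncurry fun a => partialDeriv s (f a)) W := by
      refine (hf1.clm_apply (contDiffOn_const (c := ((0 : ℝ),
        (EuclideanSpace.single s 1 : Eucl n))))).congr ?_
      rintro ⟨t, y⟩ hty
      exact hsec f hf t y hty s
    refine ⟨hsm, fun t y hty => ?_⟩
    have hd : DifferentiableAt ℝ (fderiv ℝ (Function.uncurry f)) (t, y) :=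
      (hf1.contDiffAt (hW.mem_nhds hty)).differentiableAt (by simp)
    have hsymm : IsSymmSndFDerivAt ℝ (Function.uncurry f) (t, y) :=
      (hf.contDiffAt (hW.mem_nhds hty)).isSymmSndFDerivAt (by
        rw [minSmoothness_of_isRCLikeNormedField]
        exact WithTop.coe_le_coe.2 (le_top : (2 : ℕ∞) ≤ ⊤))
    have e1 : deriv (fun t => partialDeriv s (f t) y) t =
        fderiv ℝ (fderiv ℝ (Function.uncurry f)) (t, y) (1, 0) (0, EuclideanSpace.single s 1) := by
      rw [hsec' _ hsm t y hty]
      have : (Function.uncurry fun a => partialDeriv s (f a)) =ᶠ[𝓝 (t, y)] fun p =>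
          fderiv ℝ (Function.uncurry f) p (0, EuclideanSpace.single s 1) := by
        filter_upwards [hW.mem_nhds hty] with p hp
        exact hsec f hf p.1 p.2 hp s
      rw [this.fderiv_eq, fderiv_clm_apply hd (differentiableAt_const _)]
      simp
    have e2 : partialDeriv s (g t) y =
        fderiv ℝ (fderiv ℝ (Function.uncurry f)) (t, y) (0, EuclideanSpace.single s 1) (1, 0) := by
      have : g t =ᶠ[𝓝 y] fun z => fderiv ℝ (Function.uncurry f) (t, z) (1, 0) := by
        have hc : Filter.Tendsto (fun z => (t, z)) (𝓝 y) (𝓝 (t, y)) :=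
          (continuous_const.prodMk continuous_id).tendsto y
        filter_upwards [hc (hW.mem_nhds hty)] with z hz
        rw [← hfg t z hz, hsec' f hf t z hz]
      unfold partialDeriv
      rw [this.fderiv_eq]
      have h2 := (hd.hasFDerivAt.clm_apply (hasFDerivAt_const ((1 : ℝ), (0 : Eucl n)) _)).comp y
        (hasFDerivAt_prodMk_right t y)
      refine (congrArg (fun L => L (EuclideanSpace.single s (1 : ℝ))) h2.fderiv).trans ?_
      simp
    rw [e1]
    refine Eq.trans ?_ e2.symm
    exact hsymm _ _
  have := multiDeriv_rel R hR I (f := G) (g := fun t y => deriv (fun t => G t y) t)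
    ⟨hG, fun _ _ _ => rfl⟩
  exact this.2 t y h

end Hadamard

/-! ### A criterion for `J ^ k` to be the preimage of the adic filtration -/

section Criterion

variable {n N : ℕ} {A : Type*} [Ring A] [Algebra ℂ A] {J : Ideal A} [J.IsTwoSided]
  {T : A →ₐ[ℂ] MatPS n N}

theorem map_mem_adicSub_of_mem_pow (hT : ∀ a ∈ J, T a ∈ adicSub n N 1) (k : ℕ) :
    ∀ a ∈ J ^ k, T a ∈ adicSub n N k := by
  induction k with
  | zero => exact fun _ _ => mem_adicSub_zero _
  | succ k ih =>
    intro a ha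
    rw [Ideal.IsTwoSided.pow_succ] at ha
    refine Submodule.mul_induction_on ha (fun x hx y hy => ?_) fun x y hx hy => ?_
    · rw [map_mul, add_comm k 1]
      exact mul_mem_adicSub (hT x hx) (ih y hy)
    · rw [map_add]
      exact Submodule.add_mem _ hx hy

/-- Here `E I a b` and `ξ s` play the roles of monomial matrix units and centred coordinates.
Iterating the Hadamard expansion `hH` shows that every `γ` is, modulo `J ^ k`, a combination of the
`E I a b` with `|I| < k`. On their span `T` is injective, as their images are distinct monomial
matrix units. So if `T γ` has order at least `k`, the combination is zero and `γ ∈ J ^ k`. The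
relations are required only modulo all `J ^ k`, since for sections they will hold only near the
point. -/
theorem mem_pow_iff_of_hadamard (hT : ∀ a ∈ J, T a ∈ adicSub n N 1)
    {E : (Fin n →₀ ℕ) → Fin N → Fin N → A} (hE : ∀ I a b, T (E I a b) = unitMonomial I a b)
    {ξ : Fin n → A} (hξ : ∀ s, ξ s ∈ J)
    (hξE : ∀ k s I a b, ξ s * E I a b - E (I + Finsupp.single s 1) a b ∈ J ^ k)
    (hH : ∀ γ : A, ∃ (c : Fin N → Fin N → ℂ) (η : Fin n → A), ∀ k,
      γ - (∑ a, ∑ b, c a b • E 0 a b + ∑ s, ξ s * η s) ∈ J ^ k) :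
    (∀ k a, T a ∈ adicSub n N k ↔ a ∈ J ^ k) ∧ ∀ k f, ∃ a, T a - f ∈ adicSub n N k := by
  have hfw := map_mem_adicSub_of_mem_pow (J := J) hT
  let S : ℕ → Submodule ℂ A := fun k =>
    Submodule.span ℂ {x | ∃ I a b, I.degree < k ∧ x = E I a b}
  have hS : ∀ k I a b, I.degree < k → E I a b ∈ S k := fun k I a b h =>
    Submodule.subset_span ⟨I, a, b, h, rfl⟩
  have hsm : ∀ k (c : ℂ) (x : A), x ∈ J ^ k → c • x ∈ J ^ k := by
    intro k c x hx
    rw [Algebra.smul_def]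
    exact (J ^ k).mul_mem_left _ hx
  -- Multiplication by `ξ s` raises the degree of a combination by one, up to an error in `J ^ (k +
  -- 1)`.
  have hshift : ∀ k s, ∀ u ∈ S k, ∃ u' ∈ S (k + 1), ξ s * u - u' ∈ J ^ (k + 1) := by
    intro k s u hu
    induction hu using Submodule.span_induction with
    | mem x hx =>
      obtain ⟨I, a, b, hI, rfl⟩ := hx
      exact ⟨_, hS (k + 1) (I + Finsupp.single s 1) a b (by simpa using hI), hξE _ s I a b⟩
    | zero => exact ⟨0, Submodule.zero_mem _, by simp⟩
    | add x y _ _ hx hy =>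
      obtain ⟨x', hx', hx⟩ := hx
      obtain ⟨y', hy', hy⟩ := hy
      refine ⟨x' + y', Submodule.add_mem _ hx' hy', ?_⟩
      rw [mul_add, add_sub_add_comm]
      exact Ideal.add_mem _ hx hy
    | smul c x _ hx =>
      obtain ⟨x', hx', hx⟩ := hx
      refine ⟨c • x', Submodule.smul_mem _ _ hx', ?_⟩
      rw [mul_smul_comm, ← smul_sub]
      exact hsm _ _ _ hx
  -- If `η_s` is approximated modulo `J ^ k`, then `ξ_s η_s` is approximated modulo `J ^ (k + 1)`
  -- because `ξ_s ∈ J`.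
  have hapx : ∀ k γ, ∃ u ∈ S k, γ - u ∈ J ^ k := by
    intro k
    induction k with
    | zero =>
      intro γ
      refine ⟨0, Submodule.zero_mem _, ?_⟩
      rw [Submodule.pow_zero, Ideal.one_eq_top]
      trivial
    | succ k ih =>
      intro γ
      obtain ⟨c, η, hγ⟩ := hH γ
      choose u hu hηu using fun s => ih (η s)
      choose u' hu' hξu using fun s => hshift k s (u s) (hu s)
      refine ⟨∑ a, ∑ b, c a b • E 0 a b + ∑ s, u' s, Submodule.add_mem _
        (Submodule.sum_mem _ fun a _ => Submodule.sum_mem _ fun b _ =>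
          Submodule.smul_mem _ _ (hS _ _ _ _ (by simp)))
        (Submodule.sum_mem _ fun s _ => hu' s), ?_⟩
      have h1 : γ - (∑ a, ∑ b, c a b • E 0 a b + ∑ s, u' s) =
          (γ - (∑ a, ∑ b, c a b • E 0 a b + ∑ s, ξ s * η s)) +
          ∑ s, (ξ s * (η s - u s) + (ξ s * u s - u' s)) := by
        simp only [mul_sub, Finset.sum_add_distrib, Finset.sum_sub_distrib]
        abel
      rw [h1]
      refine Ideal.add_mem _ (hγ _) (Ideal.sum_mem _ fun s _ => Ideal.add_mem _ ?_ (hξu s))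
      rw [Ideal.IsTwoSided.pow_succ]
      exact Ideal.mul_mem_mul (hξ s) (hηu s)
  -- Reading off coefficients inverts `T` on `S k`. Conversely `T ∘ L k` is truncation, which gives
  -- the density of the image.
  let L : ℕ → MatPS n N →ₗ[ℂ] A := fun k =>
    { toFun := fun f => ∑ I ∈ degLT n k, ∑ a, ∑ b, MvPowerSeries.coeff I (f a b) • E I a b
      map_add' := fun f g => by
        simp only [Matrix.add_apply, map_add, add_smul, Finset.sum_add_distrib]
      map_smul' := fun c f => by
        simp only [Matrix.smul_apply, MvPowerSeries.coeff_smul, mul_smul, Finset.smul_sum,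
          RingHom.id_apply] }
  have hL : ∀ k f, L k f =
      ∑ I ∈ degLT n k, ∑ a, ∑ b, MvPowerSeries.coeff I (f a b) • E I a b := fun _ _ => rfl
  have hTL : ∀ k f, T (L k f) = truncMat k f := by
    intro k f
    rw [hL, truncMat]
    simp only [map_sum, map_smul, hE]
  have hLT : ∀ k, ∀ u ∈ S k, L k (T u) = u := by
    classical
    intro k u hu
    have : Set.EqOn ((L k).comp T.toLinearMap) (LinearMap.id (R := ℂ))
        {x | ∃ I a b, I.degree < k ∧ x = E I a b} := by
      rintro _ ⟨I, a, b, hI, rfl⟩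
      change L k (T (E I a b)) = E I a b
      rw [hE, hL]
      simp only [coeff_unitMonomial]
      rw [Finset.sum_eq_single I, Finset.sum_eq_single a, Finset.sum_eq_single b]
      · simp
      · intro b' _ hb'; simp [Ne.symm hb']
      · simp
      · intro a' _ ha'; simp [Ne.symm ha']
      · simp
      · intro I' _ hI'; simp [hI']
      · intro h; exact absurd (mem_degLT.2 hI) h
    exact LinearMap.eqOn_span this hu
  refine ⟨fun k a => ⟨fun ha => ?_, hfw k a⟩, fun k f => ⟨L k f, ?_⟩⟩
  · obtain ⟨u, hu, hau⟩ := hapx k a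
    have hTu : T u ∈ adicSub n N k := by
      have := Submodule.sub_mem _ ha (hfw k _ hau)
      rwa [map_sub, sub_sub_cancel] at this
    have hu0 : u = 0 := by
      rw [← hLT k u hu, hL]
      refine Finset.sum_eq_zero fun I hI => Finset.sum_eq_zero fun a _ =>
        Finset.sum_eq_zero fun b _ => ?_
      rw [mem_adicSub_iff.1 hTu a b I (mem_degLT.1 hI), zero_smul]
    rwa [hu0, sub_zero] at hau
  · rw [hTL, ← neg_mem_iff, neg_sub]
    exact sub_truncMat_mem k f

end Criterion

/-! ### Standard local trivializations -/

section Std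

variable {n N : ℕ} {M : Type*} [TopologicalSpace M] [ChartedSpace (Eucl n) M]
  {E : M → Type*} [∀ x, AddCommGroup (E x)] [∀ x, Module ℂ (E x)]
  [∀ x, TopologicalSpace (E x)] [TopologicalSpace (TotalSpace (Fib N) E)]
  [FiberBundle (Fib N) E] [VectorBundle ℂ (Fib N) E]
  [∀ x, IsTopologicalAddGroup (E x)] [∀ x, ContinuousSMul ℂ (E x)]

/-- Continuous endomorphisms of `ℂ^N` are matrices. -/
def endMat (N : ℕ) : (Fib N →L[ℂ] Fib N) ≃ₐ[ℂ] Mat N :=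
  (Module.End.toContinuousLinearMap (Fib N)).symm.trans LinearMap.toMatrixAlgEquiv'

theorem endMat_apply (A : Fib N →L[ℂ] Fib N) (i j : Fin N) :
    endMat N A i j = A (Pi.single j 1) i := by
  simp [endMat, LinearMap.toMatrixAlgEquiv'_apply, Module.End.toContinuousLinearMap]

/-- The matrix of an endomorphism of the fibre at `x` in a trivialization. -/
def fibreOf (e : Trivialization (Fib N) (π (Fib N) E)) [MemTrivializationAtlas e] (x : M)
    (hx : x ∈ e.baseSet) : EndFib E x ≃ₐ[ℂ] Mat N :=
  (e.continuousLinearEquivAt ℂ x hx).conjContinuousAlgEquiv.toAlgEquiv.trans (endMat N)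

/-- The matrix of an endomorphism of the fibre at `x` in the trivialization at `x₀`, where this
makes sense. -/
def stdFibre (x₀ x : M) : EndFib E x ≃ₐ[ℂ] Mat N :=
  open Classical in
  if h : x ∈ (trivializationAt (Fib N) E x₀).baseSet then fibreOf (trivializationAt (Fib N) E x₀) x h
  -- Off the base set the trivialization at `x` itself is used, so that the value is an algebra
  -- isomorphism at every point; no smoothness is claimed there.
  else fibreOf (trivializationAt (Fib N) E x) x
    (FiberBundle.mem_baseSet_trivializationAt (Fib N) E x)

theorem stdFibre_eq {x₀ x : M} (h : x ∈ (trivializationAt (Fib N) E x₀).baseSet)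
    (A : EndFib E x) :
    stdFibre x₀ x A = endMat N
      (ContinuousLinearMap.inCoordinates (Fib N) E (Fib N) E x₀ x x₀ x A) := by
  rw [ContinuousLinearMap.inCoordinates_eq h h, stdFibre, dif_pos h]
  rfl

theorem inCoordinates_change (x₀ x₁ x : M) (h₀ : x ∈ (trivializationAt (Fib N) E x₀).baseSet)
    (h₁ : x ∈ (trivializationAt (Fib N) E x₁).baseSet) (A : EndFib E x) :
    ContinuousLinearMap.inCoordinates (Fib N) E (Fib N) E x₀ x x₀ x A =
      ((trivializationAt (Fib N) E x₁).coordChangeL ℂ (trivializationAt (Fib N) E x₀) x :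
        Fib N →L[ℂ] Fib N).comp
      ((ContinuousLinearMap.inCoordinates (Fib N) E (Fib N) E x₁ x x₁ x A).comp
      ((trivializationAt (Fib N) E x₀).coordChangeL ℂ (trivializationAt (Fib N) E x₁) x :
        Fib N →L[ℂ] Fib N)) := by
  rw [ContinuousLinearMap.inCoordinates_eq h₀ h₀, ContinuousLinearMap.inCoordinates_eq h₁ h₁]
  ext v : 1
  have e1 := Trivialization.coe_coordChangeL (R := ℂ) (trivializationAt (Fib N) E x₁)
    (trivializationAt (Fib N) E x₀) ⟨h₁, h₀⟩
  have e2 := Trivialization.coe_coordChangeL (R := ℂ) (trivializationAt (Fib N) E x₀)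
    (trivializationAt (Fib N) E x₁) ⟨h₀, h₁⟩
  simp only [ContinuousLinearMap.comp_apply, ContinuousLinearEquiv.coe_coe, e1, e2]
  change _ = ((trivializationAt (Fib N) E x₀).continuousLinearEquivAt ℂ x h₀)
    (((trivializationAt (Fib N) E x₁).continuousLinearEquivAt ℂ x h₁).symm
      (((trivializationAt (Fib N) E x₁).continuousLinearEquivAt ℂ x h₁)
        (A (((trivializationAt (Fib N) E x₁).continuousLinearEquivAt ℂ x h₁).symm
      (((trivializationAt (Fib N) E x₁).continuousLinearEquivAt ℂ x h₁)
      (((trivializationAt (Fib N) E x₀).continuousLinearEquivAt ℂ x h₀).symm v))))))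
  rw [ContinuousLinearEquiv.symm_apply_apply, ContinuousLinearEquiv.symm_apply_apply]

theorem contMDiffAt_endMat {g : M → (Fib N →L[ℂ] Fib N)} {x : M} :
    ContMDiffAt (𝓡 n) 𝓘(ℝ, Fib N →L[ℂ] Fib N) ∞ g x ↔
      ∀ i j, ContMDiffAt (𝓡 n) 𝓘(ℝ, ℂ) ∞ (fun x => endMat N (g x) i j) x := by
  constructor
  · intro h i j
    let L : (Fib N →L[ℂ] Fib N) →L[ℝ] ℂ := LinearMap.toContinuousLinearMap
      { toFun := fun A => A (Pi.single j 1) i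
        map_add' := fun _ _ => rfl
        map_smul' := fun _ _ => rfl }
    have := L.contDiff.contMDiff (n := ∞) |>.contMDiffAt.comp x h
    refine this.congr_of_eventuallyEq (Filter.Eventually.of_forall fun y => ?_)
    exact endMat_apply _ _ _
  · intro h
    have h1 : ContMDiffAt (𝓡 n) 𝓘(ℝ, Fin N → Fin N → ℂ) ∞ (fun x i j => endMat N (g x) i j) x :=
      contMDiffAt_pi_space.2 fun i => contMDiffAt_pi_space.2 fun j => h i j
    let L : (Fin N → Fin N → ℂ) →L[ℝ] (Fib N →L[ℂ] Fib N) := LinearMap.toContinuousLinearMap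
      { toFun := fun A => (endMat N).symm (Matrix.of A)
        map_add' := fun A B => map_add (endMat N).symm (Matrix.of A) (Matrix.of B)
        map_smul' := fun c A => by
          have : Matrix.of (c • A) = (c : ℂ) • Matrix.of A := by
            ext i j; simp
          rw [this, map_smul]
          rfl }
    have := L.contDiff.contMDiff (n := ∞) |>.contMDiffAt.comp x h1
    refine this.congr_of_eventuallyEq (Filter.Eventually.of_forall fun y => ?_)
    change _ = (endMat N).symm (endMat N (g y))
    rw [AlgEquiv.symm_apply_apply]

/-- Smoothness of a section near a point can be tested in the trivialization at any point. -/
theorem contMDiffAt_inCoordinates_iff (hE : IsSmoothBundle n N E) {s : ∀ x, EndFib E x}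
    {x₀ x₁ x : M} (h₀ : x ∈ (trivializationAt (Fib N) E x₀).baseSet)
    (h₁ : x ∈ (trivializationAt (Fib N) E x₁).baseSet)
    (h : ContMDiffAt (𝓡 n) 𝓘(ℝ, Fib N →L[ℂ] Fib N) ∞
      (fun x => ContinuousLinearMap.inCoordinates (Fib N) E (Fib N) E x₁ x x₁ x (s x)) x) :
    ContMDiffAt (𝓡 n) 𝓘(ℝ, Fib N →L[ℂ] Fib N) ∞
      (fun x => ContinuousLinearMap.inCoordinates (Fib N) E (Fib N) E x₀ x x₀ x (s x)) x := by
  have hopen : (trivializationAt (Fib N) E x₀).baseSet ∩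
      (trivializationAt (Fib N) E x₁).baseSet ∈ 𝓝 x :=
    ((trivializationAt (Fib N) E x₀).open_baseSet.inter
      (trivializationAt (Fib N) E x₁).open_baseSet).mem_nhds ⟨h₀, h₁⟩
  have c1 := (hE (trivializationAt (Fib N) E x₀) (trivializationAt (Fib N) E x₁)).contMDiffAt hopen
  have c2 := (hE (trivializationAt (Fib N) E x₁) (trivializationAt (Fib N) E x₀)).contMDiffAt
    (by rwa [Set.inter_comm])
  have hmul : ContDiff ℝ ∞ fun p : (Fib N →L[ℂ] Fib N) × (Fib N →L[ℂ] Fib N) => p.1 * p.2 :=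
    contDiff_mul
  have h3 := hmul.contMDiff.contMDiffAt.comp x (h.prodMk_space c1)
  have h4 := hmul.contMDiff.contMDiffAt.comp x (c2.prodMk_space h3)
  refine h4.congr_of_eventuallyEq ?_
  filter_upwards [hopen] with y hy
  exact inCoordinates_change x₀ x₁ y hy.1 hy.2 (s y)

theorem Sec.contMDiffAt_stdFibre (hE : IsSmoothBundle n N E) (γ : Sec n N E) {x₀ x : M}
    (h : x ∈ (trivializationAt (Fib N) E x₀).baseSet) (i j : Fin N) :
    ContMDiffAt (𝓡 n) 𝓘(ℝ, ℂ) ∞ (fun x => stdFibre x₀ x (γ.1 x) i j) x := by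
  have h1 := contMDiffAt_inCoordinates_iff hE (s := γ.1) h
    (FiberBundle.mem_baseSet_trivializationAt (Fib N) E x) ((isSmoothSection_iff γ.1).1 γ.2 x)
  refine (contMDiffAt_endMat.1 h1 i j).congr_of_eventuallyEq ?_
  filter_upwards [(trivializationAt (Fib N) E x₀).open_baseSet.mem_nhds h] with y hy
  rw [stdFibre_eq hy]

/-- The trivialization may be chosen separately at each point. This suits sections given by a
formula over one trivialization and extended by zero. -/
theorem isSmoothSection_of_stdFibre (hE : IsSmoothBundle n N E) {s : ∀ x, EndFib E x}
    (h : ∀ x, ∃ x₀, x ∈ (trivializationAt (Fib N) E x₀).baseSet ∧ ∀ i j,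
      ContMDiffAt (𝓡 n) 𝓘(ℝ, ℂ) ∞ (fun x => (stdFibre x₀ x (s x) : Mat N) i j) x) :
    IsSmoothSection n N s := by
  rw [isSmoothSection_iff]
  intro x
  obtain ⟨x₀, hx, hs⟩ := h x
  refine contMDiffAt_inCoordinates_iff hE
    (FiberBundle.mem_baseSet_trivializationAt (Fib N) E x) hx (contMDiffAt_endMat.2 fun i j => ?_)
  refine (hs i j).congr_of_eventuallyEq ?_
  filter_upwards [(trivializationAt (Fib N) E x₀).open_baseSet.mem_nhds hx] with y hy
  rw [stdFibre_eq hy]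

end Std

section Local

variable {n N : ℕ} {M : Type*} [TopologicalSpace M] [ChartedSpace (Eucl n) M]
  {E : M → Type*} [∀ x, AddCommGroup (E x)] [∀ x, Module ℂ (E x)]
  [∀ x, TopologicalSpace (E x)] [TopologicalSpace (TotalSpace (Fib N) E)]
  [FiberBundle (Fib N) E] [VectorBundle ℂ (Fib N) E]
  [∀ x, IsTopologicalAddGroup (E x)] [∀ x, ContinuousSMul ℂ (E x)]

/-! ### Sections in a local trivialization -/

theorem LocalTriv.pull_apply_chart (Ψ : LocalTriv n N E) (γ : Sec n N E) {x : M}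
    (hx : x ∈ Ψ.chart.source) : Ψ.pull γ (Ψ.chart x) = Ψ.fibre x (γ.1 x) := by
  have h : ∀ z, z = x → Ψ.fibre z (γ.1 z) = Ψ.fibre x (γ.1 x) := by
    rintro _ rfl
    rfl
  exact h _ (Ψ.chart.left_inv hx)

theorem LocalTriv.pull_add (Ψ : LocalTriv n N E) (γ η : Sec n N E) :
    Ψ.pull (γ + η) = fun y => Ψ.pull γ y + Ψ.pull η y :=
  funext fun _ => map_add _ _ _

theorem LocalTriv.pull_mul (Ψ : LocalTriv n N E) (γ η : Sec n N E) :
    Ψ.pull (γ * η) = fun y => Ψ.pull γ y * Ψ.pull η y :=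
  funext fun _ => map_mul _ _ _

theorem LocalTriv.pull_algebraMap (Ψ : LocalTriv n N E) (c : ℂ) :
    Ψ.pull (algebraMap ℂ (Sec n N E) c) = fun _ => algebraMap ℂ (Mat N) c :=
  funext fun _ => AlgEquiv.commutes _ _

variable [IsManifold (𝓡 n) ∞ M]

theorem LocalTriv.contDiffOn_pull (Ψ : LocalTriv n N E) (γ : Sec n N E) (i j : Fin N) :
    ContDiffOn ℝ ∞ (fun y => Ψ.pull γ y i j) Ψ.chart.target :=
  contMDiffOn_iff_contDiffOn.1 ((Ψ.smooth γ i j).comp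
    (contMDiffOn_symm_of_mem_maximalAtlas Ψ.chart_mem) fun _ hy => Ψ.chart.map_target hy)

/-- Taylor expansion of sections in a local trivialization. -/
def LocalTriv.taylorHom (Ψ : LocalTriv n N E) {y : Eucl n} (hy : y ∈ Ψ.chart.target) :
    Sec n N E →ₐ[ℂ] MatPS n N :=
  AlgHom.ofLinearMap
    { toFun := fun γ => taylor (Ψ.pull γ) y
      map_add' := fun γ η => by
        rw [Ψ.pull_add]
        exact taylor_add Ψ.chart.open_target (Ψ.contDiffOn_pull γ) (Ψ.contDiffOn_pull η) hy
      map_smul' := fun c γ => by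
        rw [Algebra.smul_def, Ψ.pull_mul, taylor_mul Ψ.chart.open_target
          (Ψ.contDiffOn_pull _) (Ψ.contDiffOn_pull γ) hy, Ψ.pull_algebraMap, taylor_const,
          constMat_algebraMap, RingHom.id_apply, ← Algebra.smul_def] }
    (by
      change taylor (Ψ.pull 1) y = 1
      rw [← map_one (algebraMap ℂ (Sec n N E)), Ψ.pull_algebraMap, taylor_const,
        constMat_algebraMap, map_one])
    (fun γ η => by
      change taylor (Ψ.pull (γ * η)) y = _
      rw [Ψ.pull_mul]
      exact taylor_mul Ψ.chart.open_target (Ψ.contDiffOn_pull γ) (Ψ.contDiffOn_pull η) hy)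

theorem LocalTriv.taylorHom_apply (Ψ : LocalTriv n N E) {y : Eucl n} (hy : y ∈ Ψ.chart.target)
    (γ : Sec n N E) : Ψ.taylorHom hy γ = taylor (Ψ.pull γ) y := rfl

variable (n N E) in
/-- The standard local trivialization at `x₀`. -/
def stdTriv (hE : IsSmoothBundle n N E) (x₀ : M) : LocalTriv n N E where
  chart := (chartAt (Eucl n) x₀).restr (trivializationAt (Fib N) E x₀).baseSet
  chart_mem := restr_mem_maximalAtlas _ (IsManifold.chart_mem_maximalAtlas x₀)
    (trivializationAt (Fib N) E x₀).open_baseSet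
  fibre := stdFibre x₀
  smooth γ i j := fun _ hx => (Sec.contMDiffAt_stdFibre hE γ
    (interior_subset hx.2) i j).contMDiffWithinAt

variable {hE : IsSmoothBundle n N E}

theorem mem_stdTriv_source {x₀ x : M} : x ∈ (stdTriv n N E hE x₀).chart.source ↔
    x ∈ (chartAt (Eucl n) x₀).source ∧ x ∈ (trivializationAt (Fib N) E x₀).baseSet := by
  change x ∈ (chartAt (Eucl n) x₀).source ∩ interior _ ↔ _
  rw [(trivializationAt (Fib N) E x₀).open_baseSet.interior_eq]
  rfl

theorem self_mem_stdTriv_source (x₀ : M) : x₀ ∈ (stdTriv n N E hE x₀).chart.source :=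
  mem_stdTriv_source.2 ⟨mem_chart_source _ _, FiberBundle.mem_baseSet_trivializationAt (Fib N) E x₀⟩

/-- Multiplication of a section by a smooth real function. -/
def smulSec (hE : IsSmoothBundle n N E) {h : M → ℝ} (hh : ContMDiff (𝓡 n) 𝓘(ℝ, ℝ) ∞ h)
    (γ : Sec n N E) : Sec n N E :=
  ⟨fun x => (h x : ℂ) • γ.1 x, isSmoothSection_of_stdFibre hE fun x => ⟨x,
    FiberBundle.mem_baseSet_trivializationAt (Fib N) E x, fun i j => by
      have h1 := Sec.contMDiffAt_stdFibre hE γ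
        (FiberBundle.mem_baseSet_trivializationAt (Fib N) E x) i j
      have h2 := (Complex.ofRealCLM.contDiff (n := ∞)).contMDiff.contMDiffAt.comp x (hh x)
      refine ((contDiff_mul (𝕜 := ℝ) (n := ∞)).contMDiff.contMDiffAt.comp x
        (h2.prodMk_space h1)).congr_of_eventuallyEq (Filter.Eventually.of_forall fun y => ?_)
      change stdFibre x y ((h y : ℂ) • γ.1 y) i j = (h y : ℂ) * stdFibre x y (γ.1 y) i j
      rw [map_smul]
      rfl⟩⟩

variable [T2Space M]

/-- Every smooth matrix valued function agrees near a point with a global section. -/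
theorem exists_sec_pull (x₀ : M) {m : M} (hm : m ∈ (stdTriv n N E hE x₀).chart.source)
    {a : Eucl n → Mat N} (ha : ∀ i j, ContDiff ℝ ∞ fun y => a y i j) :
    ∃ γ : Sec n N E, ((stdTriv n N E hE x₀).pull γ =ᶠ[𝓝 ((stdTriv n N E hE x₀).chart m)] a) ∧
      ∀ g : Eucl n → ℝ, (∀ y, a y = (g y : ℂ) • (1 : Mat N)) →
        ∃ h : M → ℝ, ∀ x, γ.1 x = (h x : ℂ) • (1 : EndFib E x) := by
  set Ψ := stdTriv n N E hE x₀ with hΨ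
  obtain ⟨χ, -, hχ⟩ := (SmoothBumpFunction.nhds_basis_tsupport (I := 𝓡 n) m).mem_iff.1
    (Ψ.chart.open_source.mem_nhds hm)
  -- The closed support of `χ` lies in the domain of `Ψ`, so the values of `Ψ` outside its domain
  -- are multiplied by zero.
  let s : ∀ x, EndFib E x := fun x => (χ x : ℂ) • (Ψ.fibre x).symm (a (Ψ.chart x))
  have hs : IsSmoothSection n N s := by
    refine isSmoothSection_of_stdFibre hE fun x => ?_
    by_cases hx : x ∈ tsupport χ
    · refine ⟨x₀, (mem_stdTriv_source.1 (hχ hx)).2, fun i j => ?_⟩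
      have h1 : ContMDiffAt (𝓡 n) 𝓘(ℝ, Eucl n) ∞ Ψ.chart x :=
        (contMDiffOn_of_mem_maximalAtlas Ψ.chart_mem).contMDiffAt
          (Ψ.chart.open_source.mem_nhds (hχ hx))
      have h2 := (ha i j).contMDiff.contMDiffAt.comp x h1
      have h3 := (Complex.ofRealCLM.contDiff (n := ∞)).contMDiff.contMDiffAt.comp x
        (χ.contMDiff x)
      refine ((contDiff_mul (𝕜 := ℝ) (n := ∞)).contMDiff.contMDiffAt.comp x
        (h3.prodMk_space h2)).congr_of_eventuallyEq (Filter.Eventually.of_forall fun y => ?_)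
      change stdFibre x₀ y ((χ y : ℂ) • (stdFibre x₀ y).symm (a (Ψ.chart y))) i j =
        (χ y : ℂ) * a (Ψ.chart y) i j
      rw [map_smul, AlgEquiv.apply_symm_apply]
      rfl
    · refine ⟨x, FiberBundle.mem_baseSet_trivializationAt (Fib N) E x, fun i j => ?_⟩
      refine (contMDiffAt_const (c := (0 : ℂ))).congr_of_eventuallyEq ?_
      filter_upwards [(isClosed_tsupport χ).isOpen_compl.mem_nhds hx] with y hy
      change stdFibre x y ((χ y : ℂ) • _) i j = 0
      rw [image_eq_zero_of_notMem_tsupport hy, Complex.ofReal_zero, zero_smul, map_zero]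
      rfl
  refine ⟨⟨s, hs⟩, ?_, ?_⟩
  · have hmt : Ψ.chart m ∈ Ψ.chart.target := Ψ.chart.map_source hm
    have hcont : Filter.Tendsto Ψ.chart.symm (𝓝 (Ψ.chart m)) (𝓝 m) := by
      have := Ψ.chart.continuousAt_symm hmt
      unfold ContinuousAt at this
      rwa [Ψ.chart.left_inv hm] at this
    filter_upwards [hcont χ.eventuallyEq_one, Ψ.chart.open_target.mem_nhds hmt] with y hy hyt
    change Ψ.fibre _ ((χ (Ψ.chart.symm y) : ℂ) • (Ψ.fibre _).symm
      (a (Ψ.chart (Ψ.chart.symm y)))) = a y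
    have hy' : χ (Ψ.chart.symm y) = 1 := hy
    rw [hy', Complex.ofReal_one, one_smul, AlgEquiv.apply_symm_apply, Ψ.chart.right_inv hyt]
  · intro g hg
    -- The cut-off is real, so a real scalar function gives a section that is real scalar on all of
    -- `M`, as needed for `realJets`.
    refine ⟨fun x => χ x * g (Ψ.chart x), fun x => ?_⟩
    change (χ x : ℂ) • (Ψ.fibre x).symm (a (Ψ.chart x)) = _
    rw [hg, map_smul, map_one, smul_smul, Complex.ofReal_mul]

/-- A section that vanishes near `m` lies in all powers of `I_m`. -/
theorem mem_vanIdeal_pow_of_eventually (hE : IsSmoothBundle n N E) {γ : Sec n N E} {m : M}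
    (h : ∀ᶠ x in 𝓝 m, γ.1 x = 0) (k : ℕ) : γ ∈ vanIdeal n N E m ^ k := by
  obtain ⟨χ, -, hχ⟩ := (SmoothBumpFunction.nhds_basis_tsupport (I := 𝓡 n) m).mem_iff.1 h
  have hsm : ContMDiff (𝓡 n) 𝓘(ℝ, ℝ) ∞ fun x => 1 - χ x :=
    (contMDiff_const (c := (1 : ℝ))).sub χ.contMDiff
  -- With `χ = 1` at `m` and `χ` supported where `γ` vanishes, `η = 1 - χ` lies in `I_m` and `η γ =
  -- γ`. Hence `γ = η ^ k γ` for every `k`.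
  let η : Sec n N E := smulSec hE hsm 1
  have hη : η ∈ vanIdeal n N E m := by
    change ((1 - χ m : ℝ) : ℂ) • (1 : EndFib E m) = 0
    rw [χ.eq_one]
    simp
  have hγ : η * γ = γ := by
    refine Subtype.ext (funext fun x => ?_)
    change (((1 - χ x : ℝ) : ℂ) • (1 : EndFib E x)) * γ.1 x = γ.1 x
    by_cases hx : x ∈ tsupport χ
    · have : γ.1 x = 0 := hχ hx
      rw [this, mul_zero]
    · rw [image_eq_zero_of_notMem_tsupport hx]
      simp
  induction k with
  | zero =>
    rw [Submodule.pow_zero, Ideal.one_eq_top]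
    trivial
  | succ k ih =>
    rw [Ideal.IsTwoSided.pow_succ, ← hγ]
    exact Ideal.mul_mem_mul hη ih

theorem sub_mem_vanIdeal_pow {x₀ m : M} (hm : m ∈ (stdTriv n N E hE x₀).chart.source)
    {γ η : Sec n N E} (h : (stdTriv n N E hE x₀).pull γ
      =ᶠ[𝓝 ((stdTriv n N E hE x₀).chart m)] (stdTriv n N E hE x₀).pull η) (k : ℕ) :
    γ - η ∈ vanIdeal n N E m ^ k := by
  set Ψ := stdTriv n N E hE x₀ with hΨ
  refine mem_vanIdeal_pow_of_eventually hE ?_ k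
  filter_upwards [(Ψ.chart.continuousAt hm) h, Ψ.chart.open_source.mem_nhds hm] with x hx hxs
  have h1 : Ψ.pull γ (Ψ.chart x) = Ψ.pull η (Ψ.chart x) := hx
  rw [Ψ.pull_apply_chart γ hxs, Ψ.pull_apply_chart η hxs] at h1
  change γ.1 x - η.1 x = 0
  rw [(Ψ.fibre x).injective h1, sub_self]

theorem mem_vanIdeal_iff {γ : Sec n N E} {m : M} : γ ∈ vanIdeal n N E m ↔ γ.1 m = 0 := Iff.rfl

/-! ### Powers of the ideal of sections vanishing at a point -/

/-- The monomial `∏ (z_s - p_s)^{J_s}` times the matrix unit `(a, b)`, as a function on `ℝⁿ`. -/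
def monoMat (p : Eucl n) (J : Fin n →₀ ℕ) (a b : Fin N) (z : Eucl n) : Mat N :=
  ((∏ s, (z s - p s) ^ J s : ℝ) : ℂ) • Matrix.single a b 1

theorem contDiff_monoMat (p : Eucl n) (J : Fin n →₀ ℕ) (a b i j : Fin N) :
    ContDiff ℝ ∞ fun z => monoMat p J a b z i j := by
  have h : ContDiff ℝ ∞ fun z : Eucl n => ∏ s, (z s - p s) ^ J s := by
    refine contDiff_prod fun s _ => ?_
    fun_prop
  exact (Complex.ofRealCLM.contDiff.comp h).mul contDiff_const

theorem monoMat_add_single (p : Eucl n) (J : Fin n →₀ ℕ) (s : Fin n) (a b : Fin N)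
    (z : Eucl n) : monoMat p (J + Finsupp.single s 1) a b z =
      (((z s - p s : ℝ) : ℂ) • (1 : Mat N)) * monoMat p J a b z := by
  classical
  unfold monoMat
  rw [smul_mul_smul_comm, one_mul, ← Complex.ofReal_mul]
  congr 3
  rw [← Finset.mul_prod_erase _ _ (Finset.mem_univ s),
    ← Finset.mul_prod_erase Finset.univ (fun t => (z t - p t) ^ J t) (Finset.mem_univ s)]
  rw [Finset.prod_congr rfl (g := fun t => (z t - p t) ^ J t)]
  · simp [pow_succ']
    ring
  · intro t ht
    simp [(Finset.ne_of_mem_erase ht).symm]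

theorem contDiff_coordMat (p : Eucl n) (s : Fin n) (i j : Fin N) :
    ContDiff ℝ ∞ fun z : Eucl n => (((z s - p s : ℝ) : ℂ) • (1 : Mat N)) i j := by
  have h : ContDiff ℝ ∞ fun z : Eucl n => z s - p s := by fun_prop
  exact (Complex.ofRealCLM.contDiff.comp h).mul contDiff_const

theorem taylor_monoMat (p : Eucl n) (J : Fin n →₀ ℕ) (a b : Fin N) :
    taylor (monoMat p J a b) p = unitMonomial J a b := by
  induction hd : J.degree generalizing J with
  | zero =>
    rw [Finsupp.degree_eq_zero_iff] at hd
    subst hd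
    rw [← constMat_single, ← taylor_const _ p]
    congr 1
    funext z
    simp [monoMat]
  | succ d ih =>
    obtain ⟨s, hs⟩ : ∃ s, J s ≠ 0 := by
      by_contra hcon
      push Not at hcon
      have : J = 0 := Finsupp.ext hcon
      simp [this] at hd
    have hle : Finsupp.single s 1 ≤ J :=
      Finsupp.single_le_iff.2 (Nat.one_le_iff_ne_zero.2 hs)
    obtain ⟨K, rfl⟩ : ∃ K, J = K + Finsupp.single s 1 := ⟨_, (tsub_add_cancel_of_le hle).symm⟩
    have h1 : monoMat p (K + Finsupp.single s 1) a b = fun z =>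
        (((z s - p s : ℝ) : ℂ) • (1 : Mat N)) * monoMat p K a b z :=
      funext fun z => monoMat_add_single p K s a b z
    rw [h1, taylor_mul isOpen_univ (fun i j => (contDiff_coordMat p s i j).contDiffOn)
      (fun i j => (contDiff_monoMat p K a b i j).contDiffOn) (Set.mem_univ p), taylor_coord,
      ih K (by simpa using hd), unitMonomial_add_single]
    simp

/-- The powers of `I_m` are the preimages of the adic filtration under Taylor expansion. -/
theorem mem_vanIdeal_pow_iff {x₀ m : M} (hm : m ∈ (stdTriv n N E hE x₀).chart.source) :
    (∀ k a, (stdTriv n N E hE x₀).taylorHom ((stdTriv n N E hE x₀).chart.map_source hm) a ∈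
      adicSub n N k ↔ a ∈ vanIdeal n N E m ^ k) ∧
    ∀ k f, ∃ a, (stdTriv n N E hE x₀).taylorHom ((stdTriv n N E hE x₀).chart.map_source hm) a - f ∈
      adicSub n N k := by
  set Ψ := stdTriv n N E hE x₀ with hΨ
  set p := Ψ.chart m with hp
  have hpt : p ∈ Ψ.chart.target := Ψ.chart.map_source hm
  -- `F I a b` and `ξ s` are global sections whose germs at `m` are the monomials times matrix units
  -- and the coordinates, both centred at `p`.
  choose F hF _ using fun (I : Fin n →₀ ℕ) (a b : Fin N) =>
    exists_sec_pull (hE := hE) x₀ hm (contDiff_monoMat p I a b)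
  choose ξ hξ _ using fun (s : Fin n) =>
    exists_sec_pull (N := N) (E := E) (hE := hE) x₀ hm (contDiff_coordMat p s)
  refine mem_pow_iff_of_hadamard (E := F) (ξ := ξ) ?_ ?_ ?_ ?_ ?_
  · intro γ hγ
    rw [mem_adicSub_iff]
    intro i j I hI
    have hI : I = 0 := by rw [← Finsupp.degree_eq_zero_iff]; omega
    subst hI
    refine (coeffEntry_zero_taylor _ _ i j).trans ?_
    rw [Ψ.pull_apply_chart γ hm, mem_vanIdeal_iff.1 hγ, map_zero]
    rfl
  · intro I a b
    rw [Ψ.taylorHom_apply, taylor_congr (hF I a b), taylor_monoMat]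
  · intro s
    rw [mem_vanIdeal_iff]
    apply (Ψ.fibre m).injective
    rw [← Ψ.pull_apply_chart (ξ s) hm, (hξ s).self_of_nhds, map_zero]
    simp [← hΨ, ← hp]
  · intro k s I a b
    refine sub_mem_vanIdeal_pow hm ?_ k
    rw [← hΨ, Ψ.pull_mul]
    filter_upwards [hξ s, hF I a b, hF (I + Finsupp.single s 1) a b] with y h1 h2 h3
    rw [h1, h2, h3, monoMat_add_single]
  · intro γ
    -- Each entry of the section is replaced by a globally smooth function with the same germ, so
    -- that `hadamard` applies. Its remainders are again realised by global sections `η s`.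
    choose g hg hgγ using fun i j => exists_contDiff_eventuallyEq Ψ.chart.open_target
      (Ψ.contDiffOn_pull γ i j) hpt
    choose b hb hgb using fun i j => hadamard (hg i j) p
    choose η hη _ using fun s => exists_sec_pull (hE := hE) x₀ hm
      (a := fun y => Matrix.of fun i j => b i j s y) (fun i j => hb i j s)
    refine ⟨fun i j => g i j p, η, fun k => sub_mem_vanIdeal_pow hm ?_ k⟩
    rw [← hΨ]
    have e1 : Ψ.pull (∑ i, ∑ j, g i j p • F 0 i j + ∑ s, ξ s * η s) = fun y =>
        ∑ i, ∑ j, g i j p • Ψ.pull (F 0 i j) y + ∑ s, Ψ.pull (ξ s) y * Ψ.pull (η s) y := by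
      funext y
      let φ : Sec n N E →ₐ[ℂ] Mat N := (Ψ.fibre (Ψ.chart.symm y)).toAlgHom.comp
        ((Pi.evalAlgHom ℂ (EndFib E) (Ψ.chart.symm y)).comp (Sec n N E).val)
      have hφ : ∀ γ, Ψ.pull γ y = φ γ := fun _ => rfl
      simp only [hφ, map_add, map_sum, map_smul, map_mul]
    rw [e1]
    filter_upwards [Filter.eventually_all.2 fun i => Filter.eventually_all.2 fun j => hgγ i j,
      Filter.eventually_all.2 fun i => Filter.eventually_all.2 fun j => hF 0 i j,
      Filter.eventually_all.2 hξ, Filter.eventually_all.2 hη] with y h1 h2 h3 h4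
    simp only [← hΨ] at h2 h3 h4
    simp only [h2, h3, h4]
    refine Matrix.ext fun i j => ?_
    rw [← h1 i j, hgb i j y, Matrix.add_apply, Matrix.sum_apply, Matrix.sum_apply]
    congr 1
    · rw [Finset.sum_eq_single i, Matrix.sum_apply, Finset.sum_eq_single j]
      · simp [monoMat]
      · intro j' _ hj'
        simp [monoMat, hj']
      · simp
      · intro i' _ hi'
        rw [Matrix.sum_apply]
        exact Finset.sum_eq_zero fun j' _ => by simp [monoMat, hi']
      · simp
    · refine Finset.sum_congr rfl fun s _ => ?_
      rw [smul_mul_assoc, one_mul]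
      rfl

/-! ### Frames from Taylor expansion -/

theorem coeff_realScalar (r : MvPowerSeries (Fin n) ℝ) (I : Fin n →₀ ℕ) (i j : Fin N) :
    MvPowerSeries.coeff I (realScalar n N r i j) =
      if i = j then ((MvPowerSeries.coeff I r : ℝ) : ℂ) else 0 := by
  simp only [realScalar, Matrix.scalar_apply, Matrix.diagonal_apply]
  split_ifs
  · rw [MvPowerSeries.coeff_map]
    rfl
  · simp

/-- Real scalar series are approximated by Taylor series of real scalar sections. -/
theorem exists_real_sec {x₀ m : M} (hm : m ∈ (stdTriv n N E hE x₀).chart.source)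
    (r : MvPowerSeries (Fin n) ℝ) (k : ℕ) :
    ∃ γ : Sec n N E, (∃ h : M → ℝ, ∀ x, γ.1 x = (h x : ℂ) • (1 : EndFib E x)) ∧
      (stdTriv n N E hE x₀).taylorHom ((stdTriv n N E hE x₀).chart.map_source hm) γ -
        realScalar n N r ∈ adicSub n N k := by
  set Ψ := stdTriv n N E hE x₀ with hΨ
  set p := Ψ.chart m with hp
  have hpt : p ∈ Ψ.chart.target := Ψ.chart.map_source hm
  choose F hF _ using fun (I : Fin n →₀ ℕ) (a b : Fin N) =>
    exists_sec_pull (hE := hE) x₀ hm (contDiff_monoMat p I a b)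
  -- `Γ` has the required Taylor series, but it need not be real scalar away from `m`, as its
  -- summands may have different cut-offs. Below, `γ` is real scalar everywhere and has the same
  -- germ at `m`.
  let Γ : Sec n N E := ∑ J ∈ degLT n k, ∑ a, ∑ b,
    MvPowerSeries.coeff J (realScalar n N r a b) • F J a b
  have hTΓ : Ψ.taylorHom hpt Γ = truncMat k (realScalar n N r) := by
    simp only [Γ, truncMat, map_sum, map_smul]
    refine Finset.sum_congr rfl fun J _ => Finset.sum_congr rfl fun a _ =>
      Finset.sum_congr rfl fun b _ => ?_
    rw [Ψ.taylorHom_apply, taylor_congr (hF J a b), taylor_monoMat]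
  let g : Eucl n → ℝ := fun z =>
    ∑ J ∈ degLT n k, MvPowerSeries.coeff J r * ∏ s, (z s - p s) ^ J s
  have hg : ContDiff ℝ ∞ g := by
    refine ContDiff.sum fun J _ => contDiff_const.mul (contDiff_prod fun s _ => ?_)
    fun_prop
  obtain ⟨γ, hγ, hreal⟩ := exists_sec_pull (hE := hE) x₀ hm
    (a := fun z => (g z : ℂ) • (1 : Mat N)) fun i j =>
      (Complex.ofRealCLM.contDiff.comp hg).mul contDiff_const
  refine ⟨γ, hreal g fun _ => rfl, ?_⟩
  have hpull : Ψ.pull γ =ᶠ[𝓝 p] Ψ.pull Γ := by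
    have e1 : Ψ.pull Γ = fun y => ∑ J ∈ degLT n k, ∑ a, ∑ b,
        MvPowerSeries.coeff J (realScalar n N r a b) • Ψ.pull (F J a b) y := by
      funext y
      let φ : Sec n N E →ₐ[ℂ] Mat N := (Ψ.fibre (Ψ.chart.symm y)).toAlgHom.comp
        ((Pi.evalAlgHom ℂ (EndFib E) (Ψ.chart.symm y)).comp (Sec n N E).val)
      have hφ : ∀ γ, Ψ.pull γ y = φ γ := fun _ => rfl
      simp only [hφ, Γ, map_sum, map_smul]
    rw [e1]
    filter_upwards [hγ, (Filter.eventually_all_finset (degLT n k)).2 fun J _ =>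
      Filter.eventually_all.2 fun a => Filter.eventually_all.2 fun b => hF J a b] with y h1 h2
    simp only [← hΨ] at h1 h2
    rw [h1]
    refine Matrix.ext fun i j => ?_
    simp only [Matrix.sum_apply, Matrix.smul_apply, g, Complex.ofReal_sum, smul_eq_mul,
      Finset.sum_mul]
    refine Finset.sum_congr rfl fun J hJ => ?_
    simp only [h2 J hJ, coeff_realScalar, monoMat, Matrix.smul_apply, Matrix.single_apply,
      smul_eq_mul]
    rw [Finset.sum_eq_single i, Finset.sum_eq_single j]
    · by_cases hij : i = j
      · simp [hij, Matrix.one_apply]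
      · simp [hij]
    · intro b _ hb; simp [hb]
    · simp
    · intro a _ ha
      exact Finset.sum_eq_zero fun b _ => by simp [ha]
    · simp
  have h3 := neg_mem (sub_truncMat_mem k (realScalar n N r))
  rw [neg_sub, ← hTΓ, Ψ.taylorHom_apply, ← taylor_congr hpull] at h3
  exact h3

set_option maxHeartbeats 1000000 in
/-- The frame at `m` given by Taylor expansion in a standard local trivialization. -/
theorem exists_frame {x₀ m : M} (hm : m ∈ (stdTriv n N E hE x₀).chart.source) :
    ∃ Φ : Frame n N E m,
      (∀ γ, Φ.toEquiv.symm (jet n N E m γ) =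
        taylor ((stdTriv n N E hE x₀).pull γ) ((stdTriv n N E hE x₀).chart m)) ∧
      ∀ f, ∃ γ : Sec n N E, (Φ.toEquiv f).1 1 = Ideal.Quotient.mk (vanIdeal n N E m ^ 1) γ ∧
        ∀ i j, stdFibre x₀ m (γ.1 m) i j = coeffEntry 0 i j f := by
  set Ψ := stdTriv n N E hE x₀ with hΨ
  set p := Ψ.chart m with hp
  have hpt : p ∈ Ψ.chart.target := Ψ.chart.map_source hm
  obtain ⟨hT, hd⟩ := mem_vanIdeal_pow_iff (hE := hE) hm
  obtain ⟨e, he1, he2, he3⟩ := exists_equiv_invLimit (vanIdeal n N E m) (Ψ.taylorHom hpt) hT hd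
  have hev : ∀ γ : Sec n N E, ∀ i j,
      stdFibre x₀ m (γ.1 m) i j = coeffEntry 0 i j (Ψ.taylorHom hpt γ) := by
    intro γ i j
    rw [Ψ.taylorHom_apply, coeffEntry_zero_taylor, Ψ.pull_apply_chart γ hm]
    rfl
  refine ⟨⟨e, fun k => ⟨k, fun f hf => (he3 k f).2 hf⟩, fun k => ⟨k, fun a ha => ?_⟩,
    fun f => ⟨?_, ?_⟩⟩, fun γ => ?_, fun f => ?_⟩
  · rw [← mem_adicSub, ← he3, AlgEquiv.apply_symm_apply, ha]
  · rintro ⟨r, rfl⟩ k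
    obtain ⟨γ, hγ, hγr⟩ := exists_real_sec (hE := hE) hm r k
    exact ⟨γ, hγ, ((he2 k _ γ).1 hγr).symm⟩
  · intro hf
    -- To order `k` the series `f` agrees with the Taylor series of a real scalar section. Every
    -- coefficient of `f` is therefore that of a real scalar series, and the real series is
    -- assembled coefficient by coefficient.
    choose γ hγr hγ using hf
    have h1 : ∀ k, Ψ.taylorHom hpt (γ k) - f ∈ adicSub n N k := by
      intro k
      exact (he2 k f (γ k)).2 (hγ k).symm
    have h2 : ∀ k, Ψ.taylorHom hpt (γ k) ∈ Set.range (realScalar n N) := by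
      intro k
      obtain ⟨h, hh⟩ := hγr k
      refine taylor_real (h := fun y => h (Ψ.chart.symm y)) (Filter.Eventually.of_forall
        fun y => ?_)
      unfold LocalTriv.pull
      rw [hh, map_smul, map_one]
    choose r hr using h2
    refine ⟨mkPS fun I => MvPowerSeries.coeff I (r (I.degree + 1)), matPS_ext fun I i j => ?_⟩
    rw [← coeffEntry_eq_of_sub_mem (h1 (I.degree + 1)) (Nat.lt_succ_self _) i j, ← hr,
      coeffEntry_apply, coeffEntry_apply, coeff_realScalar, coeff_realScalar, coeff_mkPS]
  · change e.symm (toInvLimit (vanIdeal n N E m) γ) = Ψ.taylorHom hpt γ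
    rw [← he1, AlgEquiv.symm_apply_apply]
  · obtain ⟨γ, hγ⟩ := hd 1 f
    refine ⟨γ, (he2 1 f γ).1 hγ, fun i j => ?_⟩
    rw [hev]
    exact coeffEntry_eq_of_sub_mem hγ (by simp) i j

end Local

section OmegaExists

variable {n N : ℕ} {M : Type*} [TopologicalSpace M] [ChartedSpace (Eucl n) M]
  {E : M → Type*} [∀ x, AddCommGroup (E x)] [∀ x, Module ℂ (E x)]
  [∀ x, TopologicalSpace (E x)] [TopologicalSpace (TotalSpace (Fib N) E)]
  [FiberBundle (Fib N) E] [VectorBundle ℂ (Fib N) E]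
  [∀ x, IsTopologicalAddGroup (E x)] [∀ x, ContinuousSMul ℂ (E x)]
  [IsManifold (𝓡 n) ∞ M] [T2Space M] {hE : IsSmoothBundle n N E}

/-! ### The standard local frame fields -/

variable (n N E) in
/-- The local frame field given by Taylor expansion in the standard local trivialization at
`x₀`. -/
def stdFrame (hE : IsSmoothBundle n N E) (x₀ m : M) : Frame n N E m :=
  open Classical in
  if h : m ∈ (stdTriv n N E hE x₀).chart.source then (exists_frame h).choose
  -- Off the domain any frame will do; the one from the standard trivialization at `m` itself
  -- serves.
  else (exists_frame (self_mem_stdTriv_source (hE := hE) m)).choose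

theorem stdFrame_symm_jet {x₀ m : M} (h : m ∈ (stdTriv n N E hE x₀).chart.source)
    (γ : Sec n N E) : (stdFrame n N E hE x₀ m).toEquiv.symm (jet n N E m γ) =
      taylor ((stdTriv n N E hE x₀).pull γ) ((stdTriv n N E hE x₀).chart m) := by
  unfold stdFrame
  rw [dif_pos h]
  exact (exists_frame h).choose_spec.1 γ

theorem stdFrame_eval {x₀ m : M} (h : m ∈ (stdTriv n N E hE x₀).chart.source) (f : MatPS n N) :
    ∃ γ : Sec n N E, ((stdFrame n N E hE x₀ m).toEquiv f).1 1 =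
      Ideal.Quotient.mk (vanIdeal n N E m ^ 1) γ ∧
      ∀ i j, stdFibre x₀ m (γ.1 m) i j = coeffEntry 0 i j f := by
  unfold stdFrame
  rw [dif_pos h]
  exact (exists_frame h).choose_spec.2 f

theorem smoothFrameOn_stdFrame (x₀ : M) :
    SmoothFrameOn n N E (stdFrame n N E hE x₀) (stdTriv n N E hE x₀).chart.source := by
  intro γ I i j
  have h1 := ((isParallelOn_taylor (stdTriv n N E hE x₀).chart.open_target
    ((stdTriv n N E hE x₀).contDiffOn_pull γ)) I i j).1
  refine (h1.contMDiffOn.comp (contMDiffOn_of_mem_maximalAtlas (stdTriv n N E hE x₀).chart_mem)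
    fun x hx => (stdTriv n N E hE x₀).chart.map_source hx).congr fun x hx => ?_
  rw [stdFrame_symm_jet hx]
  rfl

/-! ### Lifts of paths in the standard local frame fields -/

theorem addRight_mem_contDiffGroupoid (w : Eucl n) :
    (Homeomorph.addRight w).toOpenPartialHomeomorph ∈ contDiffGroupoid ∞ (𝓡 n) := by
  rw [contDiffGroupoid, mem_groupoid_of_pregroupoid]
  constructor
  · have h : ContDiff ℝ ∞ fun y : Eucl n => y + w := by fun_prop
    exact h.contDiffOn
  · have h : ContDiff ℝ ∞ fun y : Eucl n => y + -w := by fun_prop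
    exact h.contDiffOn

theorem transHomeomorph_addRight_mem {e : OpenPartialHomeomorph M (Eucl n)}
    (he : e ∈ IsManifold.maximalAtlas (𝓡 n) ∞ M) (w : Eucl n) :
    e.transHomeomorph (Homeomorph.addRight w) ∈ IsManifold.maximalAtlas (𝓡 n) ∞ M := by
  rw [OpenPartialHomeomorph.transHomeomorph_eq_trans]
  refine mem_maximalAtlas_iff.2 fun e' he' => ?_
  have h1 := mem_maximalAtlas_iff.1 he e' he'
  have hτ := addRight_mem_contDiffGroupoid w
  constructor
  · rw [OpenPartialHomeomorph.trans_symm_eq_symm_trans_symm, OpenPartialHomeomorph.trans_assoc]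
    exact StructureGroupoid.trans _ (StructureGroupoid.symm _ hτ) h1.1
  · rw [← OpenPartialHomeomorph.trans_assoc]
    exact StructureGroupoid.trans _ h1.2 hτ

/-- A local trivialization with translated chart. -/
def LocalTriv.translate (Ψ : LocalTriv n N E) (w : Eucl n) : LocalTriv n N E where
  chart := Ψ.chart.transHomeomorph (Homeomorph.addRight (-w))
  chart_mem := transHomeomorph_addRight_mem Ψ.chart_mem (-w)
  fibre := Ψ.fibre
  smooth := Ψ.smooth

theorem LocalTriv.translate_chart (Ψ : LocalTriv n N E) (w : Eucl n) (x : M) :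
    (Ψ.translate w).chart x = Ψ.chart x + -w := rfl

theorem LocalTriv.translate_chart_symm (Ψ : LocalTriv n N E) (w y : Eucl n) :
    (Ψ.translate w).chart.symm y = Ψ.chart.symm (y + w) := by
  change Ψ.chart.symm (y + - -w) = _
  rw [neg_neg]

theorem LocalTriv.mem_translate_target (Ψ : LocalTriv n N E) (w y : Eucl n) :
    y ∈ (Ψ.translate w).chart.target ↔ y + w ∈ Ψ.chart.target := by
  change y + - -w ∈ Ψ.chart.target ↔ _
  rw [neg_neg]

theorem LocalTriv.translate_pull (Ψ : LocalTriv n N E) (w y : Eucl n) (γ : Sec n N E) :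
    (Ψ.translate w).pull γ y = Ψ.pull γ (y + w) := by
  change Ψ.fibre _ (γ.1 _) = Ψ.fibre _ (γ.1 _)
  rw [Ψ.translate_chart_symm]

/-- In the standard local frame field, `σ^*ω` is minus the derivative in the formal
variables. -/
theorem isPullbackOmega_stdFrame {x₀ x : M} (hx : x ∈ (stdTriv n N E hE x₀).chart.source)
    (v : TangentSpace (𝓡 n) x) :
    IsPullbackOmega (stdFrame n N E hE x₀) x v
      (negDirDer n N (mfderiv (𝓡 n) 𝓘(ℝ, Eucl n) (extChartAt (𝓡 n) x₀) x v)) := by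
  set Ψ := stdTriv n N E hE x₀ with hΨ
  set w : Eucl n := mfderiv (𝓡 n) 𝓘(ℝ, Eucl n) (extChartAt (𝓡 n) x₀) x v with hw
  set p : Eucl n := Ψ.chart x with hp
  have hpt : p ∈ Ψ.chart.target := Ψ.chart.map_source hx
  have hline : ContDiff ℝ ∞ fun q : ℝ × Eucl n => q.2 + (p + q.1 • w) := by fun_prop
  let c : ℝ → M := fun t => Ψ.chart.symm (p + t • w)
  have hc0 : c 0 = x := by
    change Ψ.chart.symm (p + (0 : ℝ) • w) = x
    rw [zero_smul, add_zero]
    exact Ψ.chart.left_inv hx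
  have hcast : ∀ z (h : z = x) , (h ▸ v : TangentSpace (𝓡 n) z) = (show Eucl n from v) := by
    rintro _ rfl
    rfl
  -- The path is a straight line in the chart. It is lifted by one trivialization whose chart is
  -- translated so that `p + t • w` becomes the origin.
  refine ⟨c, hc0, ?_, fun t => Ψ.translate (p + t • w), ?_, ?_⟩
  · rw [hcast _ hc0]
    have hx' := (mem_stdTriv_source.1 hx).1
    have hmd := mdifferentiable_chart (I := 𝓡 n) (M := M) x₀
    have h1 : HasMFDerivAt 𝓘(ℝ, Eucl n) (𝓡 n) (chartAt (Eucl n) x₀).symm (p + (0 : ℝ) • w)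
        (mfderiv 𝓘(ℝ, Eucl n) (𝓡 n) (chartAt (Eucl n) x₀).symm (p + (0 : ℝ) • w)) := by
      refine MDifferentiableAt.hasMFDerivAt ?_
      rw [zero_smul, add_zero]
      exact hmd.mdifferentiableAt_symm ((chartAt (Eucl n) x₀).map_source hx')
    have h2 : HasMFDerivAt 𝓘(ℝ, ℝ) 𝓘(ℝ, Eucl n) (fun t : ℝ => p + t • w) 0
        ((1 : ℝ →L[ℝ] ℝ).smulRight w) := by
      have h4 : HasDerivAt (fun t : ℝ => p + t • w) w 0 := by
        simpa using ((hasDerivAt_id (0 : ℝ)).smul_const w).const_add p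
      exact h4.hasFDerivAt.hasMFDerivAt
    have h3 := h1.comp (0 : ℝ) h2
    refine h3.congr_mfderiv ?_
    refine ContinuousLinearMap.ext_ring ?_
    have h5 := congrArg (fun L => L v) (hmd.symm_comp_deriv hx')
    have h6 : (mfderiv 𝓘(ℝ, Eucl n) (𝓡 n) (chartAt (Eucl n) x₀).symm (p + (0 : ℝ) • w))
        ((1 : ℝ) • w) = v := by
      rw [one_smul, zero_smul, add_zero]
      exact h5
    refine Eq.trans h6 ?_
    exact (one_smul ℝ (show Eucl n from v)).symm
  · refine ⟨{q | q.2 + (p + q.1 • w) ∈ Ψ.chart.target},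
      Ψ.chart.open_target.preimage hline.continuous, ?_, ?_, ?_, ?_, ?_⟩
    · simpa using hpt
    · intro q hq
      exact (Ψ.mem_translate_target _ _).2 hq
    · have h1 : ContMDiffOn 𝓘(ℝ, ℝ × Eucl n) (𝓡 n) ∞
          (fun q : ℝ × Eucl n => Ψ.chart.symm (q.2 + (p + q.1 • w)))
          {q | q.2 + (p + q.1 • w) ∈ Ψ.chart.target} :=
        (contMDiffOn_symm_of_mem_maximalAtlas Ψ.chart_mem).comp
          hline.contMDiff.contMDiffOn fun q hq => hq
      refine h1.congr fun q _ => ?_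
      exact Ψ.translate_chart_symm _ _
    · intro γ i j
      refine ((Ψ.contDiffOn_pull γ i j).comp hline.contDiffOn fun q hq => hq).congr fun q _ => ?_
      change (Ψ.translate _).pull γ q.2 i j = _
      rw [Ψ.translate_pull]
      rfl
    · intro t ht
      have ht' : p + t • w ∈ Ψ.chart.target := by simpa using ht
      refine ⟨?_, fun γ => ?_⟩
      · change (Ψ.translate _).chart.symm 0 = Ψ.chart.symm (p + t • w)
        rw [Ψ.translate_chart_symm, zero_add]
      · change (stdFrame n N E hE x₀ (c t)).toEquiv.symm (jet n N E (c t) γ) = _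
        rw [stdFrame_symm_jet (Ψ.chart.map_target ht')]
        have h1 : (Ψ.translate (p + t • w)).pull γ = fun y => Ψ.pull γ (y + (p + t • w)) :=
          funext fun y => Ψ.translate_pull _ _ _
        change _ = taylor ((Ψ.translate (p + t • w)).pull γ) 0
        rw [h1, taylor_translate, zero_add]
        congr 1
        exact Ψ.chart.right_inv ht'
  · intro a ha
    have hG : ∀ i j, ContDiff ℝ ∞ (Function.uncurry fun (t : ℝ) (y : Eucl n) =>
        a (y + -(t • w)) i j) := by
      intro i j
      refine (ha i j).comp ?_
      change ContDiff ℝ ∞ fun q : ℝ × Eucl n => q.2 + -(q.1 • w)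
      fun_prop
    -- The fibre isomorphisms of the two trivializations cancel, and of the two translations only
    -- the shift by `-(t • w)` remains.
    have htr : (fun y => Matrix.of fun i j => deriv (fun t : ℝ =>
        (Ψ.translate (p + (0 : ℝ) • w)).transition (Ψ.translate (p + t • w)) a y i j) 0)
        =ᶠ[𝓝 (0 : Eucl n)] fun y => Matrix.of fun i j => deriv (fun t : ℝ =>
          a (y + -(t • w)) i j) 0 := by
      have hc : Filter.Tendsto (fun y : Eucl n => y + p) (𝓝 0) (𝓝 p) := by
        have : Continuous fun y : Eucl n => y + p := by fun_prop
        simpa using this.tendsto 0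
      filter_upwards [hc (Ψ.chart.open_target.mem_nhds hpt)] with y hy
      have hy' : y + p ∈ Ψ.chart.target := hy
      refine Matrix.ext fun i j => ?_
      simp only [Matrix.of_apply]
      congr 1
      funext t
      change Ψ.fibre _ ((Ψ.fibre _).symm (a ((Ψ.translate _).chart _))) i j = _
      rw [AlgEquiv.apply_symm_apply, Ψ.translate_chart, Ψ.translate_chart_symm, zero_smul,
        add_zero, Ψ.chart.right_inv hy', show y + p + -(p + t • w) = y + -(t • w) by abel]
    change _ = taylor (fun y => Matrix.of fun i j => deriv (fun t : ℝ =>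
        (Ψ.translate (p + (0 : ℝ) • w)).transition (Ψ.translate (p + t • w)) a y i j) 0) 0
    rw [taylor_congr htr]
    refine matPS_ext fun I i j => ?_
    -- After the derivative in `t` is moved outside the partial derivatives, the series at `0` of
    -- the shifted function is the series of `a` at the moving point `-(t • w)`. Parallelism then
    -- turns its derivative into a formal one.
    have h1 := deriv_multiDeriv isOpen_univ (hG i j).contDiffOn I (Set.mem_univ ((0 : ℝ), (0 : Eucl n)))
    rw [coeffEntry_taylor]
    change _ = _ * multiDeriv I (fun y => deriv (fun t : ℝ => a (y + -(t • w)) i j) 0) 0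
    rw [← h1]
    have hpar : IsParallelOn Set.univ (taylor a) :=
      isParallelOn_taylor isOpen_univ fun i j => (ha i j).contDiffOn
    have h2 : ∀ t : ℝ, ((∏ s, (I s).factorial : ℕ) : ℂ)⁻¹ *
        multiDeriv I (fun y => a (y + -(t • w)) i j) 0 =
        coeffEntry I i j (taylor a (t • -w)) := by
      intro t
      have := congrArg (coeffEntry I i j) (taylor_translate a (-(t • w)) 0)
      rw [coeffEntry_taylor, zero_add] at this
      rw [this, smul_neg]
    have h3 : HasDerivAt (fun t : ℝ => coeffEntry I i j (taylor a (t • -w)))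
        (coeffEntry I i j ((negDirDer n N w).1 (taylor a 0))) 0 := by
      have h4 : DifferentiableAt ℝ (fun z => coeffEntry I i j (taylor a z)) ((0 : ℝ) • -w) :=
        ((hpar I i j).1.contDiffAt Filter.univ_mem).differentiableAt (by simp)
      have h5 : HasDerivAt (fun t : ℝ => t • -w) (-w) 0 := by
        simpa using (hasDerivAt_id (0 : ℝ)).smul_const (-w)
      have h6 := h4.hasFDerivAt.comp_hasDerivAt (0 : ℝ) h5
      rw [map_neg, hpar.fderiv_apply (Set.mem_univ _), neg_neg, zero_smul] at h6
      exact h6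
    have h7 : (fun t : ℝ => multiDeriv I (fun y => a (y + -(t • w)) i j) 0) = fun t =>
        ((∏ s, (I s).factorial : ℕ) : ℂ) * coeffEntry I i j (taylor a (t • -w)) := by
      funext t
      rw [← h2, mul_inv_cancel_left₀]
      exact_mod_cast (Finset.prod_pos fun s _ => Nat.factorial_pos _).ne'
    rw [h7, (h3.const_mul _).deriv, inv_mul_cancel_left₀]
    exact_mod_cast (Finset.prod_pos fun s _ => Nat.factorial_pos _).ne'

end OmegaExists

/-! ### The derivative of jets along paths -/

/-- Once `‖L t - id‖ ≤ 1 / 2`, one has `‖z t‖ ≤ 2 ‖L t (z t)‖`. So `z t` stays bounded and `L t (z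
t) - z t` tends to zero. -/
theorem tendsto_of_clm_tendsto_id {α V : Type*} [NormedAddCommGroup V] [NormedSpace ℝ V]
    {l : Filter α} {L : α → V →L[ℝ] V}
    (hL : Filter.Tendsto L l (𝓝 (ContinuousLinearMap.id ℝ V))) {z : α → V} {w : V}
    (h : Filter.Tendsto (fun t => L t (z t)) l (𝓝 w)) : Filter.Tendsto z l (𝓝 w) := by
  have h1 : Filter.Tendsto (fun t => ‖L t - ContinuousLinearMap.id ℝ V‖) l (𝓝 0) := by
    simpa using (hL.sub_const (ContinuousLinearMap.id ℝ V)).norm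
  have h2 : Filter.Tendsto (fun t => ‖L t - ContinuousLinearMap.id ℝ V‖ * (2 * ‖L t (z t)‖)) l
      (𝓝 0) := by
    simpa using h1.mul (h.norm.const_mul 2)
  have h3 : Filter.Tendsto (fun t => L t (z t) - z t) l (𝓝 0) := by
    refine squeeze_zero_norm' ?_ h2
    filter_upwards [h1.eventually (ge_mem_nhds (show (0 : ℝ) < 1 / 2 by norm_num))] with t ht
    have h4 : ‖L t (z t) - z t‖ ≤ ‖L t - ContinuousLinearMap.id ℝ V‖ * ‖z t‖ :=
      (L t - ContinuousLinearMap.id ℝ V).le_opNorm (z t)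
    have h5 : ‖z t‖ ≤ ‖L t (z t)‖ + ‖L t (z t) - z t‖ := by
      have := norm_sub_norm_le (z t) (L t (z t))
      rw [norm_sub_rev] at this
      linarith
    have h6 : ‖z t‖ ≤ 2 * ‖L t (z t)‖ := by
      have := mul_le_mul_of_nonneg_right ht (norm_nonneg (z t))
      linarith
    exact h4.trans (mul_le_mul_of_nonneg_left h6 (norm_nonneg _))
  have := h.sub h3
  simpa using this

/-- At `t = 0` the derivative of `H` in the second variable is the identity. Hence `(t, q) ↦ (t,
H(t, q))` has surjective derivative at `(0, y)` and maps neighbourhoods to neighbourhoods. -/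
theorem tendsto_implicit {n : ℕ} {H : ℝ × Eucl n → Eucl n} {W : Set (ℝ × Eucl n)} (hW : IsOpen W)
    (hH : ContDiffOn ℝ ∞ H W) (h0 : ∀ y, ((0 : ℝ), y) ∈ W → H (0, y) = y) {y : Eucl n}
    (hy : ((0 : ℝ), y) ∈ W) {O : Set (ℝ × Eucl n)} (hO : O ∈ 𝓝 ((0 : ℝ), y)) :
    ∀ᶠ t in 𝓝 (0 : ℝ), ∃ q, (t, q) ∈ O ∧ H (t, q) = y := by
  have h1 : HasStrictFDerivAt H (fderiv ℝ H (0, y)) (0, y) := by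
    exact (hH.contDiffAt (hW.mem_nhds hy)).hasStrictFDerivAt (by simp)
  have h2 := hasStrictFDerivAt_fst.prodMk h1
  have h3 : ∀ v : Eucl n, fderiv ℝ H (0, y) (0, v) = v := by
    intro v
    have h4 := (h1.hasFDerivAt).comp y (hasFDerivAt_prodMk_right (0 : ℝ) y)
    have h5 : (H ∘ fun z => ((0 : ℝ), z)) =ᶠ[𝓝 y] id := by
      have hc : Filter.Tendsto (fun z : Eucl n => ((0 : ℝ), z)) (𝓝 y) (𝓝 (0, y)) :=
        (continuous_const.prodMk continuous_id).tendsto y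
      filter_upwards [hc (hW.mem_nhds hy)] with z hz
      exact h0 z hz
    have h6 := h4.unique ((hasFDerivAt_id y).congr_of_eventuallyEq h5)
    simpa using congrArg (fun L => L v) h6
  have h7 := h2.map_nhds_eq_of_surj (by
    rw [LinearMap.range_eq_top]
    rintro ⟨τ, v⟩
    refine ⟨(τ, v - fderiv ℝ H (0, y) (τ, 0)), ?_⟩
    have : ((τ, v - fderiv ℝ H (0, y) (τ, 0)) : ℝ × Eucl n) =
      (τ, 0) + (0, v - fderiv ℝ H (0, y) (τ, 0)) := by simp
    refine Prod.ext rfl ?_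
    change fderiv ℝ H (0, y) _ = v
    rw [this, map_add, h3, add_sub_cancel])
  simp only [h0 y hy] at h7
  have h8 : (fun p : ℝ × Eucl n => (p.1, H p)) '' O ∈ 𝓝 ((0 : ℝ), y) := by
    rw [← h7]
    exact Filter.image_mem_map hO
  have hc : Filter.Tendsto (fun t : ℝ => (t, y)) (𝓝 0) (𝓝 (0, y)) :=
    (continuous_id.prodMk continuous_const).tendsto 0
  filter_upwards [hc h8] with t ht
  obtain ⟨⟨t', q⟩, hq, he⟩ := ht
  obtain ⟨rfl, h9⟩ := Prod.ext_iff.1 he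
  exact ⟨q, hq, h9⟩

/-- Difference quotients in `t` along points converging to `y`. -/
theorem tendsto_slope_of_contDiffAt {n : ℕ} {g : ℝ × Eucl n → ℂ} {y : Eucl n}
    (hg : ContDiffAt ℝ ∞ g (0, y)) {q : ℝ → Eucl n}
    (hq : Filter.Tendsto (fun t => (t, q t)) (𝓝 0) (𝓝 ((0 : ℝ), y))) :
    Filter.Tendsto (fun t : ℝ => t⁻¹ • (g (t, q t) - g (0, q t))) (𝓝[≠] 0)
      (𝓝 (deriv (fun t => g (t, y)) 0)) := by
  -- Strict differentiability allows both points of the difference quotient to move.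
  have h1 := hg.hasStrictFDerivAt (by simp)
  have hd : deriv (fun t => g (t, y)) 0 = fderiv ℝ g (0, y) (1, 0) := by
    have h2 := (h1.hasFDerivAt.comp (0 : ℝ) (hasFDerivAt_prodMk_left (0 : ℝ) y)).hasDerivAt
    exact h2.deriv.trans (by simp)
  have hq0 : Filter.Tendsto (fun t => ((0 : ℝ), q t)) (𝓝 0) (𝓝 ((0 : ℝ), y)) :=
    tendsto_const_nhds.prodMk_nhds ((continuous_snd.tendsto _).comp hq)
  have h3 := (h1.isLittleO.comp_tendsto (hq.prodMk_nhds hq0)).mono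
    (nhdsWithin_le_nhds (s := {(0 : ℝ)}ᶜ))
  have h4 : (fun t : ℝ => g (t, q t) - g (0, q t) - t • fderiv ℝ g (0, y) (1, 0)) =o[𝓝[≠] 0]
      fun t : ℝ => t := by
    refine (h3.congr (fun t => ?_) fun t => rfl).trans_isBigO ?_
    · have : ((t, q t) - (0, q t) : ℝ × Eucl n) = t • (1, 0) := by simp
      simp only [Function.comp_apply]
      rw [this, map_smul]
    · refine Asymptotics.IsBigO.of_bound 1 (Filter.Eventually.of_forall fun t => ?_)
      simp [Prod.norm_def]
  have h5 := h4.tendsto_inv_smul_nhds_zero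
  rw [hd]
  have h6 := h5.add_const (fderiv ℝ g (0, y) (1, 0))
  rw [zero_add] at h6
  refine h6.congr' ?_
  filter_upwards [self_mem_nhdsWithin] with t ht
  rw [smul_sub, inv_smul_smul₀ ht, sub_add_cancel]

/-- The differential of a complex valued function. -/
def dAt {n : ℕ} {M : Type*} [TopologicalSpace M] [ChartedSpace (Eucl n) M] (F : M → ℂ) (x : M) :
    Eucl n →L[ℝ] ℂ := mfderiv (𝓡 n) 𝓘(ℝ, ℂ) F x

theorem deriv_comp_path {n : ℕ} {M : Type*} [TopologicalSpace M] [ChartedSpace (Eucl n) M]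
    {F : M → ℂ} {c : ℝ → M} {v : TangentSpace (𝓡 n) (c 0)}
    (hF : MDifferentiableAt (𝓡 n) 𝓘(ℝ, ℂ) F (c 0))
    (hc : HasMFDerivAt 𝓘(ℝ, ℝ) (𝓡 n) c 0 ((1 : ℝ →L[ℝ] ℝ).smulRight v)) :
    deriv (F ∘ c) 0 = dAt F (c 0) v := by
  have h := hF.hasMFDerivAt.comp (0 : ℝ) hc
  have h' : HasFDerivAt (F ∘ c) ((dAt F (c 0)).comp
    ((1 : ℝ →L[ℝ] ℝ).smulRight (show Eucl n from v))) (0 : ℝ) := h.hasFDerivAt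
  refine h'.hasDerivAt.deriv.trans ?_
  change dAt F (c 0) ((1 : ℝ) • v) = _
  rw [one_smul]

theorem multiDeriv_neg {n : ℕ} (I : Fin n →₀ ℕ) (f : Eucl n → ℂ) (y : Eucl n) :
    multiDeriv I (fun z => -f z) y = -multiDeriv I f y := by
  have h := multiDeriv_rel (α := Unit) (β := Unit) (fun f g : Unit → Eucl n → ℂ =>
    f () = fun z => -g () z) (fun s f g h => by
      funext z
      change fderiv ℝ (f ()) z _ = -fderiv ℝ (g ()) z _
      rw [h, fderiv_fun_neg]
      rfl) I (f := fun _ z => -f z) (g := fun _ => f) rfl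
  exact congrFun h y

/-! ### Lifts of paths and the value of the connection form on jets -/

section Lift

variable {n N : ℕ} {M : Type*} [TopologicalSpace M] [ChartedSpace (Eucl n) M]
  {E : M → Type*} [∀ x, AddCommGroup (E x)] [∀ x, Module ℂ (E x)]
  [∀ x, TopologicalSpace (E x)] [TopologicalSpace (TotalSpace (Fib N) E)]
  [FiberBundle (Fib N) E] [VectorBundle ℂ (Fib N) E]
  [∀ x, IsTopologicalAddGroup (E x)] [∀ x, ContinuousSMul ℂ (E x)]
  [IsManifold (𝓡 n) ∞ M] {Ψ : ℝ → LocalTriv n N E} {W : Set (ℝ × Eucl n)}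

/-- The point of the model that a path of local trivializations maps to a given point of `M`. -/
theorem tendsto_chart_of_path (hW : IsOpen W) (h1 : ∀ p ∈ W, p.2 ∈ (Ψ p.1).chart.target)
    (h2 : ContMDiffOn 𝓘(ℝ, ℝ × Eucl n) (𝓡 n) ∞ (fun p => (Ψ p.1).chart.symm p.2) W)
    {y : Eucl n} (hy : ((0 : ℝ), y) ∈ W) :
    (∀ᶠ t in 𝓝 (0 : ℝ), (Ψ 0).chart.symm y ∈ (Ψ t).chart.source) ∧
      Filter.Tendsto (fun t => (t, (Ψ t).chart ((Ψ 0).chart.symm y))) (𝓝 0)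
        (𝓝 ((0 : ℝ), y)) := by
  set W' := W ∩ (fun p : ℝ × Eucl n => (Ψ p.1).chart.symm p.2) ⁻¹' (Ψ 0).chart.source with hW'
  have hW'o : IsOpen W' := h2.continuousOn.isOpen_inter_preimage hW (Ψ 0).chart.open_source
  -- A lift is jointly smooth only through the inverse charts. Written in the chart of `Ψ 0` they
  -- give a family starting at the identity, and solving `H(t, q) = y` shows that the fixed point of
  -- `M` lies in the domain of `Ψ t` for small `t`, with chart image close to `y`.
  let H : ℝ × Eucl n → Eucl n := fun p => (Ψ 0).chart ((Ψ p.1).chart.symm p.2)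
  have hH : ContDiffOn ℝ ∞ H W' :=
    contMDiffOn_iff_contDiffOn.1 ((contMDiffOn_of_mem_maximalAtlas (Ψ 0).chart_mem).comp
      (h2.mono Set.inter_subset_left) fun p hp => hp.2)
  have h0 : ∀ y, ((0 : ℝ), y) ∈ W' → H (0, y) = y := fun y hy =>
    (Ψ 0).chart.right_inv (h1 _ hy.1)
  have hyW' : ((0 : ℝ), y) ∈ W' := ⟨hy, (Ψ 0).chart.map_target (h1 _ hy)⟩
  have key : ∀ O ∈ 𝓝 ((0 : ℝ), y), ∀ᶠ t in 𝓝 (0 : ℝ),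
      (Ψ 0).chart.symm y ∈ (Ψ t).chart.source ∧
        (t, (Ψ t).chart ((Ψ 0).chart.symm y)) ∈ O := by
    intro O hO
    filter_upwards [tendsto_implicit hW'o hH h0 hyW'
      (Filter.inter_mem hO (hW'o.mem_nhds hyW'))] with t ht
    obtain ⟨q, ⟨hqO, hqW'⟩, hq⟩ := ht
    have h3 : (Ψ 0).chart.symm y = (Ψ t).chart.symm q := by
      rw [← hq]
      exact (Ψ 0).chart.left_inv hqW'.2
    have h4 : q ∈ (Ψ t).chart.target := h1 _ hqW'.1
    rw [h3]
    refine ⟨(Ψ t).chart.map_target h4, ?_⟩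
    rw [(Ψ t).chart.right_inv h4]
    exact hqO
  exact ⟨(key _ Filter.univ_mem).mono fun t ht => ht.1, fun O hO => (key O hO).mono fun t ht => ht.2⟩

/-- Let `p` be the point with coordinate `y` in `Ψ 0`, `q t` its coordinate in `Ψ t`, `R t` the
change of fibre coordinates at `p` from `Ψ 0` to `Ψ t`, and `f t` the transition of `a` at `y`. For
small `t`, `R t (f t) = (Ψ 0).pull γ (q t)`, whereas `R t (f 0) = (Ψ t).pull γ (q t)`. So `R t` maps
the difference quotient of `f` to minus the one of `t ↦ (Ψ t).pull γ` at the point `q t`. Since `R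
t` tends to the identity, the limits agree. -/
theorem deriv_transition (hW : IsOpen W) (h1 : ∀ p ∈ W, p.2 ∈ (Ψ p.1).chart.target)
    (h2 : ContMDiffOn 𝓘(ℝ, ℝ × Eucl n) (𝓡 n) ∞ (fun p => (Ψ p.1).chart.symm p.2) W)
    (h3 : ∀ (γ : Sec n N E) (i j : Fin N),
      ContDiffOn ℝ ∞ (fun p : ℝ × Eucl n => (Ψ p.1).pull γ p.2 i j) W)
    {y : Eucl n} (hy : ((0 : ℝ), y) ∈ W)
    (hsec : ∀ Z : Mat N, ∃ η : Sec n N E, (Ψ 0).pull η y = Z)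
    (γ : Sec n N E) {a : Eucl n → Mat N} (ha : a =ᶠ[𝓝 y] (Ψ 0).pull γ) (i j : Fin N) :
    deriv (fun t => (Ψ 0).transition (Ψ t) a y i j) 0 =
      -deriv (fun t => (Ψ t).pull γ y i j) 0 := by
  obtain ⟨hsrc, hq⟩ := tendsto_chart_of_path hW h1 h2 hy
  set p := (Ψ 0).chart.symm y with hp
  let q : ℝ → Eucl n := fun t => (Ψ t).chart p
  have hq' : Filter.Tendsto q (𝓝 0) (𝓝 y) := (continuous_snd.tendsto _).comp hq
  have hq0 : q 0 = y := (Ψ 0).chart.right_inv (h1 _ hy)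
  have hpull : ∀ η : Sec n N E, ∀ᶠ t in 𝓝 (0 : ℝ),
      (Ψ t).fibre p (η.1 p) = (Ψ t).pull η (q t) := fun η =>
    hsrc.mono fun t ht => ((Ψ t).pull_apply_chart η ht).symm
  let R : ℝ → Mat N ≃ₐ[ℂ] Mat N := fun t => ((Ψ 0).fibre p).symm.trans ((Ψ t).fibre p)
  have hRη : ∀ (η : Sec n N E) t, R t ((Ψ 0).pull η y) = (Ψ t).fibre p (η.1 p) := fun η t =>
    congrArg ((Ψ t).fibre p) (((Ψ 0).fibre p).symm_apply_apply (η.1 p))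
  have hR0 : ∀ Z, R 0 Z = Z := fun Z => ((Ψ 0).fibre p).apply_symm_apply Z
  -- The fibre isomorphisms of a lift are controlled only through sections. By `hsec` every matrix
  -- is the value of a section at `p`, which suffices for `R t → id`.
  have hR : ∀ Z i j, Filter.Tendsto (fun t => R t Z i j) (𝓝 0) (𝓝 (Z i j)) := by
    intro Z i j
    obtain ⟨η, rfl⟩ := hsec Z
    have h4 : ContinuousAt (fun p : ℝ × Eucl n => (Ψ p.1).pull η p.2 i j) (0, y) :=
      (h3 η i j).continuousOn.continuousAt (hW.mem_nhds hy)
    refine (h4.tendsto.comp hq).congr' ?_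
    filter_upwards [hpull η] with t ht
    rw [hRη, ht]
    rfl
  let L : ℝ → (Fin N → Fin N → ℂ) →L[ℝ] (Fin N → Fin N → ℂ) := fun t =>
    LinearMap.toContinuousLinearMap
      { toFun := fun v => R t v
        map_add' := fun u v => map_add (R t) (Matrix.of u) (Matrix.of v)
        map_smul' := fun c v => ((R t).toLinearMap.restrictScalars ℝ).map_smul c (Matrix.of v) }
  have hL0 : L 0 = ContinuousLinearMap.id ℝ _ := by
    ext v : 1
    exact hR0 v
  have hL : Filter.Tendsto L (𝓝 0) (𝓝 (ContinuousLinearMap.id ℝ _)) := by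
    rw [← hL0]
    refine continuousAt_clm_apply.2 fun v => ?_
    refine continuousAt_pi.2 fun i => continuousAt_pi.2 fun j => ?_
    have h4 : L 0 v i j = v i j := congrFun (congrFun (hR0 v) i) j
    change Filter.Tendsto _ _ (𝓝 (L 0 v i j))
    rw [h4]
    exact hR v i j
  let f : ℝ → Mat N := fun t => (Ψ 0).transition (Ψ t) a y
  have hf : ∀ t, R t (f t) = a (q t) := by
    intro t
    change (Ψ t).fibre p (((Ψ 0).fibre p).symm ((Ψ 0).fibre p (((Ψ t).fibre p).symm (a (q t)))))
      = _
    rw [AlgEquiv.symm_apply_apply, AlgEquiv.apply_symm_apply]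
  have hf0 : f 0 = (Ψ 0).pull γ y := by
    rw [← hR0 (f 0), hf, hq0]
    exact ha.eq_of_nhds
  have hlim : Filter.Tendsto (fun t : ℝ => (L t : (Fin N → Fin N → ℂ) → Fin N → Fin N → ℂ)
      (t⁻¹ • (f t - f 0))) (𝓝[≠] 0)
      (𝓝 fun i j => -deriv (fun t => (Ψ t).pull γ y i j) 0) := by
    refine tendsto_pi_nhds.2 fun i => tendsto_pi_nhds.2 fun j => ?_
    have h5 := (tendsto_slope_of_contDiffAt ((h3 γ i j).contDiffAt (hW.mem_nhds hy)) hq).neg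
    refine h5.congr' ?_
    filter_upwards [nhdsWithin_le_nhds (hpull γ), nhdsWithin_le_nhds (hq'.eventually ha)]
      with t ht hta
    have h6 : R t (t⁻¹ • (f t - f 0)) = t⁻¹ • ((Ψ 0).pull γ (q t) - (Ψ t).pull γ (q t)) := by
      have := ((R t).toLinearMap.restrictScalars ℝ).map_smul t⁻¹ (f t - f 0)
      refine this.trans ?_
      congr 1
      refine (map_sub (R t) _ _).trans ?_
      rw [hf, hf0, hRη, ht, hta]
    refine Eq.trans ?_ (congrFun (congrFun h6 i) j).symm
    change -(t⁻¹ • ((Ψ t).pull γ (q t) i j - (Ψ 0).pull γ (q t) i j)) =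
      t⁻¹ • ((Ψ 0).pull γ (q t) i j - (Ψ t).pull γ (q t) i j)
    rw [← smul_neg, neg_sub]
  have hz := tendsto_of_clm_tendsto_id (hL.mono_left nhdsWithin_le_nhds) hlim
  have hz' := tendsto_pi_nhds.1 (tendsto_pi_nhds.1 hz i) j
  refine HasDerivAt.deriv ?_
  rw [hasDerivAt_iff_tendsto_slope_zero]
  refine hz'.congr fun t => ?_
  rw [zero_add]
  rfl

variable [T2Space M]

theorem exists_sec_pull_eq (hE : IsSmoothBundle n N E) (Ψ : LocalTriv n N E) (y : Eucl n)
    (Z : Mat N) : ∃ η : Sec n N E, Ψ.pull η y = Z := by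
  set p := Ψ.chart.symm y with hp
  obtain ⟨η, hη, -⟩ := exists_sec_pull p (self_mem_stdTriv_source (hE := hE) p)
    (a := fun _ => stdFibre p p ((Ψ.fibre p).symm Z)) fun i j => contDiff_const
  refine ⟨η, ?_⟩
  have h1 := hη.eq_of_nhds
  rw [LocalTriv.pull_apply_chart _ _ (self_mem_stdTriv_source p)] at h1
  have h2 : η.1 p = (Ψ.fibre p).symm Z := (stdFibre p p).injective h1
  change Ψ.fibre p (η.1 p) = Z
  rw [h2, AlgEquiv.apply_symm_apply]

/-- The value of `σ^*ω` on jets of sections is minus the derivative of their coefficients in the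
frame field `σ`. -/
theorem IsPullbackOmega.apply_jet (hE : IsSmoothBundle n N E) {σ : ∀ x : M, Frame n N E x}
    {U : Set M} (hU : IsOpen U) (hσ : SmoothFrameOn n N E σ U) {x : M} (hx : x ∈ U)
    {v : TangentSpace (𝓡 n) x} {D : Der n N} (hD : IsPullbackOmega σ x v D) (γ : Sec n N E)
    (I : Fin n →₀ ℕ) (i j : Fin N) :
    coeffEntry I i j (D.1 ((σ x).toEquiv.symm (jet n N E x γ))) =
      -dAt (fun z => coeffEntry I i j ((σ z).toEquiv.symm (jet n N E z γ))) x v := by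
  obtain ⟨c, hc0, hc, Ψ, ⟨W, hW, h0W, h1, h2, h3, h4⟩, hω⟩ := hD
  subst hc0
  have hline : ∀ᶠ t in 𝓝 (0 : ℝ), (t, (0 : Eucl n)) ∈ W := by
    have hcont : Filter.Tendsto (fun t : ℝ => (t, (0 : Eucl n))) (𝓝 0) (𝓝 (0, 0)) :=
      (continuous_id.prodMk continuous_const).tendsto 0
    exact hcont (hW.mem_nhds h0W)
  have hsecW : ∀ᶠ y in 𝓝 (0 : Eucl n), ((0 : ℝ), y) ∈ W := by
    have hcont : Filter.Tendsto (fun y : Eucl n => ((0 : ℝ), y)) (𝓝 0) (𝓝 (0, 0)) :=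
      (continuous_const.prodMk continuous_id).tendsto 0
    exact hcont (hW.mem_nhds h0W)
  -- the derivative along the path
  have hder : deriv (fun t => coeffEntry I i j (taylor ((Ψ t).pull γ) 0)) 0 =
      dAt (fun z => coeffEntry I i j ((σ z).toEquiv.symm (jet n N E z γ))) (c 0) v := by
    have h5 : MDifferentiableAt (𝓡 n) 𝓘(ℝ, ℂ)
        (fun z => coeffEntry I i j ((σ z).toEquiv.symm (jet n N E z γ))) (c 0) :=
      ((hσ γ I i j).contMDiffAt (hU.mem_nhds hx)).mdifferentiableAt (by simp)
    have h7 : (fun t => coeffEntry I i j (taylor ((Ψ t).pull γ) 0)) =ᶠ[𝓝 0]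
        (fun z => coeffEntry I i j ((σ z).toEquiv.symm (jet n N E z γ))) ∘ c := by
      filter_upwards [hline] with t ht
      exact congrArg (coeffEntry I i j) ((h4 t ht).2 γ).symm
    exact h7.deriv_eq.trans (deriv_comp_path h5 hc)
  -- a globally defined function with the same germ
  let B : Set (Eucl n) := {y | ((0 : ℝ), y) ∈ W}
  have hB : IsOpen B := hW.preimage (continuous_const.prodMk continuous_id)
  have hB3 : ∀ i j, ContDiffOn ℝ ∞ (fun y => (Ψ 0).pull γ y i j) B := fun i j =>
    (h3 γ i j).comp ((contDiff_const.prodMk contDiff_id).contDiffOn (f := fun y => ((0 : ℝ), y)))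
      fun y hy => hy
  choose b hb hbe using fun i j => exists_contDiff_eventuallyEq hB (hB3 i j) h0W
  let a : Eucl n → Mat N := fun y => Matrix.of fun i j => b i j y
  have hae : a =ᶠ[𝓝 0] (Ψ 0).pull γ := by
    have : ∀ᶠ y in 𝓝 (0 : Eucl n), ∀ i j, b i j y = (Ψ 0).pull γ y i j :=
      Filter.eventually_all.2 fun i => Filter.eventually_all.2 fun j => hbe i j
    filter_upwards [this] with y hy
    exact Matrix.ext hy
  have h8 := hω a hb
  rw [taylor_congr hae] at h8
  -- A Taylor series depends on a germ, so the derivative of the transition is needed at every `y`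
  -- near `0`.
  have h9 : (fun y => Matrix.of fun i j =>
      deriv (fun t => (Ψ 0).transition (Ψ t) a y i j) 0) =ᶠ[𝓝 0] fun y => Matrix.of fun i j =>
        -deriv (fun t => (Ψ t).pull γ y i j) 0 := by
    filter_upwards [hae.eventuallyEq_nhds, hsecW] with y hy hyW
    refine Matrix.ext fun i j => ?_
    exact deriv_transition hW h1 h2 h3 hyW (exists_sec_pull_eq hE _ y) γ hy i j
  rw [taylor_congr h9] at h8
  have h10 : (σ (c 0)).toEquiv.symm (jet n N E (c 0) γ) = taylor ((Ψ 0).pull γ) 0 :=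
    (h4 0 h0W).2 γ
  rw [h10, h8, ← hder, coeffEntry_taylor]
  have h11 := deriv_multiDeriv (G := fun t y => (Ψ t).pull γ y i j) hW (h3 γ i j) I h0W
  have h12 : (fun t => coeffEntry I i j (taylor ((Ψ t).pull γ) 0)) = fun t =>
      ((∏ s, (I s).factorial : ℕ) : ℂ)⁻¹ * multiDeriv I (fun y => (Ψ t).pull γ y i j) 0 :=
    funext fun t => coeffEntry_taylor _ _ _ _ _
  rw [h12, deriv_const_mul_field, h11, ← mul_neg]
  congr 1
  exact multiDeriv_neg _ _ _

end Lift

/-! ### Smoothness of forms on `ℝⁿ` -/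

section FormsEucl

variable {n k : ℕ}

theorem form_apply_eq_sum (f : (Eucl n) [⋀^Fin k]→L[ℝ] ℂ) (v : Fin k → Eucl n) :
    f v = ∑ r : Fin k → Fin n, ((∏ a, (v a) (r a) : ℝ) : ℂ) *
      f (fun a => EuclideanSpace.single (r a) (1 : ℝ)) := by
  have hv : v = fun a => ∑ s : Fin n, (v a) s • EuclideanSpace.single s (1 : ℝ) := by
    funext a
    ext t
    simp [Finset.sum_apply, Pi.single_apply]
  calc f v = f.toMultilinearMap
        (fun a => ∑ s : Fin n, (v a) s • EuclideanSpace.single s (1 : ℝ)) := by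
          rw [← hv]; rfl
    _ = _ := by
      rw [MultilinearMap.map_sum]
      refine Finset.sum_congr rfl fun r _ => ?_
      rw [MultilinearMap.map_smul_univ, Complex.real_smul]
      rfl

/-- The values on tuples of basis vectors embed the forms linearly into a finite-dimensional space,
and a linear left inverse recovers the form from these smooth components. -/
theorem contDiffOn_form {X : Type*} [NormedAddCommGroup X] [NormedSpace ℝ X]
    {η : X → (Eucl n) [⋀^Fin k]→L[ℝ] ℂ} {s : Set X}
    (h : ∀ v : Fin k → Eucl n, ContDiffOn ℝ ∞ (fun y => η y v) s) : ContDiffOn ℝ ∞ η s := by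
  let ev : ((Eucl n) [⋀^Fin k]→L[ℝ] ℂ) →ₗ[ℝ] ((Fin k → Fin n) → ℂ) :=
    { toFun := fun f r => f fun a => EuclideanSpace.single (r a) (1 : ℝ)
      map_add' := fun f g => rfl
      map_smul' := fun c f => rfl }
  have hev : Function.Injective ev := by
    intro f g hfg
    ext v
    rw [form_apply_eq_sum, form_apply_eq_sum g]
    refine Finset.sum_congr rfl fun r _ => ?_
    exact congrArg (_ * ·) (congrFun hfg r)
  obtain ⟨L, hL⟩ := ev.exists_leftInverse_of_injective (LinearMap.ker_eq_bot.2 hev)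
  have h1 : ContDiffOn ℝ ∞ (fun y => ev (η y)) s := contDiffOn_pi.2 fun r => h _
  have h2 : η = fun y => LinearMap.toContinuousLinearMap L (ev (η y)) := by
    funext y
    exact (congrArg (fun T => T (η y)) hL).symm
  rw [h2]
  exact (LinearMap.toContinuousLinearMap L).contDiff.comp_contDiffOn h1

theorem ContDiffOn.form_apply {X : Type*} [NormedAddCommGroup X] [NormedSpace ℝ X]
    {η : X → (Eucl n) [⋀^Fin k]→L[ℝ] ℂ} {s : Set X} (hη : ContDiffOn ℝ ∞ η s)
    {v : Fin k → X → Eucl n} (hv : ∀ a, ContDiffOn ℝ ∞ (v a) s) :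
    ContDiffOn ℝ ∞ (fun y => η y fun a => v a y) s := by
  have h1 : ∀ w : Fin k → Eucl n, ContDiffOn ℝ ∞ (fun y => η y w) s := fun w =>
    (ContinuousAlternatingMap.apply ℝ (Eucl n) ℂ w).contDiff.comp_contDiffOn hη
  simp_rw [fun y => form_apply_eq_sum (η y) fun a => v a y]
  refine ContDiffOn.sum fun r _ => ContDiffOn.mul ?_ (h1 _)
  have h2 : ContDiffOn ℝ ∞ (fun y => ∏ a, (v a y) (r a)) s := contDiffOn_prod fun a _ =>
    (EuclideanSpace.proj (r a) : Eucl n →L[ℝ] ℝ).contDiff.comp_contDiffOn (hv a)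
  exact Complex.ofRealCLM.contDiff.comp_contDiffOn h2

set_option synthInstance.maxHeartbeats 200000 in
theorem ContDiffOn.extDeriv {η : Eucl n → (Eucl n) [⋀^Fin k]→L[ℝ] ℂ} {s : Set (Eucl n)}
    (hs : IsOpen s) (hη : ContDiffOn ℝ ∞ η s) : ContDiffOn ℝ ∞ (extDeriv η) s := by
  have h1 : ContDiffOn ℝ ∞ (fderiv ℝ η) s := hη.fderiv_of_isOpen hs (by simp)
  exact (ContinuousAlternatingMap.alternatizeUncurryFinCLM (n := k) ℝ
    (Eucl n) ℂ).contDiff.comp_contDiffOn h1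

end FormsEucl

/-! ### Charts -/

section Charts

variable {n k : ℕ} {M : Type*} [TopologicalSpace M] [ChartedSpace (Eucl n) M]

/-- The differential of the chart at `x₀`. -/
def toChart (x₀ x : M) : Eucl n →L[ℝ] Eucl n :=
  mfderiv (𝓡 n) 𝓘(ℝ, Eucl n) (extChartAt (𝓡 n) x₀) x

/-- The differential of the inverse of the chart at `x₀`. -/
def fromChart (x₀ : M) (y : Eucl n) : Eucl n →L[ℝ] Eucl n :=
  mfderiv 𝓘(ℝ, Eucl n) (𝓡 n) (extChartAt (𝓡 n) x₀).symm y

theorem RoughForm.congr_apply (β : RoughForm n (fun _ : M => ℂ) k) {x x' : M} (h : x = x')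
    {v v' : Fin k → Eucl n} (hv : v = v') :
    β x (show Fin k → TangentSpace (𝓡 n) x from v) =
      β x' (show Fin k → TangentSpace (𝓡 n) x' from v') := by
  subst h hv
  rfl

theorem chartForm_apply (β : RoughForm n (fun _ : M => ℂ) k) (x₀ : M) (y : Eucl n)
    (v : Fin k → Eucl n) : chartForm β x₀ y v =
      β ((extChartAt (𝓡 n) x₀).symm y) (fun a => fromChart x₀ y (v a)) := rfl

theorem extD_apply (β : RoughForm n (fun _ : M => ℂ) k) (x : M)
    (v : Fin (k + 1) → TangentSpace (𝓡 n) x) : extD β x v =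
      extDeriv (chartForm β x) (extChartAt (𝓡 n) x x) (fun a => toChart x x (v a)) := rfl

variable [IsManifold (𝓡 n) ∞ M]

theorem mdifferentiableAt_extChartAt_symm' {x₀ : M} {y : Eucl n}
    (hy : y ∈ (extChartAt (𝓡 n) x₀).target) :
    MDifferentiableAt 𝓘(ℝ, Eucl n) (𝓡 n) (extChartAt (𝓡 n) x₀).symm y :=
  ((contMDiffOn_extChartAt_symm (n := ∞) x₀).contMDiffAt
    ((isOpen_extChartAt_target x₀).mem_nhds hy)).mdifferentiableAt (by simp)

theorem mdifferentiableAt_extChartAt' {x₀ x : M} (hx : x ∈ (extChartAt (𝓡 n) x₀).source) :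
    MDifferentiableAt (𝓡 n) 𝓘(ℝ, Eucl n) (extChartAt (𝓡 n) x₀) x :=
  (contMDiffAt_extChartAt' (n := ∞) (by rwa [extChartAt_source] at hx)).mdifferentiableAt (by simp)

theorem fromChart_toChart {x₀ x : M} (hx : x ∈ (extChartAt (𝓡 n) x₀).source) (v : Eucl n) :
    fromChart x₀ (extChartAt (𝓡 n) x₀ x) (toChart x₀ x v) = v := by
  have h1 := (mdifferentiableAt_extChartAt_symm'
    ((extChartAt (𝓡 n) x₀).map_source hx)).hasMFDerivAt.comp x
      (mdifferentiableAt_extChartAt' hx).hasMFDerivAt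
  have h2 : (extChartAt (𝓡 n) x₀).symm ∘ extChartAt (𝓡 n) x₀ =ᶠ[𝓝 x] id := by
    filter_upwards [(isOpen_extChartAt_source x₀).mem_nhds hx] with z hz
    exact (extChartAt (𝓡 n) x₀).left_inv hz
  have h3 := h1.mfderiv.symm.trans (h2.mfderiv_eq.trans mfderiv_id)
  exact congrArg (fun L : Eucl n →L[ℝ] Eucl n => L v) h3

theorem toChart_fromChart {x₀ : M} {y : Eucl n} (hy : y ∈ (extChartAt (𝓡 n) x₀).target)
    (v : Eucl n) :
    toChart x₀ ((extChartAt (𝓡 n) x₀).symm y) (fromChart x₀ y v) = v := by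
  have h1 := (mdifferentiableAt_extChartAt'
    ((extChartAt (𝓡 n) x₀).map_target hy)).hasMFDerivAt.comp y
      (mdifferentiableAt_extChartAt_symm' hy).hasMFDerivAt
  have h2 : extChartAt (𝓡 n) x₀ ∘ (extChartAt (𝓡 n) x₀).symm =ᶠ[𝓝 y] id := by
    filter_upwards [(isOpen_extChartAt_target x₀).mem_nhds hy] with z hz
    exact (extChartAt (𝓡 n) x₀).right_inv hz
  have h3 := h1.mfderiv.symm.trans (h2.mfderiv_eq.trans mfderiv_id)
  exact congrArg (fun L : Eucl n →L[ℝ] Eucl n => L v) h3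

/-- The coordinate change between two charts. -/
def chartChange (x₀ x₁ : M) : Eucl n → Eucl n := fun y =>
  extChartAt (𝓡 n) x₁ ((extChartAt (𝓡 n) x₀).symm y)

theorem contDiffOn_chartChange (x₀ x₁ : M) : ContDiffOn ℝ ∞ (chartChange x₀ x₁)
    ((extChartAt (𝓡 n) x₀).target ∩
      (extChartAt (𝓡 n) x₀).symm ⁻¹' (extChartAt (𝓡 n) x₁).source) := by
  refine contMDiffOn_iff_contDiffOn.1 ?_
  refine (contMDiffOn_extChartAt (I := 𝓡 n) (n := ∞) (x := x₁)).comp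
    ((contMDiffOn_extChartAt_symm (n := ∞) x₀).mono Set.inter_subset_left) fun y hy => ?_
  have := hy.2
  rwa [Set.mem_preimage, extChartAt_source] at this

theorem isOpen_chartDomain (x₀ : M) {U : Set M} (hU : IsOpen U) :
    IsOpen ((extChartAt (𝓡 n) x₀).target ∩ (extChartAt (𝓡 n) x₀).symm ⁻¹' U) :=
  (continuousOn_extChartAt_symm x₀).isOpen_inter_preimage (isOpen_extChartAt_target x₀) hU

theorem fromChart_eq {x₀ x₁ : M} {y : Eucl n} (hy : y ∈ (extChartAt (𝓡 n) x₀).target)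
    (hy' : (extChartAt (𝓡 n) x₀).symm y ∈ (extChartAt (𝓡 n) x₁).source) (v : Eucl n) :
    fromChart x₁ (chartChange x₀ x₁ y) (fderiv ℝ (chartChange x₀ x₁) y v) = fromChart x₀ y v := by
  have hd : DifferentiableAt ℝ (chartChange x₀ x₁) y :=
    ((contDiffOn_chartChange x₀ x₁).contDiffAt
      ((isOpen_chartDomain x₀ (isOpen_extChartAt_source x₁)).mem_nhds ⟨hy, hy'⟩)).differentiableAt
      (by simp)
  have h1 := (mdifferentiableAt_extChartAt_symm'
    ((extChartAt (𝓡 n) x₁).map_source hy')).hasMFDerivAt.comp y hd.hasFDerivAt.hasMFDerivAt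
  have h2 : (extChartAt (𝓡 n) x₁).symm ∘ chartChange x₀ x₁ =ᶠ[𝓝 y]
      (extChartAt (𝓡 n) x₀).symm := by
    filter_upwards [(isOpen_chartDomain x₀ (isOpen_extChartAt_source x₁)).mem_nhds ⟨hy, hy'⟩]
      with z hz
    exact (extChartAt (𝓡 n) x₁).left_inv hz.2
  have h3 := h1.mfderiv.symm.trans h2.mfderiv_eq
  exact congrArg (fun L : Eucl n →L[ℝ] Eucl n => L v) h3

theorem fderiv_chartChange_toChart {x₀ x₁ x : M} (hx : x ∈ (extChartAt (𝓡 n) x₀).source)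
    (hx' : x ∈ (extChartAt (𝓡 n) x₁).source) (v : Eucl n) :
    fderiv ℝ (chartChange x₀ x₁) (extChartAt (𝓡 n) x₀ x) (toChart x₀ x v) = toChart x₁ x v := by
  have h0 := (extChartAt (𝓡 n) x₀).left_inv hx
  have h1 := fromChart_eq ((extChartAt (𝓡 n) x₀).map_source hx)
    (x₁ := x₁) (by rwa [h0]) (toChart x₀ x v)
  rw [fromChart_toChart hx] at h1
  have h2 : chartChange x₀ x₁ (extChartAt (𝓡 n) x₀ x) = extChartAt (𝓡 n) x₁ x := by
    unfold chartChange
    rw [h0]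
  rw [h2] at h1
  have h3 := toChart_fromChart ((extChartAt (𝓡 n) x₁).map_source hx')
    (fderiv ℝ (chartChange x₀ x₁) (extChartAt (𝓡 n) x₀ x) (toChart x₀ x v))
  rw [h1, (extChartAt (𝓡 n) x₁).left_inv hx'] at h3
  exact h3.symm

/-- Change of charts for forms. -/
theorem chartForm_change (β : RoughForm n (fun _ : M => ℂ) k) {x₀ x₁ : M} {y : Eucl n}
    (hy : y ∈ (extChartAt (𝓡 n) x₀).target)
    (hy' : (extChartAt (𝓡 n) x₀).symm y ∈ (extChartAt (𝓡 n) x₁).source) :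
    chartForm β x₀ y = (chartForm β x₁ (chartChange x₀ x₁ y)).compContinuousLinearMap
      (fderiv ℝ (chartChange x₀ x₁) y) := by
  ext v
  rw [ContinuousAlternatingMap.compContinuousLinearMap_apply, chartForm_apply, chartForm_apply]
  refine β.congr_apply ((extChartAt (𝓡 n) x₁).left_inv hy').symm ?_
  funext a
  exact (fromChart_eq hy hy' (v a)).symm

/-- In any other chart the form is the pullback under the smooth coordinate change. -/
theorem smoothFormOn_of_chart {β : RoughForm n (fun _ : M => ℂ) k} {U : Set M} (hU : IsOpen U)
    {x₁ : M} (hUx : U ⊆ (extChartAt (𝓡 n) x₁).source)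
    (h : ContDiffOn ℝ ∞ (chartForm β x₁)
      ((extChartAt (𝓡 n) x₁).target ∩ (extChartAt (𝓡 n) x₁).symm ⁻¹' U)) :
    SmoothFormOn β U := by
  intro x₀
  have hmaps : ∀ y ∈ (extChartAt (𝓡 n) x₀).target ∩ (extChartAt (𝓡 n) x₀).symm ⁻¹' U,
      chartChange x₀ x₁ y ∈
        (extChartAt (𝓡 n) x₁).target ∩ (extChartAt (𝓡 n) x₁).symm ⁻¹' U := by
    intro y hy
    refine ⟨(extChartAt (𝓡 n) x₁).map_source (hUx hy.2), ?_⟩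
    rw [Set.mem_preimage]
    unfold chartChange
    rw [(extChartAt (𝓡 n) x₁).left_inv (hUx hy.2)]
    exact hy.2
  have hφ := (contDiffOn_chartChange x₀ x₁).mono (t := (extChartAt (𝓡 n) x₀).target ∩
    (extChartAt (𝓡 n) x₀).symm ⁻¹' U) (Set.inter_subset_inter_right _ fun y hy => hUx hy)
  have h1 := h.comp hφ hmaps
  refine contDiffOn_form fun v => ?_
  refine (ContDiffOn.form_apply h1 (v := fun a y => fderiv ℝ (chartChange x₀ x₁) y (v a))
    fun a => ?_).congr fun y hy => ?_
  · exact (hφ.fderiv_of_isOpen (isOpen_chartDomain x₀ hU) (by simp)).clm_apply contDiffOn_const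
  · rw [chartForm_change β hy.1 (hUx hy.2)]
    rfl

theorem SmoothFormOn.contDiffAt {β : RoughForm n (fun _ : M => ℂ) k} {U : Set M}
    (hβ : SmoothFormOn β U) (hU : IsOpen U) {x₀ x : M} (hx : x ∈ U)
    (hx₀ : x ∈ (extChartAt (𝓡 n) x₀).source) :
    ContDiffAt ℝ ∞ (chartForm β x₀) (extChartAt (𝓡 n) x₀ x) := by
  refine (hβ x₀).contDiffAt ((isOpen_chartDomain x₀ hU).mem_nhds
    ⟨(extChartAt (𝓡 n) x₀).map_source hx₀, ?_⟩)
  rw [Set.mem_preimage, (extChartAt (𝓡 n) x₀).left_inv hx₀]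
  exact hx

/-- The exterior derivative may be computed in any chart. -/
theorem SmoothFormOn.extD_apply_chart {β : RoughForm n (fun _ : M => ℂ) k} {U : Set M}
    (hβ : SmoothFormOn β U) (hU : IsOpen U) {x₀ x : M} (hx : x ∈ U)
    (hx₀ : x ∈ (extChartAt (𝓡 n) x₀).source) (v : Fin (k + 1) → TangentSpace (𝓡 n) x) :
    extD β x v = extDeriv (chartForm β x₀) (extChartAt (𝓡 n) x₀ x)
      (fun a => toChart x₀ x (v a)) := by
  have hxx : x ∈ (extChartAt (𝓡 n) x).source := mem_extChartAt_source x
  have hp := (extChartAt (𝓡 n) x₀).map_source hx₀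
  have hp' : (extChartAt (𝓡 n) x₀).symm (extChartAt (𝓡 n) x₀ x) ∈
      (extChartAt (𝓡 n) x).source := by rwa [(extChartAt (𝓡 n) x₀).left_inv hx₀]
  have hφ : chartChange x₀ x (extChartAt (𝓡 n) x₀ x) = extChartAt (𝓡 n) x x := by
    unfold chartChange
    rw [(extChartAt (𝓡 n) x₀).left_inv hx₀]
  have hnh := (isOpen_chartDomain x₀ (isOpen_extChartAt_source (I := 𝓡 n) x)).mem_nhds ⟨hp, hp'⟩
  have h1 : chartForm β x₀ =ᶠ[𝓝 (extChartAt (𝓡 n) x₀ x)] fun y =>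
      (chartForm β x (chartChange x₀ x y)).compContinuousLinearMap
        (fderiv ℝ (chartChange x₀ x) y) := by
    filter_upwards [hnh] with y hy
    exact chartForm_change β hy.1 hy.2
  have h2 : DifferentiableAt ℝ (chartForm β x) (chartChange x₀ x (extChartAt (𝓡 n) x₀ x)) := by
    rw [hφ]
    exact (hβ.contDiffAt hU hx hxx).differentiableAt (by simp)
  rw [h1.extDeriv_eq, extDeriv_pullback h2 ((contDiffOn_chartChange x₀ x).contDiffAt hnh) (by
    rw [minSmoothness_of_isRCLikeNormedField]
    exact WithTop.coe_le_coe.2 (le_top : (2 : ℕ∞) ≤ ⊤)), hφ, extD_apply,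
    ContinuousAlternatingMap.compContinuousLinearMap_apply]
  congr 1
  funext a
  exact (fderiv_chartChange_toChart hx₀ hxx (v a)).symm

/-- At each point `extD` uses the chart of that very point. For smooth forms one fixed chart
computes it on a whole neighbourhood, so identities such as `d² = 0` carry over from `ℝⁿ`. -/
theorem SmoothFormOn.chartForm_extD {β : RoughForm n (fun _ : M => ℂ) k} {U : Set M}
    (hβ : SmoothFormOn β U) (hU : IsOpen U) {x₀ : M} {y : Eucl n}
    (hy : y ∈ (extChartAt (𝓡 n) x₀).target) (hyU : (extChartAt (𝓡 n) x₀).symm y ∈ U) :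
    chartForm (extD β) x₀ y = extDeriv (chartForm β x₀) y := by
  ext v
  rw [chartForm_apply]
  refine (hβ.extD_apply_chart hU hyU ((extChartAt (𝓡 n) x₀).map_target hy) _).trans ?_
  rw [(extChartAt (𝓡 n) x₀).right_inv hy]
  congr 1
  funext a
  exact toChart_fromChart hy (v a)

theorem SmoothFormOn.extD {β : RoughForm n (fun _ : M => ℂ) k} {U : Set M}
    (hβ : SmoothFormOn β U) (hU : IsOpen U) : SmoothFormOn (extD β) U := fun x₀ =>
  (ContDiffOn.extDeriv (isOpen_chartDomain x₀ hU) (hβ x₀)).congr fun _ hy =>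
    hβ.chartForm_extD hU hy.1 hy.2

theorem SmoothFormOn.extD_extD {β : RoughForm n (fun _ : M => ℂ) k} {U : Set M}
    (hβ : SmoothFormOn β U) (hU : IsOpen U) {x : M} (hx : x ∈ U) :
    EndJet.extD (EndJet.extD β) x = 0 := by
  ext v
  have hxx : x ∈ (extChartAt (𝓡 n) x).source := mem_extChartAt_source x
  rw [extD_apply]
  have h1 : chartForm (EndJet.extD β) x =ᶠ[𝓝 (extChartAt (𝓡 n) x x)] extDeriv (chartForm β x) := by
    filter_upwards [(isOpen_chartDomain x hU).mem_nhds ⟨(extChartAt (𝓡 n) x).map_source hxx, by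
      rw [Set.mem_preimage, (extChartAt (𝓡 n) x).left_inv hxx]; exact hx⟩] with y hy
    exact hβ.chartForm_extD hU hy.1 hy.2
  rw [h1.extDeriv_eq, extDeriv_extDeriv_apply (hβ.contDiffAt hU hx hxx) (by
    rw [minSmoothness_of_isRCLikeNormedField]
    exact WithTop.coe_le_coe.2 (le_top : (2 : ℕ∞) ≤ ⊤))]
  rfl

theorem extD_congr {β β' : RoughForm n (fun _ : M => ℂ) k} {U : Set M} (hU : IsOpen U)
    (h : ∀ x ∈ U, β x = β' x) {x : M} (hx : x ∈ U) : extD β x = extD β' x := by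
  ext v
  rw [extD_apply, extD_apply]
  have hxx : x ∈ (extChartAt (𝓡 n) x).source := mem_extChartAt_source x
  have h1 : chartForm β x =ᶠ[𝓝 (extChartAt (𝓡 n) x x)] chartForm β' x := by
    filter_upwards [(isOpen_chartDomain x hU).mem_nhds ⟨(extChartAt (𝓡 n) x).map_source hxx, by
      rw [Set.mem_preimage, (extChartAt (𝓡 n) x).left_inv hxx]; exact hx⟩] with y hy
    unfold chartForm
    rw [h _ hy.2]
  rw [h1.extDeriv_eq]

theorem SmoothFormOn.mono {β : RoughForm n (fun _ : M => ℂ) k} {U V : Set M}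
    (hβ : SmoothFormOn β U) (h : V ⊆ U) : SmoothFormOn β V := fun x₀ =>
  (hβ x₀).mono (Set.inter_subset_inter_right _ (Set.preimage_mono h))

theorem SmoothFormOn.congr {β β' : RoughForm n (fun _ : M => ℂ) k} {U : Set M}
    (hβ : SmoothFormOn β U) (h : ∀ x ∈ U, β' x = β x) : SmoothFormOn β' U := fun x₀ =>
  (hβ x₀).congr fun y hy => by
    unfold chartForm
    rw [h _ hy.2]

theorem smoothFormOn_of_locally {β : RoughForm n (fun _ : M => ℂ) k} {U : Set M}
    (h : ∀ x ∈ U, ∃ V, IsOpen V ∧ x ∈ V ∧ SmoothFormOn β V) : SmoothFormOn β U := by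
  intro x₀ y hy
  obtain ⟨V, hV, hxV, hβ⟩ := h _ hy.2
  exact ((hβ x₀).contDiffAt ((isOpen_chartDomain x₀ hV).mem_nhds ⟨hy.1, hxV⟩)).contDiffWithinAt

end Charts

/-! ### Sums of products of functions and forms -/

section FunctionForms

variable {n k : ℕ} {M : Type*} [TopologicalSpace M] [ChartedSpace (Eucl n) M]
  [IsManifold (𝓡 n) ∞ M] {ι : Type*} [Fintype ι]

/-- The form `∑ᵣ fᵣ βᵣ`. -/
def sumForm (f : ι → M → ℂ) (β : ι → RoughForm n (fun _ : M => ℂ) k) :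
    RoughForm n (fun _ : M => ℂ) k := fun x => ∑ r, f r x • β r x

theorem sumForm_apply (f : ι → M → ℂ) (β : ι → RoughForm n (fun _ : M => ℂ) k) (x : M)
    (v : Fin k → TangentSpace (𝓡 n) x) : sumForm f β x v = ∑ r, f r x * β r x v := by
  let ev : ((TangentSpace (𝓡 n) x) [⋀^Fin k]→ₗ[ℝ] ℂ) →+ ℂ :=
    { toFun := fun g => g v, map_zero' := rfl, map_add' := fun _ _ => rfl }
  exact map_sum ev (fun r => f r x • β r x) Finset.univ

theorem chartForm_sumForm (f : ι → M → ℂ) (β : ι → RoughForm n (fun _ : M => ℂ) k) (x₀ : M)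
    (y : Eucl n) (v : Fin k → Eucl n) : chartForm (sumForm f β) x₀ y v =
      ∑ r, f r ((extChartAt (𝓡 n) x₀).symm y) * chartForm (β r) x₀ y v := by
  rw [chartForm_apply]
  exact sumForm_apply f β _ _

theorem contDiffOn_comp_chart_symm {f : M → ℂ} {U : Set M} (hf : ContMDiffOn (𝓡 n) 𝓘(ℝ, ℂ) ∞ f U)
    (x₀ : M) : ContDiffOn ℝ ∞ (fun y => f ((extChartAt (𝓡 n) x₀).symm y))
      ((extChartAt (𝓡 n) x₀).target ∩ (extChartAt (𝓡 n) x₀).symm ⁻¹' U) :=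
  contMDiffOn_iff_contDiffOn.1 (hf.comp
    ((contMDiffOn_extChartAt_symm (n := ∞) x₀).mono Set.inter_subset_left) fun _ hy => hy.2)

theorem smoothFormOn_sumForm {f : ι → M → ℂ} {β : ι → RoughForm n (fun _ : M => ℂ) k} {U : Set M}
    (hf : ∀ r, ContMDiffOn (𝓡 n) 𝓘(ℝ, ℂ) ∞ (f r) U) (hβ : ∀ r, SmoothFormOn (β r) U) :
    SmoothFormOn (sumForm f β) U := by
  intro x₀
  refine contDiffOn_form fun v => ?_
  simp_rw [chartForm_sumForm]
  refine ContDiffOn.sum fun r _ => ?_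
  exact (contDiffOn_comp_chart_symm (hf r) x₀).mul
    (ContDiffOn.form_apply (hβ r x₀) fun a => contDiffOn_const)

theorem chartForm_toChart (β : RoughForm n (fun _ : M => ℂ) k) {x₀ x : M}
    (hx : x ∈ (extChartAt (𝓡 n) x₀).source) (v : Fin k → TangentSpace (𝓡 n) x) :
    chartForm β x₀ (extChartAt (𝓡 n) x₀ x) (fun a => toChart x₀ x (v a)) = β x v := by
  rw [chartForm_apply]
  refine β.congr_apply ((extChartAt (𝓡 n) x₀).left_inv hx) ?_
  funext a
  exact fromChart_toChart hx (v a)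

theorem dAt_eq_fderiv {f : M → ℂ} {x₀ x : M} (hf : MDifferentiableAt (𝓡 n) 𝓘(ℝ, ℂ) f x)
    (hx : x ∈ (extChartAt (𝓡 n) x₀).source) (v : Eucl n) :
    dAt f x v = fderiv ℝ (fun y => f ((extChartAt (𝓡 n) x₀).symm y)) (extChartAt (𝓡 n) x₀ x)
      (toChart x₀ x v) := by
  have h0 := (extChartAt (𝓡 n) x₀).left_inv hx
  have h1 : MDifferentiableAt (𝓡 n) 𝓘(ℝ, ℂ) f
      ((extChartAt (𝓡 n) x₀).symm (extChartAt (𝓡 n) x₀ x)) := by rwa [h0]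
  have h2 := (h1.hasMFDerivAt.comp _ (mdifferentiableAt_extChartAt_symm'
    ((extChartAt (𝓡 n) x₀).map_source hx)).hasMFDerivAt).hasFDerivAt
  have h3 : HasFDerivAt (fun y => f ((extChartAt (𝓡 n) x₀).symm y))
      ((dAt f ((extChartAt (𝓡 n) x₀).symm (extChartAt (𝓡 n) x₀ x))).comp
        (fromChart x₀ (extChartAt (𝓡 n) x₀ x))) (extChartAt (𝓡 n) x₀ x) := h2
  rw [h3.fderiv, ContinuousLinearMap.comp_apply, fromChart_toChart hx, h0]

/-- The Leibniz rule `d(fβ) = f dβ + df ∧ β`, with the wedge product expanded into the same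
alternating sum as in `wedge`, so that the two can cancel later. -/
theorem extD_sumForm {f : ι → M → ℂ} {β : ι → RoughForm n (fun _ : M => ℂ) k} {U : Set M}
    (hU : IsOpen U) (hf : ∀ r, ContMDiffOn (𝓡 n) 𝓘(ℝ, ℂ) ∞ (f r) U)
    (hβ : ∀ r, SmoothFormOn (β r) U) {x : M} (hx : x ∈ U)
    (v : Fin (k + 1) → TangentSpace (𝓡 n) x) :
    extD (sumForm f β) x v = ∑ r, (f r x * extD (β r) x v +
      ∑ a : Fin (k + 1), (-1 : ℂ) ^ (a : ℕ) *
        (dAt (f r) x (v a) * β r x fun b => v (a.succAbove b))) := by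
  have hxx : x ∈ (extChartAt (𝓡 n) x).source := mem_extChartAt_source x
  set p := extChartAt (𝓡 n) x x with hp
  have hpn := (isOpen_chartDomain x hU).mem_nhds ⟨(extChartAt (𝓡 n) x).map_source hxx, by
      rw [Set.mem_preimage, (extChartAt (𝓡 n) x).left_inv hxx]; exact hx⟩
  have hdf : ∀ r, DifferentiableAt ℝ (fun y => f r ((extChartAt (𝓡 n) x).symm y)) p := fun r =>
    ((contDiffOn_comp_chart_symm (hf r) x).contDiffAt hpn).differentiableAt (by simp)
  have hdβ : ∀ r (w : Fin k → Eucl n), DifferentiableAt ℝ (fun y => chartForm (β r) x y w) p :=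
    fun r w => ((ContDiffOn.form_apply (hβ r x) (v := fun a _ => w a)
      fun a => contDiffOn_const).contDiffAt hpn).differentiableAt (by simp)
  rw [extD_apply, extDeriv_apply (((smoothFormOn_sumForm hf hβ).contDiffAt hU hx
    hxx).differentiableAt (by simp))]
  have h1 : ∀ r, extD (β r) x v = ∑ a : Fin (k + 1), (-1 : ℂ) ^ (a : ℕ) *
      fderiv ℝ (fun y => chartForm (β r) x y (fun b => toChart x x (v (a.succAbove b)))) p
        (toChart x x (v a)) := by
    intro r
    rw [extD_apply, extDeriv_apply (((hβ r).contDiffAt hU hx hxx).differentiableAt (by simp))]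
    refine Finset.sum_congr rfl fun a _ => ?_
    rw [zsmul_eq_mul]
    push_cast
    rfl
  simp_rw [h1, Finset.mul_sum, ← Finset.sum_add_distrib]
  rw [Finset.sum_comm]
  refine Finset.sum_congr rfl fun a _ => ?_
  rw [zsmul_eq_mul]
  push_cast
  let w : Fin k → Eucl n := fun b => toChart x x (v (a.succAbove b))
  have h2 : HasFDerivAt (fun y => chartForm (sumForm f β) x y w)
      (∑ r, (f r ((extChartAt (𝓡 n) x).symm p) • fderiv ℝ (fun y => chartForm (β r) x y w) p +
        chartForm (β r) x p w • fderiv ℝ (fun y => f r ((extChartAt (𝓡 n) x).symm y)) p)) p := by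
    have h6 : (fun y => chartForm (sumForm f β) x y w) = fun y => ∑ r,
        f r ((extChartAt (𝓡 n) x).symm y) * chartForm (β r) x y w := by
      funext y
      exact chartForm_sumForm f β x y _
    rw [h6]
    exact HasFDerivAt.fun_sum fun r _ => (hdf r).hasFDerivAt.mul (hdβ r w).hasFDerivAt
  have h7 : fderiv ℝ (fun y => chartForm (sumForm f β) x y w) p (toChart x x (v a)) =
      ∑ r, (f r x * fderiv ℝ (fun y => chartForm (β r) x y w) p (toChart x x (v a)) +
        dAt (f r) x (v a) * β r x fun b => v (a.succAbove b)) := by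
    rw [h2.fderiv, ContinuousLinearMap.sum_apply]
    refine Finset.sum_congr rfl fun r _ => ?_
    have h3 : chartForm (β r) x p w = β r x fun b => v (a.succAbove b) :=
      chartForm_toChart (β r) hxx _
    have h4 : dAt (f r) x (v a) = fderiv ℝ (fun y => f r ((extChartAt (𝓡 n) x).symm y)) p
        (toChart x x (v a)) :=
      dAt_eq_fderiv (((hf r).contMDiffAt (hU.mem_nhds hx)).mdifferentiableAt (by simp)) hxx _
    have h5 : f r ((extChartAt (𝓡 n) x).symm p) = f r x :=
      congrArg (f r) ((extChartAt (𝓡 n) x).left_inv hxx)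
    rw [h3, h5, h4]
    simp only [ContinuousLinearMap.add_apply, ContinuousLinearMap.smul_apply, smul_eq_mul]
    ring
  refine (congrArg ((-1 : ℂ) ^ (a : ℕ) * ·) h7).trans ?_
  rw [Finset.mul_sum]
  refine Finset.sum_congr rfl fun r _ => ?_
  change _ = f r x * ((-1) ^ (a : ℕ) * fderiv ℝ (fun y => chartForm (β r) x y w) p
    (toChart x x (v a))) + _
  ring

end FunctionForms

section JetForms

variable {n N : ℕ} {M : Type*} [TopologicalSpace M] [ChartedSpace (Eucl n) M]
  {E : M → Type*} [∀ x, AddCommGroup (E x)] [∀ x, Module ℂ (E x)]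
  [∀ x, TopologicalSpace (E x)] [TopologicalSpace (TotalSpace (Fib N) E)]
  [FiberBundle (Fib N) E] [VectorBundle ℂ (Fib N) E]
  [∀ x, IsTopologicalAddGroup (E x)] [∀ x, ContinuousSMul ℂ (E x)]

/-! ### The fibres of the jet bundle -/

theorem coeffEntry_algebraMap_smul (c : ℝ) (f : MatPS n N) : (c : ℂ) • f = c • f := by
  refine matPS_ext fun I i j => ?_
  rw [coeffEntry_smul, map_smul, Complex.real_smul]

theorem JE.smul_apply {m : M} (c : ℂ) (s : JE n N E m) (Φ : Frame n N E m) :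
    (c • s).1 Φ = c • s.1 Φ := rfl

theorem JE.sum_apply {m : M} {ι : Type*} (t : Finset ι) (s : ι → JE n N E m) (Φ : Frame n N E m) :
    (∑ r ∈ t, s r).1 Φ = ∑ r ∈ t, (s r).1 Φ := by
  let ev : JE n N E m →+ MatPS n N :=
    { toFun := fun s => s.1 Φ, map_zero' := rfl, map_add' := fun _ _ => rfl }
  exact map_sum ev s t

/-- The adic filtration of the fibres of the jet bundle does not depend on frames. -/
theorem JE.mem_adicSub_of_frame {m : M} {s : JE n N E m} {Φ : Frame n N E m} {k : ℕ}
    (h : s.1 Φ ∈ adicSub n N k) (Φ' : Frame n N E m) : s.1 Φ' ∈ adicSub n N k := by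
  obtain ⟨g, rfl⟩ := Φ.exists_comp_eq Φ'
  rw [s.2 Φ g]
  exact map_adicSub_of_mem_G (inv_mem g.2) h

theorem JE.ext_frame {m : M} {s t : JE n N E m} (Φ : Frame n N E m) (h : s.1 Φ = t.1 Φ) :
    s = t := by
  refine Subtype.ext (funext fun Φ' => ?_)
  obtain ⟨g, rfl⟩ := Φ.exists_comp_eq Φ'
  rw [s.2 Φ g, t.2 Φ g, h]

/-- The transition between two frames at a point. -/
def Frame.change {m : M} (Φ Φ' : Frame n N E m) : MatPS n N ≃ₐ[ℂ] MatPS n N :=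
  Φ.toEquiv.trans Φ'.toEquiv.symm

/-- The element of the fibre of the jet bundle with given value in a frame. -/
def JE.ofFrame {m : M} (Φ : Frame n N E m) : MatPS n N →ₗ[ℝ] JE n N E m where
  toFun f := ⟨fun Φ' => Φ.change Φ' f, fun _ _ => rfl⟩
  map_add' f g := Subtype.ext (funext fun Φ' => map_add (Φ.change Φ') f g)
  map_smul' c f := Subtype.ext (funext fun Φ' => by
    change Φ.change Φ' (c • f) = c • Φ.change Φ' f
    rw [← coeffEntry_algebraMap_smul, map_smul, coeffEntry_algebraMap_smul])

theorem JE.ofFrame_apply_self {m : M} (Φ : Frame n N E m) (f : MatPS n N) :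
    (JE.ofFrame Φ f).1 Φ = f := Φ.toEquiv.symm_apply_apply f

/-- The jet of a section as an element of the jet bundle. -/
def jetJE (γ : Sec n N E) (m : M) : JE n N E m :=
  ⟨fun Φ => Φ.toEquiv.symm (jet n N E m γ), fun _ _ => rfl⟩

/-! ### Approximation of forms by jets of sections -/

/-- On `U`, the form `α` agrees with `∑ᵣ βᵣ ⊗ J(γᵣ)` up to terms of degree at least `d`. -/
structure IsDecomp {k : ℕ} (α : RoughForm n (fun x => JE n N E x) k) (d : ℕ) (U : Set M)
    {ι : Type} [Fintype ι] (β : ι → RoughForm n (fun _ : M => ℂ) k) (γ : ι → Sec n N E) :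
    Prop where
  smooth : ∀ r, SmoothFormOn (β r) U
  approx : ∀ x ∈ U, ∀ (v : Fin k → TangentSpace (𝓡 n) x) (Φ : Frame n N E x),
    (α x v).1 Φ - ∑ r, β r x v • Φ.toEquiv.symm (jet n N E x (γ r)) ∈ adicSub n N d

/-- Near every point of `U`, the form `α` can be approximated to every order. -/
def LocDecomp {k : ℕ} (α : RoughForm n (fun x => JE n N E x) k) (U : Set M) : Prop :=
  ∀ x ∈ U, ∀ d, ∃ V, IsOpen V ∧ x ∈ V ∧ ∃ (ι : Type) (_ : Fintype ι)
    (β : ι → RoughForm n (fun _ : M => ℂ) k) (γ : ι → Sec n N E), IsDecomp α d V β γ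

theorem coeffForm_apply {k : ℕ} (α : RoughForm n (fun x => JE n N E x) k)
    (σ : ∀ x : M, Frame n N E x) (I : Fin n →₀ ℕ) (i j : Fin N) (x : M)
    (v : Fin k → TangentSpace (𝓡 n) x) :
    coeffForm α σ I i j x v = coeffEntry I i j ((α x v).1 (σ x)) := rfl

/-- The coefficients of the jets of a section in a frame field. -/
def jetCoeff (σ : ∀ x : M, Frame n N E x) (γ : Sec n N E) (I : Fin n →₀ ℕ) (i j : Fin N)
    (x : M) : ℂ := coeffEntry I i j ((σ x).toEquiv.symm (jet n N E x γ))

theorem coeffEntry_sum_smul {ι : Type*} [Fintype ι] (c : ι → ℂ) (f : ι → MatPS n N)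
    (I : Fin n →₀ ℕ) (i j : Fin N) :
    coeffEntry I i j (∑ r, c r • f r) = ∑ r, coeffEntry I i j (f r) * c r := by
  rw [map_sum]
  exact Finset.sum_congr rfl fun r _ => by rw [coeffEntry_smul, mul_comm]

variable {k d : ℕ} {α : RoughForm n (fun x => JE n N E x) k} {U : Set M} {ι : Type} [Fintype ι]
  {β : ι → RoughForm n (fun _ : M => ℂ) k} {γ : ι → Sec n N E}

variable [IsManifold (𝓡 n) ∞ M]

theorem IsDecomp.coeffForm_eq (h : IsDecomp α d U β γ) (σ : ∀ x : M, Frame n N E x)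
    {I : Fin n →₀ ℕ} (hI : I.degree < d) (i j : Fin N) {x : M} (hx : x ∈ U) :
    coeffForm α σ I i j x = sumForm (fun r => jetCoeff σ (γ r) I i j) β x := by
  ext v
  rw [sumForm_apply, coeffForm_apply, coeffEntry_eq_of_sub_mem (h.approx x hx v (σ x)) hI,
    coeffEntry_sum_smul]
  rfl

theorem IsDecomp.smoothFormOn (h : IsDecomp α d U β γ) {V : Set M} {σ : ∀ x : M, Frame n N E x}
    (hσ : SmoothFrameOn n N E σ V) {I : Fin n →₀ ℕ} (hI : I.degree < d) (i j : Fin N) :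
    SmoothFormOn (coeffForm α σ I i j) (U ∩ V) := by
  refine (smoothFormOn_sumForm (f := fun r => jetCoeff σ (γ r) I i j) (β := β)
    (fun r => (hσ (γ r) I i j).mono Set.inter_subset_right)
    fun r => (h.smooth r).mono Set.inter_subset_left).congr fun x hx => ?_
  exact h.coeffForm_eq σ hI i j hx.1

theorem coeffEntry_wedge (A : ∀ x : M, TangentSpace (𝓡 n) x → Der n N)
    (σ : ∀ x : M, Frame n N E x) (x : M) (v : Fin (k + 1) → TangentSpace (𝓡 n) x)
    (I : Fin n →₀ ℕ) (i j : Fin N) : coeffEntry I i j (wedge A α σ x v) =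
      ∑ a : Fin (k + 1), (-1 : ℂ) ^ (a : ℕ) *
        coeffEntry I i j ((A x (v a)).1 ((α x fun b => v (a.succAbove b)).1 (σ x))) := by
  rw [wedge, map_sum]
  exact Finset.sum_congr rfl fun a _ => coeffEntry_smul _ _ _ _ _

/-- The expression `d + σ^*ω` in terms of an approximation by jets of sections. -/
theorem IsDecomp.extD_add_wedge (h : IsDecomp α (d + 1) U β γ) (hU : IsOpen U) {V : Set M}
    (hV : IsOpen V) {σ : ∀ x : M, Frame n N E x} (hσ : SmoothFrameOn n N E σ V)
    {A : ∀ x : M, TangentSpace (𝓡 n) x → Der n N} {x : M} (hx : x ∈ U) (hxV : x ∈ V)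
    (hA : ∀ (v : TangentSpace (𝓡 n) x) (γ : Sec n N E) (I : Fin n →₀ ℕ) (i j : Fin N),
      coeffEntry I i j ((A x v).1 ((σ x).toEquiv.symm (jet n N E x γ))) =
        -dAt (jetCoeff σ γ I i j) x v)
    {I : Fin n →₀ ℕ} (hI : I.degree < d) (i j : Fin N)
    (v : Fin (k + 1) → TangentSpace (𝓡 n) x) :
    extD (coeffForm α σ I i j) x v + coeffEntry I i j (wedge A α σ x v) =
      ∑ r, jetCoeff σ (γ r) I i j x * extD (β r) x v := by
  have hUV := hU.inter hV
  rw [extD_congr hUV (fun y hy => h.coeffForm_eq σ (hI.trans (Nat.lt_succ_self d)) i j hy.1)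
    ⟨hx, hxV⟩, extD_sumForm (f := fun r => jetCoeff σ (γ r) I i j) hUV (fun r => (hσ (γ r) I i j).mono Set.inter_subset_right)
    (fun r => (h.smooth r).mono Set.inter_subset_left) ⟨hx, hxV⟩, Finset.sum_add_distrib,
    coeffEntry_wedge, add_assoc]
  -- The terms `d(jetCoeff) ∧ β_r` of the Leibniz rule cancel against the connection form, whose
  -- value on jets is given by `hA`.
  refine add_eq_left.2 ?_
  rw [Finset.sum_comm, ← Finset.sum_add_distrib]
  refine Finset.sum_eq_zero fun a _ => ?_
  have h1 : coeffEntry I i j ((A x (v a)).1 ((α x fun b => v (a.succAbove b)).1 (σ x))) =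
      -∑ r, dAt (jetCoeff σ (γ r) I i j) x (v a) * β r x fun b => v (a.succAbove b) := by
    -- The derivation turns the error of order `d + 1` into one of order `d`, still invisible in
    -- degrees less than `d`.
    have h2 := Der.map_adicSub (A x (v a)) (h.approx x hx (fun b => v (a.succAbove b)) (σ x))
    rw [map_sub] at h2
    rw [coeffEntry_eq_of_sub_mem h2 hI, map_sum]
    simp_rw [map_smul]
    rw [coeffEntry_sum_smul, ← Finset.sum_neg_distrib]
    refine Finset.sum_congr rfl fun r _ => ?_
    rw [hA, neg_mul]
  rw [h1, ← Finset.mul_sum]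
  ring

/-! ### The connection -/

variable [T2Space M] {hE : IsSmoothBundle n N E}

/-- The action of the connection form on a form in the standard frame at `x`. -/
def wedgeStd (hE : IsSmoothBundle n N E) (α : RoughForm n (fun x => JE n N E x) k) (x : M)
    (I : Fin n →₀ ℕ) (i j : Fin N) :
    (TangentSpace (𝓡 n) x) [⋀^Fin (k + 1)]→ₗ[ℝ] ℂ :=
  AlternatingMap.alternatizeUncurryFin
    { toFun := fun v => (coeffEntry I i j ∘ₗ
        ((negDirDer n N (toChart x x v)).1.restrictScalars ℝ) ∘ₗ
        LinearMap.proj (R := ℝ) (stdFrame n N E hE x x) ∘ₗ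
        ((JE n N E x).val.toLinearMap.restrictScalars ℝ)).compAlternatingMap (α x)
      map_add' := fun v w => by
        ext u
        change coeffEntry I i j ((negDirDer n N (toChart x x (v + w))).1
          ((α x u).1 (stdFrame n N E hE x x))) =
          coeffEntry I i j ((negDirDer n N (toChart x x v)).1
            ((α x u).1 (stdFrame n N E hE x x))) +
          coeffEntry I i j ((negDirDer n N (toChart x x w)).1
            ((α x u).1 (stdFrame n N E hE x x)))
        rw [coeffEntry_apply, coeffEntry_apply, coeffEntry_apply, coeff_negDirDer,
          coeff_negDirDer, coeff_negDirDer, ← neg_add, ← Finset.sum_add_distrib]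
        refine congrArg Neg.neg (Finset.sum_congr rfl fun s _ => ?_)
        have : toChart x x (v + w) s = toChart x x v s + toChart x x w s :=
          congrFun (congrArg WithLp.ofLp (map_add (toChart x x) v w)) s
        rw [this]
        push_cast
        ring
      map_smul' := fun c v => by
        ext u
        change coeffEntry I i j ((negDirDer n N (toChart x x (c • v))).1
          ((α x u).1 (stdFrame n N E hE x x))) =
          c • coeffEntry I i j ((negDirDer n N (toChart x x v)).1
            ((α x u).1 (stdFrame n N E hE x x)))
        rw [coeffEntry_apply, coeffEntry_apply, coeff_negDirDer,
          coeff_negDirDer, smul_neg, Finset.smul_sum]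
        refine congrArg Neg.neg (Finset.sum_congr rfl fun s _ => ?_)
        have : toChart x x (c • v) s = c * toChart x x v s :=
          congrFun (congrArg WithLp.ofLp (map_smul (toChart x x) c v)) s
        rw [this, Complex.real_smul]
        push_cast
        ring }

/-- The derivations `σ^*ω` in the standard frame fields. -/
def stdOmega (n N : ℕ) {M : Type*} [TopologicalSpace M] [ChartedSpace (Eucl n) M] (x₀ : M) (x : M)
    (v : TangentSpace (𝓡 n) x) : Der n N :=
  negDirDer n N (toChart x₀ x v)

theorem wedgeStd_apply (α : RoughForm n (fun x => JE n N E x) k) (x : M)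
    (I : Fin n →₀ ℕ) (i j : Fin N) (v : Fin (k + 1) → TangentSpace (𝓡 n) x) :
    wedgeStd hE α x I i j v =
      coeffEntry I i j (wedge (stdOmega n N x) α (stdFrame n N E hE x) x v) := by
  rw [coeffEntry_wedge, wedgeStd, AlternatingMap.alternatizeUncurryFin_apply]
  refine Finset.sum_congr rfl fun a _ => ?_
  rw [zsmul_eq_mul]
  push_cast
  rfl

/-- The connection induced by `ω`, on forms without smoothness. -/
def nabRough (hE : IsSmoothBundle n N E) (α : RoughForm n (fun x => JE n N E x) k) :
    RoughForm n (fun x => JE n N E x) (k + 1) := fun x =>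
  -- Each point uses its own standard frame field. Independence of this choice is proved only for
  -- forms with approximations by jets.
  (JE.ofFrame (stdFrame n N E hE x x)).compAlternatingMap
    { toFun := fun v => Matrix.of fun i j => ((fun I =>
        extD (coeffForm α (stdFrame n N E hE x) I i j) x v + wedgeStd hE α x I i j v) : PS n)
      map_update_add' := fun v a u w => by
        refine matPS_ext fun I i j => ?_
        exact (extD (coeffForm α (stdFrame n N E hE x) I i j) x +
          wedgeStd hE α x I i j).map_update_add v a u w
      map_update_smul' := fun v a c u => by
        refine matPS_ext fun I i j => ?_
        exact (extD (coeffForm α (stdFrame n N E hE x) I i j) x +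
          wedgeStd hE α x I i j).map_update_smul v a c u
      map_eq_zero_of_eq' := fun v a b hab hne => by
        refine matPS_ext fun I i j => ?_
        exact (extD (coeffForm α (stdFrame n N E hE x) I i j) x +
          wedgeStd hE α x I i j).map_eq_zero_of_eq v hab hne }

theorem coeffEntry_nabRough_std (α : RoughForm n (fun x => JE n N E x) k) (x : M)
    (v : Fin (k + 1) → TangentSpace (𝓡 n) x) (I : Fin n →₀ ℕ) (i j : Fin N) :
    coeffEntry I i j ((nabRough hE α x v).1 (stdFrame n N E hE x x)) =
      extD (coeffForm α (stdFrame n N E hE x) I i j) x v +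
        coeffEntry I i j (wedge (stdOmega n N x) α (stdFrame n N E hE x) x v) := by
  rw [← wedgeStd_apply]
  refine (congrArg (coeffEntry I i j) (JE.ofFrame_apply_self _ _)).trans ?_
  rfl

theorem isPullbackOmega_stdOmega {x₀ x : M} (hx : x ∈ (stdTriv n N E hE x₀).chart.source)
    (v : TangentSpace (𝓡 n) x) :
    IsPullbackOmega (stdFrame n N E hE x₀) x v (stdOmega n N x₀ x v) :=
  isPullbackOmega_stdFrame hx v

/-- The connection in terms of an approximation by jets of sections. -/
theorem IsDecomp.nabRough (h : IsDecomp α (d + 1) U β γ) (hU : IsOpen U) :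
    IsDecomp (nabRough hE α) d U (fun r => extD (β r)) γ := by
  refine ⟨fun r => (h.smooth r).extD hU, fun x hx v Φ => ?_⟩
  have hxs := self_mem_stdTriv_source (hE := hE) x
  -- The adic filtration does not depend on the frame, so the estimate in the standard frame at `x`
  -- suffices.
  have h1 : ((EndJet.nabRough hE α x v - ∑ r, extD (β r) x v • jetJE (γ r) x : JE n N E x)).1
      (stdFrame n N E hE x x) ∈ adicSub n N d := by
    have h2 : ((EndJet.nabRough hE α x v - ∑ r, extD (β r) x v • jetJE (γ r) x : JE n N E x)).1
        (stdFrame n N E hE x x) = (EndJet.nabRough hE α x v).1 (stdFrame n N E hE x x) -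
          ∑ r, extD (β r) x v •
            (stdFrame n N E hE x x).toEquiv.symm (jet n N E x (γ r)) := by
      rw [AddSubgroupClass.coe_sub, Pi.sub_apply, JE.sum_apply]
      rfl
    rw [h2, mem_adicSub_iff]
    intro i j I hI
    rw [Matrix.sub_apply, map_sub, sub_eq_zero]
    refine (coeffEntry_nabRough_std α x v I i j).trans ?_
    rw [h.extD_add_wedge hU (stdTriv n N E hE x).chart.open_source (smoothFrameOn_stdFrame x)
      hx hxs (fun v γ I i j => (isPullbackOmega_stdOmega hxs v).apply_jet hE
        (stdTriv n N E hE x).chart.open_source (smoothFrameOn_stdFrame x) hxs γ I i j) hI]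
    exact (coeffEntry_sum_smul _ _ I i j).symm
  have h3 := JE.mem_adicSub_of_frame h1 Φ
  rw [AddSubgroupClass.coe_sub, Pi.sub_apply, JE.sum_apply] at h3
  exact h3

/-- The connection is `d + σ^*ω` in every smooth frame field. -/
theorem LocDecomp.coeffEntry_nabRough (h : LocDecomp α U) {V : Set M}
    (hV : IsOpen V) {σ : ∀ x : M, Frame n N E x} (hσ : SmoothFrameOn n N E σ V)
    {A : ∀ x : M, TangentSpace (𝓡 n) x → Der n N} {x : M} (hx : x ∈ U) (hxV : x ∈ V)
    (hA : ∀ v, IsPullbackOmega σ x v (A x v)) (v : Fin (k + 1) → TangentSpace (𝓡 n) x)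
    (I : Fin n →₀ ℕ) (i j : Fin N) :
    coeffEntry I i j ((EndJet.nabRough hE α x v).1 (σ x)) =
      extD (coeffForm α σ I i j) x v + coeffEntry I i j (wedge A α σ x v) := by
  -- Both sides are compared with `∑ dβ_r ⊗ J(γ_r)`. Order `|I| + 2` is needed, since one order is
  -- lost and the coefficient at `I` must remain visible.
  obtain ⟨W, hW, hxW, ι, _, β, γ, hd⟩ := h x hx (I.degree + 1 + 1)
  rw [hd.extD_add_wedge hW hV hσ hxW hxV (fun v γ I i j => (hA v).apply_jet hE hV hσ hxV γ I i j)
    (Nat.lt_succ_self _), coeffEntry_eq_of_sub_mem ((hd.nabRough (hE := hE) hW).approx x hxW v (σ x))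
    (Nat.lt_succ_self _), coeffEntry_sum_smul]
  rfl

theorem LocDecomp.nabRough (h : LocDecomp α U) : LocDecomp (nabRough hE α) U := by
  intro x hx d
  obtain ⟨W, hW, hxW, ι, hι, β, γ, hd⟩ := h x hx (d + 1)
  exact ⟨W, hW, hxW, ι, hι, _, γ, hd.nabRough hW⟩

/-- Up to arbitrarily high order `∇²` maps `∑ β_r ⊗ J(γ_r)` to `∑ ddβ_r ⊗ J(γ_r) = 0`. Two orders of
precision are lost, one for each application. -/
theorem LocDecomp.nabRough_nabRough (h : LocDecomp α U) {x : M} (hx : x ∈ U) :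
    EndJet.nabRough hE (EndJet.nabRough hE α) x = 0 := by
  ext v : 1
  refine Subtype.ext (funext fun Φ => eq_zero_of_forall_mem_adicSub fun d => ?_)
  obtain ⟨W, hW, hxW, ι, hι, β, γ, hd⟩ := h x hx (d + 1 + 1)
  have h1 := ((hd.nabRough (hE := hE) hW).nabRough (hE := hE) hW).approx x hxW v Φ
  have h2 : ∑ r, extD (extD (β r)) x v • Φ.toEquiv.symm (jet n N E x (γ r)) = 0 := by
    refine Finset.sum_eq_zero fun r _ => ?_
    rw [(hd.smooth r).extD_extD hW hxW]
    exact zero_smul _ _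
  rw [h2, sub_zero] at h1
  exact h1

theorem LocDecomp.smoothFormOn (h : LocDecomp α U) {V : Set M} (hV : IsOpen V)
    {σ : ∀ x : M, Frame n N E x} (hσ : SmoothFrameOn n N E σ V) (I : Fin n →₀ ℕ) (i j : Fin N) :
    SmoothFormOn (coeffForm α σ I i j) (U ∩ V) := by
  refine smoothFormOn_of_locally fun x hx => ?_
  obtain ⟨W, hW, hxW, ι, hι, β, γ, hd⟩ := h x hx.1 (I.degree + 1)
  exact ⟨W ∩ V, hW.inter hV, ⟨hxW, hx.2⟩, hd.smoothFormOn hσ (Nat.lt_succ_self _) i j⟩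

theorem LocDecomp.mem_omega (h : LocDecomp α Set.univ) : α ∈ Omega n N E k := by
  intro V σ hV hσ I i j
  simpa using h.smoothFormOn hV hσ I i j

end JetForms

/-! ### Existence of approximations by jets of sections -/

section TaylorComb

variable {n N : ℕ}

/-- A constant series is a combination of Taylor series with smooth coefficients. -/
theorem exists_taylor_comb (J : Fin n →₀ ℕ) (a b : Fin N) :
    ∃ (ι : Type) (_ : Fintype ι) (c : ι → Eucl n → ℂ) (g : ι → Eucl n → Mat N),
      (∀ r, ContDiff ℝ ∞ (c r)) ∧ (∀ r i j, ContDiff ℝ ∞ fun y => g r y i j) ∧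
      ∀ y, ∑ r, c r y • taylor (g r) y = unitMonomial J a b := by
  classical
  induction hm : J.degree generalizing J with
  | zero =>
    obtain rfl := (Finsupp.degree_eq_zero_iff J).1 hm
    refine ⟨Unit, inferInstance, fun _ _ => 1, fun _ _ => Matrix.single a b 1,
      fun _ => contDiff_const, fun _ _ _ => contDiff_const, fun y => ?_⟩
    rw [Fintype.sum_unique, one_smul, taylor_const, constMat_single]
  | succ m ih =>
    obtain ⟨s, hs⟩ : ∃ s, J s ≠ 0 := by
      by_contra! h0
      rw [(Finsupp.ext h0 : J = 0), map_zero] at hm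
      exact absurd hm (Nat.succ_ne_zero m).symm
    obtain ⟨J, rfl⟩ : ∃ J', J = J' + Finsupp.single s 1 :=
      ⟨J - Finsupp.single s 1, (tsub_add_cancel_of_le
        (Finsupp.single_le_iff.2 (Nat.one_le_iff_ne_zero.2 hs))).symm⟩
    rw [map_add, Finsupp.degree_single] at hm
    obtain ⟨ι, _, c, g, hc, hg, h⟩ := ih J (Nat.succ_injective hm)
    -- The Taylor series of `u` at `y` is `y_s + x̂_s`, so `x̂_s T(g) = T(u g) - y_s T(g)`. Each
    -- term of the combination gives two terms, whence the index type `ι ⊕ ι`.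
    let u : Eucl n → Mat N := fun z => ((z s - (0 : Eucl n) s : ℝ) : ℂ) • (1 : Mat N)
    have hu : ∀ i j, ContDiff ℝ ∞ fun y => u y i j := contDiff_coordMat 0 s
    refine ⟨ι ⊕ ι, inferInstance, Sum.elim c fun r y => -((y s : ℝ) : ℂ) * c r y,
      Sum.elim (fun r y => u y * g r y) g, ?_, ?_, fun y => ?_⟩
    · rintro (r | r)
      · exact hc r
      · have h1 : ContDiff ℝ ∞ fun y : Eucl n => y s := by fun_prop
        exact (Complex.ofRealCLM.contDiff.comp h1).neg.mul (hc r)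
    · rintro (r | r) i j
      · change ContDiff ℝ ∞ fun y => ∑ l, u y i l * g r y l j
        exact ContDiff.sum fun l _ => (hu i l).mul (hg r l j)
      · exact hg r i j
    · rw [Fintype.sum_sum_type, ← Finset.sum_add_distrib, unitMonomial_add_single, ← h y,
        Finset.mul_sum]
      refine Finset.sum_congr rfl fun r _ => ?_
      simp only [Sum.elim_inl, Sum.elim_inr]
      rw [taylor_mul isOpen_univ (fun i j => (hu i j).contDiffOn)
        (fun i j => (hg r i j).contDiffOn) (Set.mem_univ y), taylor_coord, add_mul,
        Algebra.algebraMap_eq_smul_one, smul_mul_assoc, one_mul, mul_smul_comm, smul_add,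
        smul_smul, PiLp.zero_apply, sub_zero, add_right_comm, ← add_smul, neg_mul,
        mul_comm (c r y), add_neg_cancel, zero_smul, zero_add]

end TaylorComb

section Existence

variable {n N : ℕ} {M : Type*} [TopologicalSpace M] [ChartedSpace (Eucl n) M]
  {E : M → Type*} [∀ x, AddCommGroup (E x)] [∀ x, Module ℂ (E x)]
  [∀ x, TopologicalSpace (E x)] [TopologicalSpace (TotalSpace (Fib N) E)]
  [FiberBundle (Fib N) E] [VectorBundle ℂ (Fib N) E]
  [∀ x, IsTopologicalAddGroup (E x)] [∀ x, ContinuousSMul ℂ (E x)]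
  [IsManifold (𝓡 n) ∞ M] [T2Space M] {hE : IsSmoothBundle n N E}
  {k : ℕ} {α : RoughForm n (fun x => JE n N E x) k} {U : Set M}

/-- Truncating in the standard frame leaves finitely many unit monomials with scalar forms as
coefficients. By `exists_taylor_comb` each unit monomial is a combination, with smooth coefficients,
of Taylor series of matrix functions, and near the given point these are the Taylor series of global
sections. -/
theorem locDecomp_of_std {x₀ : M} (hU : IsOpen U)
    (hUx : U ⊆ (stdTriv n N E hE x₀).chart.source)
    (h : ∀ I i j, SmoothFormOn (coeffForm α (stdFrame n N E hE x₀) I i j) U) :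
    LocDecomp α U := by
  intro x hx d
  set Ψ := stdTriv n N E hE x₀ with hΨ
  set σ := stdFrame n N E hE x₀ with hσ
  let K : Type := {J // J ∈ degLT n d} × Fin N × Fin N
  choose ι hι c g hc hg hcg using fun q : K => exists_taylor_comb (q.1 : Fin n →₀ ℕ) q.2.1 q.2.2
  let P : Type := Σ q : K, ι q
  choose γ hγ _ using fun p : P => exists_sec_pull (hE := hE) x₀ (hUx hx) (hg p.1 p.2)
  -- Equality of germs at `x` persists at all nearby points, so the jets are known on a
  -- neighbourhood.
  have hev : ∀ᶠ z in 𝓝 x, ∀ p : P, Ψ.pull (γ p) =ᶠ[𝓝 (Ψ.chart z)] g p.1 p.2 :=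
    Filter.eventually_all.2 fun p =>
      (Ψ.chart.continuousAt (hUx hx)).eventually (hγ p).eventuallyEq_nhds
  obtain ⟨W, hW, hWo, hxW⟩ := mem_nhds_iff.1 hev
  let β : P → RoughForm n (fun _ : M => ℂ) k := fun p =>
    sumForm (ι := Unit) (fun _ z => c p.1 p.2 (Ψ.chart z))
      (fun _ => coeffForm α σ p.1.1 p.1.2.1 p.1.2.2)
  refine ⟨U ∩ W, hU.inter hWo, ⟨hx, hxW⟩, P, inferInstance, β, γ, fun p => ?_,
    fun z hz v Φ => ?_⟩
  · refine smoothFormOn_sumForm (fun _ => ?_) fun _ => (h _ _ _).mono Set.inter_subset_left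
    exact (hc p.1 p.2).contMDiff.comp_contMDiffOn
      ((contMDiffOn_of_mem_maximalAtlas Ψ.chart_mem).mono fun z hz => hUx hz.1)
  · have h1 : ((α z v - ∑ p, β p z v • jetJE (γ p) z : JE n N E z)).1 (σ z) ∈ adicSub n N d := by
      have h2 : ((α z v - ∑ p, β p z v • jetJE (γ p) z : JE n N E z)).1 (σ z) =
          (α z v).1 (σ z) - truncMat d ((α z v).1 (σ z)) := by
        rw [AddSubgroupClass.coe_sub, Pi.sub_apply, JE.sum_apply]
        congr 1
        have h3 : ∀ p : P, (β p z v • jetJE (γ p) z : JE n N E z).1 (σ z) =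
            coeffEntry (p.1.1 : Fin n →₀ ℕ) p.1.2.1 p.1.2.2 ((α z v).1 (σ z)) •
              (c p.1 p.2 (Ψ.chart z) • taylor (g p.1 p.2) (Ψ.chart z)) := by
          intro p
          rw [JE.smul_apply, sumForm_apply, Fintype.sum_unique, coeffForm_apply, smul_smul,
            mul_comm]
          congr 1
          exact (stdFrame_symm_jet (hUx hz.1) (γ p)).trans (taylor_congr (hW hz.2 p))
        simp_rw [h3]
        rw [Fintype.sum_sigma]
        simp_rw [← Finset.smul_sum, hcg]
        rw [Fintype.sum_prod_type, truncMat, ← Finset.sum_coe_sort (degLT n d)]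
        refine Finset.sum_congr rfl fun J _ => ?_
        rw [Fintype.sum_prod_type]
        rfl
      rw [h2]
      exact sub_truncMat_mem _ _
    have h4 := JE.mem_adicSub_of_frame h1 Φ
    rw [AddSubgroupClass.coe_sub, Pi.sub_apply, JE.sum_apply] at h4
    exact h4

theorem locDecomp_of_mem_omega (hE : IsSmoothBundle n N E) (h : α ∈ Omega n N E k) :
    LocDecomp α Set.univ := by
  intro x _ d
  obtain ⟨V, h1⟩ := locDecomp_of_std (hE := hE) (x₀ := x) (stdTriv n N E hE x).chart.open_source subset_rfl
    (fun I i j => h _ _ (stdTriv n N E hE x).chart.open_source (smoothFrameOn_stdFrame x) I i j)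
    x (self_mem_stdTriv_source x) d
  exact ⟨V, h1⟩

end Existence

/-! ### The formal Koszul complex -/

section Koszul

variable {n k : ℕ}

/-- `∑_s (I_s + 1) dx_s ⊗ η_{I + e_s}`. -/
def koszulMap (η : (Fin n →₀ ℕ) → (Eucl n) [⋀^Fin k]→L[ℝ] ℂ) (I : Fin n →₀ ℕ) :
    Eucl n →L[ℝ] (Eucl n) [⋀^Fin k]→L[ℝ] ℂ :=
  ∑ s, ((I s : ℝ) + 1) • (EuclideanSpace.proj s : Eucl n →L[ℝ] ℝ).smulRight
    (η (I + Finsupp.single s 1))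

/-- The Koszul differential `∑_s (I_s + 1) dx_s ∧ η_{I + e_s}`. -/
def koszul (η : (Fin n →₀ ℕ) → (Eucl n) [⋀^Fin k]→L[ℝ] ℂ) (I : Fin n →₀ ℕ) :
    (Eucl n) [⋀^Fin (k + 1)]→L[ℝ] ℂ :=
  ContinuousAlternatingMap.alternatizeUncurryFin (koszulMap η I)

theorem koszulMap_apply (η : (Fin n →₀ ℕ) → (Eucl n) [⋀^Fin k]→L[ℝ] ℂ) (I : Fin n →₀ ℕ)
    (w : Eucl n) (v : Fin k → Eucl n) : koszulMap η I w v =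
      ∑ s, (w s : ℂ) * (((I s : ℂ) + 1) * η (I + Finsupp.single s 1) v) := by
  let ev : ((Eucl n) [⋀^Fin k]→L[ℝ] ℂ) →+ ℂ :=
    { toFun := fun g => g v, map_zero' := rfl, map_add' := fun _ _ => rfl }
  rw [koszulMap, ContinuousLinearMap.sum_apply]
  refine (map_sum ev _ _).trans (Finset.sum_congr rfl fun s _ => ?_)
  change ((I s : ℝ) + 1) • (w s • η (I + Finsupp.single s 1) v) = _
  rw [Complex.real_smul, Complex.real_smul]
  push_cast
  ring

theorem koszul_apply (η : (Fin n →₀ ℕ) → (Eucl n) [⋀^Fin k]→L[ℝ] ℂ) (I : Fin n →₀ ℕ)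
    (v : Fin (k + 1) → Eucl n) : koszul η I v = ∑ a : Fin (k + 1), (-1 : ℂ) ^ (a : ℕ) *
      ∑ s, (v a s : ℂ) * (((I s : ℂ) + 1) * η (I + Finsupp.single s 1) (a.removeNth v)) := by
  rw [koszul, ContinuousAlternatingMap.alternatizeUncurryFin_apply]
  refine Finset.sum_congr rfl fun a _ => ?_
  rw [koszulMap_apply, zsmul_eq_mul]
  push_cast
  rfl

theorem koszul_congr {η η' : (Fin n →₀ ℕ) → (Eucl n) [⋀^Fin k]→L[ℝ] ℂ} {I : Fin n →₀ ℕ}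
    (h : ∀ s, η (I + Finsupp.single s 1) = η' (I + Finsupp.single s 1)) :
    koszul η I = koszul η' I := by
  ext v
  simp_rw [koszul_apply, h]

theorem koszul_sub (η η' : (Fin n →₀ ℕ) → (Eucl n) [⋀^Fin k]→L[ℝ] ℂ) (I : Fin n →₀ ℕ) :
    koszul (fun J => η J - η' J) I = koszul η I - koszul η' I := by
  ext v
  rw [ContinuousAlternatingMap.sub_apply, koszul_apply, koszul_apply, koszul_apply,
    ← Finset.sum_sub_distrib]
  refine Finset.sum_congr rfl fun a _ => ?_
  rw [← mul_sub, ← Finset.sum_sub_distrib]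
  refine congrArg _ (Finset.sum_congr rfl fun s _ => ?_)
  rw [ContinuousAlternatingMap.sub_apply]
  ring

theorem koszul_smul (c : ℝ) (η : (Fin n →₀ ℕ) → (Eucl n) [⋀^Fin k]→L[ℝ] ℂ) (I : Fin n →₀ ℕ) :
    koszul (fun J => c • η J) I = c • koszul η I := by
  ext v
  rw [ContinuousAlternatingMap.smul_apply, koszul_apply, koszul_apply, Finset.smul_sum]
  refine Finset.sum_congr rfl fun a _ => ?_
  rw [Complex.real_smul, mul_left_comm, Finset.mul_sum Finset.univ _ (c : ℂ)]
  congr 1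
  refine Finset.sum_congr rfl fun s _ => ?_
  rw [ContinuousAlternatingMap.smul_apply, Complex.real_smul]
  ring

/-- The contracting homotopy of the Koszul complex, up to scalars:
`∑_s ι(e_s) η_{J - e_s}`. -/
def koszulHom (η : (Fin n →₀ ℕ) → (Eucl n) [⋀^Fin (k + 1)]→L[ℝ] ℂ) (J : Fin n →₀ ℕ) :
    (Eucl n) [⋀^Fin k]→L[ℝ] ℂ :=
  ∑ s, if J s = 0 then 0 else
    (η (J - Finsupp.single s 1)).curryLeft (EuclideanSpace.single s (1 : ℝ))

theorem koszulHom_apply (η : (Fin n →₀ ℕ) → (Eucl n) [⋀^Fin (k + 1)]→L[ℝ] ℂ) (J : Fin n →₀ ℕ)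
    (v : Fin k → Eucl n) : koszulHom η J v = ∑ s, if J s = 0 then 0 else
      η (J - Finsupp.single s 1) (Fin.cons (EuclideanSpace.single s (1 : ℝ)) v) := by
  let ev : ((Eucl n) [⋀^Fin k]→L[ℝ] ℂ) →+ ℂ :=
    { toFun := fun g => g v, map_zero' := rfl, map_add' := fun _ _ => rfl }
  refine (map_sum ev _ _).trans (Finset.sum_congr rfl fun s _ => ?_)
  split_ifs <;> rfl

theorem form_cons_eq_sum (f : (Eucl n) [⋀^Fin (k + 1)]→L[ℝ] ℂ) (w : Eucl n)
    (u : Fin k → Eucl n) :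
    f (Fin.cons w u) = ∑ s, (w s : ℂ) * f (Fin.cons (EuclideanSpace.single s (1 : ℝ)) u) := by
  have hw : w = ∑ s, w s • EuclideanSpace.single s (1 : ℝ) := by
    ext t
    simp [Finset.sum_apply, Pi.single_apply]
  let L : Eucl n →ₗ[ℝ] ℂ :=
    { toFun := fun w => f.curryLeft w u
      map_add' := fun a b => by rw [map_add]; rfl
      map_smul' := fun c a => by rw [map_smul]; rfl }
  have h1 := congrArg L hw
  rw [map_sum] at h1
  refine Eq.trans h1 (Finset.sum_congr rfl fun s _ => ?_)
  rw [map_smul, Complex.real_smul]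
  rfl

/-- With `dx_s` read as `dx̂_s`, `koszul` is the de Rham differential in the formal variables and
`koszulHom` is contraction with the Euler field `∑ x̂_s ∂/∂x̂_s`. Cartan's formula makes their
anticommutator the Lie derivative along that field, which multiplies by polynomial degree plus form
degree. The hypothesis kills the other term of the anticommutator at `I`. -/
theorem koszul_koszulHom {η : (Fin n →₀ ℕ) → (Eucl n) [⋀^Fin (k + 1)]→L[ℝ] ℂ}
    {I : Fin n →₀ ℕ} (h : ∀ L t, I = L + Finsupp.single t 1 → koszul η L = 0) :
    koszul (koszulHom η) I = ((I.degree : ℝ) + (k + 1)) • η I := by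
  classical
  ext v
  -- the closedness relations, contracted with the basis vectors
  have h1 : ∀ t, ((I t : ℕ) : ℂ) * η I v = ∑ a : Fin (k + 1), (-1 : ℂ) ^ (a : ℕ) *
      ∑ s, (v a s : ℂ) * (if I t = 0 then 0 else
        (((I - Finsupp.single t 1 : Fin n →₀ ℕ) s : ℂ) + 1) *
          η (I - Finsupp.single t 1 + Finsupp.single s 1)
            (Fin.cons (EuclideanSpace.single t (1 : ℝ)) (a.removeNth v))) := by
    intro t
    by_cases ht : I t = 0
    · simp [ht]
    · have hIt : I - Finsupp.single t 1 + Finsupp.single t 1 = I := tsub_add_cancel_of_le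
        (Finsupp.single_le_iff.2 (Nat.one_le_iff_ne_zero.2 ht))
      let w : Fin (k + 2) → Eucl n := Fin.cons (EuclideanSpace.single t (1 : ℝ)) v
      have h2 : koszul η (I - Finsupp.single t 1) w = 0 := by
        rw [h (I - Finsupp.single t 1) t hIt.symm]
        rfl
      rw [koszul_apply, Fin.sum_univ_succ] at h2
      have h3 : ∑ s, (w 0 s : ℂ) * ((((I - Finsupp.single t 1 : Fin n →₀ ℕ) s : ℂ) + 1) *
            η (I - Finsupp.single t 1 + Finsupp.single s 1) ((0 : Fin (k + 2)).removeNth w)) =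
          ((I t : ℕ) : ℂ) * η I v := by
        have hw : ∀ s, w 0 s = if s = t then 1 else 0 := fun s => by
          change EuclideanSpace.single t (1 : ℝ) s = _
          simp
        rw [Finset.sum_eq_single t]
        · have h4 : ((I - Finsupp.single t 1 : Fin n →₀ ℕ) t : ℂ) + 1 = ((I t : ℕ) : ℂ) := by
            have := DFunLike.congr_fun hIt t
            rw [Finsupp.add_apply, Finsupp.single_eq_same] at this
            exact_mod_cast this
          rw [h4, hIt, hw, if_pos rfl, Complex.ofReal_one, one_mul]
          rfl
        · intro s _ hs
          rw [hw, if_neg hs, Complex.ofReal_zero, zero_mul]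
        · simp
      rw [h3, Fin.val_zero, pow_zero, one_mul] at h2
      rw [eq_neg_of_add_eq_zero_left h2, ← Finset.sum_neg_distrib]
      refine Finset.sum_congr rfl fun a _ => ?_
      rw [Fin.val_succ, pow_succ, mul_neg_one, neg_mul, neg_neg]
      refine congrArg _ (Finset.sum_congr rfl fun s _ => ?_)
      have hrm : a.succ.removeNth w =
          Fin.cons (EuclideanSpace.single t (1 : ℝ)) (a.removeNth v) := by
        funext b
        refine Fin.cases ?_ (fun b => ?_) b
        · change w (a.succ.succAbove 0) = _
          rw [Fin.succ_succAbove_zero]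
          rfl
        · change w (a.succ.succAbove b.succ) = _
          rw [Fin.succ_succAbove_succ]
          rfl
      rw [if_neg ht, hrm]
      rfl
  -- Summing the contracted relations over `t` produces the polynomial degree `|I| = ∑ I_t`.
  have h5 : ((I.degree : ℕ) : ℂ) * η I v = ∑ a : Fin (k + 1), (-1 : ℂ) ^ (a : ℕ) *
      ∑ s, (v a s : ℂ) * ∑ t, (if I t = 0 then 0 else
        (((I - Finsupp.single t 1 : Fin n →₀ ℕ) s : ℂ) + 1) *
          η (I - Finsupp.single t 1 + Finsupp.single s 1)
            (Fin.cons (EuclideanSpace.single t (1 : ℝ)) (a.removeNth v))) := by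
    rw [Finsupp.degree_eq_sum, Nat.cast_sum, Finset.sum_mul]
    simp_rw [h1, Finset.mul_sum]
    rw [Finset.sum_comm]
    refine Finset.sum_congr rfl fun a _ => ?_
    rw [Finset.sum_comm]
  -- The form degree: each of the `k + 1` arguments, moved to the front with its sign, gives the
  -- value `η I v` back.
  have h6 : ∑ a : Fin (k + 1), (-1 : ℂ) ^ (a : ℕ) * ∑ s, (v a s : ℂ) *
      η I (Fin.cons (EuclideanSpace.single s (1 : ℝ)) (a.removeNth v)) = ((k : ℂ) + 1) * η I v := by
    have h7 := congrArg (fun f => f v)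
      (ContinuousAlternatingMap.alternatizeUncurryFin_curryLeft (η I))
    simp only [ContinuousAlternatingMap.alternatizeUncurryFin_apply] at h7
    refine Eq.trans ?_ (h7.trans ?_)
    · refine Finset.sum_congr rfl fun a _ => ?_
      rw [← form_cons_eq_sum, zsmul_eq_mul]
      push_cast
      rfl
    · rw [ContinuousAlternatingMap.smul_apply, nsmul_eq_mul]
      push_cast
      rfl
  rw [ContinuousAlternatingMap.smul_apply, Complex.real_smul]
  push_cast
  rw [add_mul, h5, ← h6, koszul_apply, ← Finset.sum_add_distrib]
  refine Finset.sum_congr rfl fun a _ => ?_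
  rw [← mul_add, ← Finset.sum_add_distrib]
  refine congrArg _ (Finset.sum_congr rfl fun s _ => ?_)
  rw [← mul_add, koszulHom_apply, Finset.mul_sum]
  refine congrArg _ ?_
  have h8 : η I (Fin.cons (EuclideanSpace.single s (1 : ℝ)) (a.removeNth v)) =
      ∑ t, if t = s then η I (Fin.cons (EuclideanSpace.single t (1 : ℝ)) (a.removeNth v))
        else 0 := by
    simp
  rw [h8, ← Finset.sum_add_distrib]
  refine Finset.sum_congr rfl fun t _ => ?_
  -- For `t ≠ s` the factors `I_s + 1` agree. For `t = s` they are `I_s + 1` and `I_s`, and the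
  -- difference is the term from `h6`.
  by_cases hts : t = s
  · subst hts
    have h9 : I + Finsupp.single t 1 - Finsupp.single t 1 = I := add_tsub_cancel_right _ _
    have h10 : (I + Finsupp.single t 1 : Fin n →₀ ℕ) t ≠ 0 := by simp
    rw [if_neg h10, h9, if_pos rfl]
    by_cases ht : I t = 0
    · simp [ht]
    · have hIt : I - Finsupp.single t 1 + Finsupp.single t 1 = I := tsub_add_cancel_of_le
        (Finsupp.single_le_iff.2 (Nat.one_le_iff_ne_zero.2 ht))
      have h4 : ((I - Finsupp.single t 1 : Fin n →₀ ℕ) t : ℂ) + 1 = ((I t : ℕ) : ℂ) := by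
        have := DFunLike.congr_fun hIt t
        rw [Finsupp.add_apply, Finsupp.single_eq_same] at this
        exact_mod_cast this
      rw [if_neg ht, h4, hIt]
      ring
  · rw [if_neg hts, add_zero]
    have h9 : (I + Finsupp.single s 1 : Fin n →₀ ℕ) t = I t := by
      simp [hts]
    rw [h9]
    by_cases ht : I t = 0
    · simp [ht]
    · have hle : Finsupp.single t 1 ≤ I := Finsupp.single_le_iff.2 (Nat.one_le_iff_ne_zero.2 ht)
      have h10 : (I - Finsupp.single t 1 : Fin n →₀ ℕ) s = I s := by
        simp [hts]
      rw [if_neg ht, if_neg ht, h10, tsub_add_eq_add_tsub hle]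

end Koszul

/-! ### Local solvability -/

section FormalPrimitive

variable {n k : ℕ}

/-- The derivative of `T (∑ c_s dx_s ⊗ f_s)` differs from `-∑ c_s dx_s ⊗ T (f_s')` by the
composition of `T` with a symmetric map. -/
theorem exists_hasFDerivAt_sum_smulRight {F F' : Type*} [NormedAddCommGroup F] [NormedSpace ℝ F]
    [NormedAddCommGroup F'] [NormedSpace ℝ F'] (T : (Eucl n →L[ℝ] F) →L[ℝ] F')
    {f : Fin n → Eucl n → F} {y : Eucl n} (c : Fin n → ℝ)
    (hf : ∀ s, DifferentiableAt ℝ (f s) y) :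
    ∃ L : Eucl n →L[ℝ] Eucl n →L[ℝ] F, (∀ u v, L u v = L v u) ∧
      fderiv ℝ (fun z => T (∑ s, c s • (EuclideanSpace.proj s : Eucl n →L[ℝ] ℝ).smulRight
        (f s z))) y +
        ∑ s, c s • (EuclideanSpace.proj s : Eucl n →L[ℝ] ℝ).smulRight (T (fderiv ℝ (f s) y)) =
      T ∘L L := by
  have h : HasFDerivAt (fun z => ∑ s, c s •
      (EuclideanSpace.proj s : Eucl n →L[ℝ] ℝ).smulRight (f s z))
      (∑ s, c s • (ContinuousLinearMap.smulRightL ℝ (Eucl n) F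
        (EuclideanSpace.proj s)).comp (fderiv ℝ (f s) y)) y := by
    refine HasFDerivAt.fun_sum fun s _ => ?_
    exact ((c s • ContinuousLinearMap.smulRightL ℝ (Eucl n) F
      (EuclideanSpace.proj s)).hasFDerivAt.comp y (hf s).hasFDerivAt)
  refine ⟨∑ s, c s • (ContinuousLinearMap.smulRightL ℝ (Eucl n) F
    (EuclideanSpace.proj s)).comp (fderiv ℝ (f s) y) +
    ∑ s, c s • (EuclideanSpace.proj s : Eucl n →L[ℝ] ℝ).smulRight (fderiv ℝ (f s) y),
    fun u v => ?_, ?_⟩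
  · simp only [add_apply, sum_apply, smul_apply, ContinuousLinearMap.smulRight_apply,
      ContinuousLinearMap.comp_apply, ContinuousLinearMap.smulRightL_apply_apply]
    rw [← Finset.sum_add_distrib, ← Finset.sum_add_distrib]
    exact Finset.sum_congr rfl fun s _ => add_comm _ _
  · rw [ContinuousLinearMap.comp_add]
    refine congrArg₂ (· + ·) (T.hasFDerivAt.comp y h).fderiv ?_
    refine ContinuousLinearMap.ext fun w => ?_
    simp only [sum_apply, smul_apply, ContinuousLinearMap.smulRight_apply,
      ContinuousLinearMap.comp_apply, map_sum, map_smul]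

theorem extDeriv_sub {η θ : Eucl n → (Eucl n) [⋀^Fin k]→L[ℝ] ℂ} {y : Eucl n}
    (h₁ : DifferentiableAt ℝ η y) (h₂ : DifferentiableAt ℝ θ y) :
    extDeriv (η - θ) y = extDeriv η y - extDeriv θ y := by
  rw [extDeriv, fderiv_sub h₁ h₂]
  exact (ContinuousAlternatingMap.alternatizeUncurryFinCLM (n := k) ℝ (Eucl n) ℂ).map_sub _ _

/-- The exterior derivative anticommutes with the Koszul differential. -/
theorem extDeriv_koszul {f : (Fin n →₀ ℕ) → Eucl n → (Eucl n) [⋀^Fin k]→L[ℝ] ℂ} {y : Eucl n}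
    (hf : ∀ J, DifferentiableAt ℝ (f J) y) (I : Fin n →₀ ℕ) :
    extDeriv (fun z => koszul (fun J => f J z) I) y =
      -koszul (fun J => extDeriv (f J) y) I := by
  -- The sum of the two compositions is the double alternatization of a map symmetric in its first
  -- two arguments, hence zero.
  obtain ⟨L, h1, h2⟩ := exists_hasFDerivAt_sum_smulRight
    (ContinuousAlternatingMap.alternatizeUncurryFinCLM (n := k) ℝ (Eucl n) ℂ)
    (fun s => (I s : ℝ) + 1) (fun s => hf (I + Finsupp.single s 1))
  have h3 := congrArg ContinuousAlternatingMap.alternatizeUncurryFin h2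
  rw [ContinuousAlternatingMap.alternatizeUncurryFin_alternatizeUncurryFinCLM_comp_of_symmetric h1,
    ContinuousAlternatingMap.alternatizeUncurryFin_add] at h3
  exact eq_neg_of_add_eq_zero_left h3

theorem contDiffOn_koszulHom {η : (Fin n →₀ ℕ) → Eucl n → (Eucl n) [⋀^Fin (k + 1)]→L[ℝ] ℂ}
    {B : Set (Eucl n)} (hη : ∀ J, ContDiffOn ℝ ∞ (η J) B) (J : Fin n →₀ ℕ) :
    ContDiffOn ℝ ∞ (fun y => koszulHom (fun I => η I y) J) B := by
  refine contDiffOn_form fun v => ?_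
  simp_rw [koszulHom_apply]
  refine ContDiffOn.sum fun s _ => ?_
  split_ifs
  · exact contDiffOn_const
  · exact ContDiffOn.form_apply (hη _) fun a => contDiffOn_const

/-- The homogeneous components of a primitive of `α`. -/
def primitive (α : (Fin n →₀ ℕ) → Eucl n → (Eucl n) [⋀^Fin (k + 1)]→L[ℝ] ℂ) :
    ℕ → (Fin n →₀ ℕ) → Eucl n → (Eucl n) [⋀^Fin k]→L[ℝ] ℂ
  | 0 => fun _ _ => 0
  -- The component of degree `m + 1` is to solve `K β_{m+1} = dβ_m - α_m`. The homotopy does so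
  -- after division by the eigenvalue `m + (k + 1)`. Only the values at `J` with `|J| = m + 1` enter
  -- the final primitive.
  | m + 1 => fun J y => ((m : ℝ) + (k + 1))⁻¹ •
      koszulHom (fun I => extDeriv (primitive α m I) y - α I y) J

theorem contDiffOn_primitive {B : Set (Eucl n)} (hB : IsOpen B)
    {α : (Fin n →₀ ℕ) → Eucl n → (Eucl n) [⋀^Fin (k + 1)]→L[ℝ] ℂ}
    (hα : ∀ J, ContDiffOn ℝ ∞ (α J) B) (m : ℕ) (J : Fin n →₀ ℕ) :
    ContDiffOn ℝ ∞ (primitive α m J) B := by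
  induction m generalizing J with
  | zero => exact contDiffOn_const
  | succ m ih =>
    refine ContDiffOn.const_smul _ (contDiffOn_koszulHom
      (η := fun I y => extDeriv (primitive α m I) y - α I y) (fun I => ?_) J)
    exact (ContDiffOn.extDeriv hB (ih I)).sub (hα I)

/-- By `koszul_koszulHom` it suffices that `dβ_m - α_m` is `K`-closed. Inductively `K dβ_m = -d K
β_m = -d(dβ_{m-1} - α_{m-1}) = dα_{m-1}`, and this is `K α_m` by closedness of `α`. In degree `0`
there is nothing to check. -/
theorem koszul_primitive {B : Set (Eucl n)} (hB : IsOpen B)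
    {α : (Fin n →₀ ℕ) → Eucl n → (Eucl n) [⋀^Fin (k + 1)]→L[ℝ] ℂ}
    (hα : ∀ J, ContDiffOn ℝ ∞ (α J) B)
    (hclosed : ∀ J, ∀ y ∈ B, extDeriv (α J) y = koszul (fun L => α L y) J) (m : ℕ) :
    ∀ I : Fin n →₀ ℕ, I.degree = m → ∀ y ∈ B, koszul (fun J => primitive α (m + 1) J y) I =
      extDeriv (primitive α m I) y - α I y := by
  induction m with
  | zero =>
    intro I hI y hy
    obtain rfl := (Finsupp.degree_eq_zero_iff I).1 hI
    change koszul (fun J => _ • koszulHom _ J) 0 = _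
    rw [koszul_smul, koszul_koszulHom, hI, smul_smul, Nat.cast_zero, inv_mul_cancel₀ (by positivity),
      one_smul]
    intro L t h
    have := DFunLike.congr_fun h t
    simp at this
  | succ m ih =>
    intro I hI y hy
    change koszul (fun J => _ • koszulHom _ J) I = _
    rw [koszul_smul, koszul_koszulHom, hI, smul_smul, inv_mul_cancel₀ (by positivity), one_smul]
    rintro L t rfl
    have hL : L.degree = m := by
      rw [map_add, Finsupp.degree_single] at hI
      exact Nat.succ_injective hI
    have hd : ∀ J, DifferentiableAt ℝ (primitive α (m + 1) J) y := fun J =>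
      ((contDiffOn_primitive hB hα (m + 1) J).contDiffAt (hB.mem_nhds hy)).differentiableAt
        (by simp)
    have h1 : (fun z => koszul (fun J => primitive α (m + 1) J z) L) =ᶠ[𝓝 y]
        (extDeriv (primitive α m L) - α L) := by
      filter_upwards [hB.mem_nhds hy] with z hz
      rw [ih L hL z hz, Pi.sub_apply]
    have h2 := extDeriv_koszul hd L
    have hd1 : DifferentiableAt ℝ (extDeriv (primitive α m L)) y :=
      ((ContDiffOn.extDeriv hB (contDiffOn_primitive hB hα m L)).contDiffAt
        (hB.mem_nhds hy)).differentiableAt (by simp)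
    have hd2 : DifferentiableAt ℝ (α L) y :=
      ((hα L).contDiffAt (hB.mem_nhds hy)).differentiableAt (by simp)
    rw [h1.extDeriv_eq, extDeriv_sub hd1 hd2,
      extDeriv_extDeriv_apply ((contDiffOn_primitive hB hα m L).contDiffAt (hB.mem_nhds hy)) (by
        rw [minSmoothness_of_isRCLikeNormedField]
        exact WithTop.coe_le_coe.2 (le_top : (2 : ℕ∞) ≤ ⊤)), zero_sub, neg_inj,
       hclosed L y hy] at h2
    rw [koszul_sub, ← h2, sub_self]

/-- Closed formal forms of positive degree have primitives. -/
theorem exists_primitive {B : Set (Eucl n)} (hB : IsOpen B)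
    {α : (Fin n →₀ ℕ) → Eucl n → (Eucl n) [⋀^Fin (k + 1)]→L[ℝ] ℂ}
    (hα : ∀ J, ContDiffOn ℝ ∞ (α J) B)
    (hclosed : ∀ J, ∀ y ∈ B, extDeriv (α J) y = koszul (fun L => α L y) J) :
    ∃ β : (Fin n →₀ ℕ) → Eucl n → (Eucl n) [⋀^Fin k]→L[ℝ] ℂ,
      (∀ J, ContDiffOn ℝ ∞ (β J) B) ∧
        ∀ J, ∀ y ∈ B, extDeriv (β J) y - koszul (fun L => β L y) J = α J y := by
  refine ⟨fun J => primitive α J.degree J, fun J => contDiffOn_primitive hB hα _ J,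
    fun J y hy => ?_⟩
  have h1 : koszul (fun L => primitive α L.degree L y) J =
      koszul (fun L => primitive α (J.degree + 1) L y) J :=
    koszul_congr fun s => by rw [map_add, Finsupp.degree_single]
  rw [h1, koszul_primitive hB hα hclosed J.degree J rfl y hy, sub_sub_cancel]

end FormalPrimitive

/-! ### Operations on approximable forms -/

section Operations

variable {n N : ℕ} {M : Type*} [TopologicalSpace M] [ChartedSpace (Eucl n) M]
  {E : M → Type*} [∀ x, AddCommGroup (E x)] [∀ x, Module ℂ (E x)]
  [∀ x, TopologicalSpace (E x)] [TopologicalSpace (TotalSpace (Fib N) E)]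
  [FiberBundle (Fib N) E] [VectorBundle ℂ (Fib N) E]
  [∀ x, IsTopologicalAddGroup (E x)] [∀ x, ContinuousSMul ℂ (E x)] [IsManifold (𝓡 n) ∞ M]
  {k d : ℕ} {α α' : RoughForm n (fun x => JE n N E x) k} {U U' : Set M}
  {ι ι' : Type} [Fintype ι] [Fintype ι']
  {β : ι → RoughForm n (fun _ : M => ℂ) k} {γ : ι → Sec n N E}
  {β' : ι' → RoughForm n (fun _ : M => ℂ) k} {γ' : ι' → Sec n N E}

/-- The product of the jets of a section with a form. -/
def mulForm (g : Sec n N E) (α : RoughForm n (fun x => JE n N E x) k) :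
    RoughForm n (fun x => JE n N E x) k := fun x =>
  ((LinearMap.mulLeft ℂ (jetJE g x)).restrictScalars ℝ).compAlternatingMap (α x)

/-- The jets of sections in a frame. -/
def Frame.jetHom {x : M} (Φ : Frame n N E x) : Sec n N E →ₐ[ℂ] MatPS n N :=
  Φ.toEquiv.symm.toAlgHom.comp (jet n N E x)

theorem mulForm_apply (g : Sec n N E) (α : RoughForm n (fun x => JE n N E x) k) (x : M)
    (v : Fin k → TangentSpace (𝓡 n) x) : mulForm g α x v = jetJE g x * α x v := rfl

theorem IsDecomp.mono (h : IsDecomp α d U β γ) (hU : U' ⊆ U) : IsDecomp α d U' β γ :=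
  ⟨fun r => (h.smooth r).mono hU, fun x hx => h.approx x (hU hx)⟩

theorem IsDecomp.congr (h : IsDecomp α d U β γ) (h' : ∀ x ∈ U, α' x = α x) :
    IsDecomp α' d U β γ :=
  ⟨h.smooth, fun x hx => by rw [h' x hx]; exact h.approx x hx⟩

theorem IsDecomp.add (h : IsDecomp α d U β γ) (h' : IsDecomp α' d U β' γ') :
    IsDecomp (α + α') d U (Sum.elim β β') (Sum.elim γ γ') := by
  refine ⟨?_, fun x hx v Φ => ?_⟩
  · rintro (r | r)
    · exact h.smooth r
    · exact h'.smooth r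
  · have h1 := add_mem (h.approx x hx v Φ) (h'.approx x hx v Φ)
    rw [Fintype.sum_sum_type]
    simp only [Sum.elim_inl, Sum.elim_inr]
    rwa [sub_add_sub_comm] at h1

theorem IsDecomp.mulForm (h : IsDecomp α d U β γ) (g : Sec n N E) :
    IsDecomp (mulForm g α) d U β (fun r => g * γ r) := by
  refine ⟨h.smooth, fun x hx v Φ => ?_⟩
  have h1 := mul_mem_adicSub_right (f := Φ.toEquiv.symm (jet n N E x g)) (h.approx x hx v Φ)
  rw [mul_sub, Finset.mul_sum] at h1
  refine (congrArg (_ - · ∈ adicSub n N d) (Finset.sum_congr rfl fun r _ => ?_)).mpr h1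
  rw [mul_smul_comm]
  exact congrArg _ (map_mul Φ.jetHom g (γ r))

theorem IsDecomp.smul (h : IsDecomp α d U β γ) (c : ℂ) :
    IsDecomp (c • α) d U β (fun r => c • γ r) := by
  refine ⟨h.smooth, fun x hx v Φ => ?_⟩
  have h1 := (adicSub n N d).smul_mem c (h.approx x hx v Φ)
  rw [smul_sub, Finset.smul_sum] at h1
  refine (congrArg (_ - · ∈ adicSub n N d) (Finset.sum_congr rfl fun r _ => ?_)).mpr h1
  rw [smul_comm]
  exact congrArg _ (map_smul Φ.jetHom c (γ r))

theorem isDecomp_zero : IsDecomp (0 : RoughForm n (fun x => JE n N E x) k) d U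
    (fun r : Empty => r.elim) (fun r => r.elim) := by
  refine ⟨fun r => r.elim, fun x hx v Φ => ?_⟩
  rw [Finset.univ_eq_empty, Finset.sum_empty, sub_zero]
  exact (adicSub n N d).zero_mem

theorem LocDecomp.mono (h : LocDecomp α U) (hU : U' ⊆ U) : LocDecomp α U' :=
  fun x hx d => h x (hU hx) d

theorem LocDecomp.of_locally
    (h : ∀ x ∈ U, ∃ V, IsOpen V ∧ x ∈ V ∧ ∃ α', LocDecomp α' V ∧ ∀ y ∈ V, α y = α' y) :
    LocDecomp α U := by
  intro x hx d
  obtain ⟨V, hV, hxV, α', hα', hαV⟩ := h x hx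
  obtain ⟨W, hW, hxW, ι, hι, β, γ, hd⟩ := hα' x hxV d
  exact ⟨W ∩ V, hW.inter hV, ⟨hxW, hxV⟩, ι, hι, β, γ,
    (hd.mono Set.inter_subset_left).congr fun y hy => hαV y hy.2⟩

theorem LocDecomp.add (h : LocDecomp α U) (h' : LocDecomp α' U) : LocDecomp (α + α') U := by
  intro x hx d
  obtain ⟨V, hV, hxV, ι, hι, β, γ, hd⟩ := h x hx d
  obtain ⟨V', hV', hxV', ι', hι', β', γ', hd'⟩ := h' x hx d
  exact ⟨V ∩ V', hV.inter hV', ⟨hxV, hxV'⟩, ι ⊕ ι', inferInstance, _, _,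
    (hd.mono Set.inter_subset_left).add (hd'.mono Set.inter_subset_right)⟩

theorem LocDecomp.mulForm (h : LocDecomp α U) (g : Sec n N E) : LocDecomp (mulForm g α) U := by
  intro x hx d
  obtain ⟨V, hV, hxV, ι, hι, β, γ, hd⟩ := h x hx d
  exact ⟨V, hV, hxV, ι, hι, _, _, hd.mulForm g⟩

theorem locDecomp_zero : LocDecomp (0 : RoughForm n (fun x => JE n N E x) k) U :=
  fun _ _ _ => ⟨Set.univ, isOpen_univ, Set.mem_univ _, Empty, inferInstance, _, _, isDecomp_zero⟩

theorem LocDecomp.sum {κ : Type*} {f : κ → RoughForm n (fun x => JE n N E x) k} {t : Finset κ}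
    (h : ∀ i ∈ t, LocDecomp (f i) U) : LocDecomp (∑ i ∈ t, f i) U :=
  Finset.sum_induction f (fun α => LocDecomp α U) (fun _ _ => LocDecomp.add) locDecomp_zero h

variable [T2Space M] {hE : IsSmoothBundle n N E}

/-- Forms with the same approximations by jets have the same image under the connection. -/
theorem nabRough_ext {x : M} {η : (TangentSpace (𝓡 n) x) [⋀^Fin (k + 1)]→ₗ[ℝ] JE n N E x}
    (h : ∀ d, ∃ V, IsOpen V ∧ x ∈ V ∧ ∃ (ι : Type) (_ : Fintype ι)
      (β : ι → RoughForm n (fun _ : M => ℂ) k) (γ : ι → Sec n N E), IsDecomp α (d + 1) V β γ ∧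
        ∀ v Φ, (η v).1 Φ - ∑ r, extD (β r) x v • Φ.toEquiv.symm (jet n N E x (γ r)) ∈
          adicSub n N d) :
    nabRough hE α x = η := by
  ext v : 1
  refine Subtype.ext (funext fun Φ => sub_eq_zero.1 (eq_zero_of_forall_mem_adicSub fun d => ?_))
  obtain ⟨V, hV, hxV, ι, hι, β, γ, hd, h2⟩ := h d
  have h1 := sub_mem ((hd.nabRough (hE := hE) hV).approx x hxV v Φ) (h2 v Φ)
  rwa [sub_sub_sub_cancel_right] at h1

theorem LocDecomp.nabRough_add (h : LocDecomp α U) (h' : LocDecomp α' U) {x : M} (hx : x ∈ U) :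
    EndJet.nabRough hE (α + α') x = EndJet.nabRough hE α x + EndJet.nabRough hE α' x := by
  refine nabRough_ext fun d => ?_
  obtain ⟨V, hV, hxV, ι, hι, β, γ, hd⟩ := h x hx (d + 1)
  obtain ⟨V', hV', hxV', ι', hι', β', γ', hd'⟩ := h' x hx (d + 1)
  refine ⟨V ∩ V', hV.inter hV', ⟨hxV, hxV'⟩, ι ⊕ ι', inferInstance, _, _,
    (hd.mono Set.inter_subset_left).add (hd'.mono Set.inter_subset_right), fun v Φ => ?_⟩
  have h1 := add_mem ((hd.nabRough (hE := hE) hV).approx x hxV v Φ)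
    ((hd'.nabRough (hE := hE) hV').approx x hxV' v Φ)
  rw [Fintype.sum_sum_type]
  simp only [Sum.elim_inl, Sum.elim_inr]
  rwa [sub_add_sub_comm] at h1

theorem LocDecomp.nabRough_smul (h : LocDecomp α U) (c : ℂ) {x : M} (hx : x ∈ U) :
    EndJet.nabRough hE (c • α) x = c • EndJet.nabRough hE α x := by
  refine nabRough_ext fun d => ?_
  obtain ⟨V, hV, hxV, ι, hι, β, γ, hd⟩ := h x hx (d + 1)
  exact ⟨V, hV, hxV, ι, hι, _, _, hd.smul c,
    fun v Φ => ((hd.nabRough (hE := hE) hV).smul c).approx x hxV v Φ⟩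

/-- Multiplication by the jet of `g` maps `β ⊗ J(γ)` to `β ⊗ J(g γ)` and leaves the scalar forms
alone. Linearity over jets, in place of a Leibniz rule, is what permits gluing without correction
terms. -/
theorem LocDecomp.nabRough_mulForm (h : LocDecomp α U) (g : Sec n N E) {x : M} (hx : x ∈ U) :
    EndJet.nabRough hE (EndJet.mulForm g α) x = EndJet.mulForm g (EndJet.nabRough hE α) x := by
  refine nabRough_ext fun d => ?_
  obtain ⟨V, hV, hxV, ι, hι, β, γ, hd⟩ := h x hx (d + 1)
  exact ⟨V, hV, hxV, ι, hι, _, _, hd.mulForm g,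
    fun v Φ => ((hd.nabRough (hE := hE) hV).mulForm g).approx x hxV v Φ⟩

theorem LocDecomp.nabRough_congr (h : LocDecomp α U) (hU : IsOpen U) (h' : ∀ y ∈ U, α' y = α y)
    {x : M} (hx : x ∈ U) : EndJet.nabRough hE α' x = EndJet.nabRough hE α x := by
  refine nabRough_ext fun d => ?_
  obtain ⟨V, hV, hxV, ι, hι, β, γ, hd⟩ := h x hx (d + 1)
  exact ⟨V ∩ U, hV.inter hU, ⟨hxV, hx⟩, ι, hι, _, _,
    (hd.mono Set.inter_subset_left).congr fun y hy => h' y hy.2,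
    fun v Φ => (hd.nabRough (hE := hE) hV).approx x hxV v Φ⟩

theorem nabRough_zero (x : M) :
    nabRough hE (0 : RoughForm n (fun x => JE n N E x) k) x = 0 :=
  nabRough_ext fun _ => ⟨Set.univ, isOpen_univ, Set.mem_univ _, Empty, inferInstance, _, _,
    isDecomp_zero, fun v Φ => by
      rw [Finset.univ_eq_empty, Finset.sum_empty, sub_zero]
      exact Submodule.zero_mem _⟩

theorem LocDecomp.nabRough_sum {κ : Type*} {f : κ → RoughForm n (fun x => JE n N E x) k}
    {t : Finset κ} (h : ∀ i ∈ t, LocDecomp (f i) U) {x : M} (hx : x ∈ U) :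
    EndJet.nabRough hE (∑ i ∈ t, f i) x = ∑ i ∈ t, EndJet.nabRough hE (f i) x := by
  classical
  induction t using Finset.induction_on with
  | empty => exact nabRough_zero x
  | insert i t hi ih =>
    have h1 := fun j hj => h j (Finset.mem_insert_of_mem hj)
    rw [Finset.sum_insert hi, Finset.sum_insert hi,
      (h i (Finset.mem_insert_self i t)).nabRough_add (LocDecomp.sum h1) hx, ih h1]

/-- The connection. -/
def nabla (hE : IsSmoothBundle n N E) (k : ℕ) : Omega n N E k →ₗ[ℂ] Omega n N E (k + 1) where
  toFun α := ⟨nabRough hE α.1, (locDecomp_of_mem_omega hE α.2).nabRough.mem_omega⟩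
  map_add' α α' := Subtype.ext <| funext fun x =>
    (locDecomp_of_mem_omega hE α.2).nabRough_add (locDecomp_of_mem_omega hE α'.2) (Set.mem_univ x)
  map_smul' c α := Subtype.ext <| funext fun x =>
    (locDecomp_of_mem_omega hE α.2).nabRough_smul c (Set.mem_univ x)

theorem isInducedConnection_nabla (hE : IsSmoothBundle n N E) :
    IsInducedConnection n N E (nabla hE) := by
  intro k α U σ A hU hσ hA x hx v I i j
  exact (locDecomp_of_mem_omega hE α.2).coeffEntry_nabRough hU hσ
    (Set.mem_univ x) hx (hA x hx) v I i j

/-- The standard frame field at `x` is smooth near `x` and its `σ^*ω` is known, so the defining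
formula applies there and prescribes the value at `x`. -/
theorem IsInducedConnection.eq_nabla (hE : IsSmoothBundle n N E)
    {nab : ∀ k : ℕ, Omega n N E k →ₗ[ℂ] Omega n N E (k + 1)}
    (h : IsInducedConnection n N E nab) : nab = nabla hE := by
  funext k
  refine LinearMap.ext fun α => Subtype.ext (funext fun x => ?_)
  ext v : 1
  refine JE.ext_frame (stdFrame n N E hE x x) (matPS_ext fun I i j => ?_)
  have hx := self_mem_stdTriv_source (hE := hE) x
  have h1 : ∀ nab, IsInducedConnection n N E nab → _ := fun nab h =>
    h k α _ (stdFrame n N E hE x) (stdOmega n N x)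
      (stdTriv n N E hE x).chart.open_source (smoothFrameOn_stdFrame x)
      (fun y hy v => isPullbackOmega_stdOmega hy v) x hx v I i j
  exact (h1 _ h).trans (h1 _ (isInducedConnection_nabla hE)).symm

theorem nabla_comp_nabla (hE : IsSmoothBundle n N E) (k : ℕ) :
    nabla hE (k + 1) ∘ₗ nabla hE k = 0 := by
  refine LinearMap.ext fun α => Subtype.ext (funext fun x => ?_)
  exact (locDecomp_of_mem_omega hE α.2).nabRough_nabRough (Set.mem_univ x)

end Operations

/-! ### The connection in charts and its local exactness -/

section LocalExact

variable {n N : ℕ} {M : Type*} [TopologicalSpace M] [ChartedSpace (Eucl n) M]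
  {E : M → Type*} [∀ x, AddCommGroup (E x)] [∀ x, Module ℂ (E x)]
  [∀ x, TopologicalSpace (E x)] [TopologicalSpace (TotalSpace (Fib N) E)]
  [FiberBundle (Fib N) E] [VectorBundle ℂ (Fib N) E]
  [∀ x, IsTopologicalAddGroup (E x)] [∀ x, ContinuousSMul ℂ (E x)] [IsManifold (𝓡 n) ∞ M]
  [T2Space M] {hE : IsSmoothBundle n N E} {k : ℕ} {U : Set M}

theorem stdTriv_source_subset (x₀ : M) :
    (stdTriv n N E hE x₀).chart.source ⊆ (extChartAt (𝓡 n) x₀).source := by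
  intro x hx
  rw [extChartAt_source]
  exact (mem_stdTriv_source.1 hx).1

/-- The jets at a point as a linear map. -/
def jetJEHom (n N : ℕ) {M : Type*} [TopologicalSpace M] [ChartedSpace (Eucl n) M]
    (E : M → Type*) [∀ x, AddCommGroup (E x)] [∀ x, Module ℂ (E x)]
    [∀ x, TopologicalSpace (E x)] [TopologicalSpace (TotalSpace (Fib N) E)]
    [FiberBundle (Fib N) E] [VectorBundle ℂ (Fib N) E]
    [∀ x, IsTopologicalAddGroup (E x)] [∀ x, ContinuousSMul ℂ (E x)] (x : M) :
    Sec n N E →ₐ[ℂ] JE n N E x :=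
  (AlgHom.pi fun Φ : Frame n N E x => Φ.jetHom).codRestrict (JE n N E x) fun γ => (jetJE γ x).2

theorem jetJEHom_apply (γ : Sec n N E) (x : M) : jetJEHom n N E x γ = jetJE γ x := rfl

theorem jetJE_congr (hE : IsSmoothBundle n N E) {γ γ' : Sec n N E} {x : M}
    (h : ∀ᶠ z in 𝓝 x, γ.1 z = γ'.1 z) : jetJE γ x = jetJE γ' x := by
  have h1 : jet n N E x γ = jet n N E x γ' := Subtype.ext (funext fun k =>
    Ideal.Quotient.eq.2 (mem_vanIdeal_pow_of_eventually hE
      (h.mono fun z hz => sub_eq_zero.2 hz) k))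
  exact Subtype.ext (funext fun Φ => congrArg Φ.toEquiv.symm h1)

theorem jetJE_eq_zero (hE : IsSmoothBundle n N E) {γ : Sec n N E} {x : M}
    (h : ∀ᶠ z in 𝓝 x, γ.1 z = 0) : jetJE γ x = 0 :=
  (jetJE_congr (γ' := 0) hE h).trans (map_zero (jetJEHom n N E x))

/-- In the standard frame field, in a chart, the connection is the exterior derivative minus the
Koszul differential. -/
theorem LocDecomp.chartForm_nabRough {α : RoughForm n (fun x => JE n N E x) k}
    (h : LocDecomp α U) (hU : IsOpen U) {x₀ : M}
    (hUx : U ⊆ (stdTriv n N E hE x₀).chart.source) {y : Eucl n}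
    (hy : y ∈ (extChartAt (𝓡 n) x₀).target) (hyU : (extChartAt (𝓡 n) x₀).symm y ∈ U)
    (I : Fin n →₀ ℕ) (i j : Fin N) :
    chartForm (coeffForm (EndJet.nabRough hE α) (stdFrame n N E hE x₀) I i j) x₀ y =
      extDeriv (chartForm (coeffForm α (stdFrame n N E hE x₀) I i j) x₀) y -
        koszul (fun J => chartForm (coeffForm α (stdFrame n N E hE x₀) J i j) x₀ y) I := by
  have hσ : SmoothFrameOn n N E (stdFrame n N E hE x₀) U := fun γ I i j =>
    (smoothFrameOn_stdFrame x₀ γ I i j).mono hUx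
  have hs : SmoothFormOn (coeffForm α (stdFrame n N E hE x₀) I i j) U := by
    simpa using h.smoothFormOn hU hσ I i j
  ext v
  rw [ContinuousAlternatingMap.sub_apply, sub_eq_add_neg]
  refine (h.coeffEntry_nabRough hU hσ (A := stdOmega n N x₀) hyU hyU
    (fun v => isPullbackOmega_stdOmega (hUx hyU) v) (fun a => fromChart x₀ y (v a)) I i j).trans ?_
  congr 1
  · rw [← hs.chartForm_extD hU hy hyU]
    rfl
  · refine (coeffEntry_wedge _ _ _ _ I i j).trans ?_
    rw [koszul_apply, ← Finset.sum_neg_distrib]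
    refine Finset.sum_congr rfl fun a _ => ?_
    rw [← mul_neg]
    congr 1
    refine (coeff_negDirDer (toChart x₀ _ (fromChart x₀ y (v a))) _ I i j).trans ?_
    rw [toChart_fromChart hy]
    rfl

/-- The form with given coefficients in the standard frame field and in the chart at `x₀`. -/
def ofCoeff (hE : IsSmoothBundle n N E) (x₀ : M)
    (b : (Fin n →₀ ℕ) → Fin N → Fin N → Eucl n → (Eucl n) [⋀^Fin k]→L[ℝ] ℂ) :
    RoughForm n (fun x => JE n N E x) k := fun x =>
  (JE.ofFrame (stdFrame n N E hE x₀ x)).compAlternatingMap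
    (({ toFun := fun v => Matrix.of fun i j => ((fun I => b I i j (extChartAt (𝓡 n) x₀ x) v) : PS n)
        map_update_add' := fun v a u w => matPS_ext fun I i j =>
        (b I i j (extChartAt (𝓡 n) x₀ x)).toAlternatingMap.map_update_add v a u w
        map_update_smul' := fun v a c u => matPS_ext fun I i j =>
        (b I i j (extChartAt (𝓡 n) x₀ x)).toAlternatingMap.map_update_smul v a c u
        map_eq_zero_of_eq' := fun v _ _ hab hne => matPS_ext fun I i j =>
        (b I i j (extChartAt (𝓡 n) x₀ x)).toAlternatingMap.map_eq_zero_of_eq v hab hne } :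
      AlternatingMap ℝ (Eucl n) (MatPS n N) (Fin k)).compLinearMap
        (toChart x₀ x).toLinearMap)

theorem coeffForm_ofCoeff {x₀ : M}
    (b : (Fin n →₀ ℕ) → Fin N → Fin N → Eucl n → (Eucl n) [⋀^Fin k]→L[ℝ] ℂ)
    (I : Fin n →₀ ℕ) (i j : Fin N) (x : M) (v : Fin k → TangentSpace (𝓡 n) x) :
    coeffForm (ofCoeff hE x₀ b) (stdFrame n N E hE x₀) I i j x v =
      b I i j (extChartAt (𝓡 n) x₀ x) (fun a => toChart x₀ x (v a)) :=
  (congrArg (coeffEntry I i j) (JE.ofFrame_apply_self _ _)).trans rfl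

theorem chartForm_coeffForm_ofCoeff {x₀ : M}
    (b : (Fin n →₀ ℕ) → Fin N → Fin N → Eucl n → (Eucl n) [⋀^Fin k]→L[ℝ] ℂ)
    (I : Fin n →₀ ℕ) (i j : Fin N) {y : Eucl n} (hy : y ∈ (extChartAt (𝓡 n) x₀).target) :
    chartForm (coeffForm (ofCoeff hE x₀ b) (stdFrame n N E hE x₀) I i j) x₀ y = b I i j y := by
  ext v
  rw [chartForm_apply]
  refine (coeffForm_ofCoeff b I i j _ _).trans ?_
  rw [(extChartAt (𝓡 n) x₀).right_inv hy]
  congr 1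
  funext a
  exact toChart_fromChart hy (v a)

theorem form_ext_chart {α α' : RoughForm n (fun x => JE n N E x) k} {x₀ x : M}
    (hx : x ∈ (extChartAt (𝓡 n) x₀).source)
    (h : ∀ I i j, chartForm (coeffForm α (stdFrame n N E hE x₀) I i j) x₀ (extChartAt (𝓡 n) x₀ x) =
      chartForm (coeffForm α' (stdFrame n N E hE x₀) I i j) x₀ (extChartAt (𝓡 n) x₀ x)) :
    α x = α' x := by
  ext v : 1
  refine JE.ext_frame (stdFrame n N E hE x₀ x) (matPS_ext fun I i j => ?_)
  rw [← coeffForm_apply α, ← coeffForm_apply α', ← chartForm_toChart _ hx, h, chartForm_toChart _ hx]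

/-- Closed forms of positive degree have local primitives. -/
theorem LocDecomp.exists_primitive {α : RoughForm n (fun x => JE n N E x) (k + 1)} {x₀ : M}
    (h : LocDecomp α (stdTriv n N E hE x₀).chart.source)
    (h0 : ∀ x ∈ (stdTriv n N E hE x₀).chart.source, EndJet.nabRough hE α x = 0) :
    ∃ β : RoughForm n (fun x => JE n N E x) k,
      LocDecomp β (stdTriv n N E hE x₀).chart.source ∧
        ∀ x ∈ (stdTriv n N E hE x₀).chart.source, EndJet.nabRough hE β x = α x := by
  set V := (stdTriv n N E hE x₀).chart.source with hV
  have hVo : IsOpen V := (stdTriv n N E hE x₀).chart.open_source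
  set B := (extChartAt (𝓡 n) x₀).target ∩ (extChartAt (𝓡 n) x₀).symm ⁻¹' V with hB
  have hBo : IsOpen B := isOpen_chartDomain x₀ hVo
  -- In the standard frame field the connection acts separately on every matrix entry, so the
  -- primitive is found entry by entry.
  have h1 : ∀ (i j : Fin N), ∃ b : (Fin n →₀ ℕ) → Eucl n → (Eucl n) [⋀^Fin k]→L[ℝ] ℂ,
      (∀ J, ContDiffOn ℝ ∞ (b J) B) ∧ ∀ J, ∀ y ∈ B,
        extDeriv (b J) y - koszul (fun L => b L y) J =
          chartForm (coeffForm α (stdFrame n N E hE x₀) J i j) x₀ y := by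
    intro i j
    refine EndJet.exists_primitive hBo (fun J => ?_) fun J y hy => ?_
    · have hs : SmoothFormOn (coeffForm α (stdFrame n N E hE x₀) J i j) V := by
        simpa using h.smoothFormOn hVo (smoothFrameOn_stdFrame x₀) J i j
      exact hs x₀
    · have h2 := h.chartForm_nabRough hVo subset_rfl hy.1 hy.2 J i j
      have h3 : chartForm (coeffForm (EndJet.nabRough hE α) (stdFrame n N E hE x₀) J i j) x₀ y =
          0 := by
        ext v
        change coeffEntry J i j ((EndJet.nabRough hE α _ _).1 _) = 0
        rw [h0 _ hy.2]
        exact map_zero (coeffEntry J i j)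
      exact sub_eq_zero.1 (h2.symm.trans h3)
  choose b hb hbα using h1
  have hc : ∀ I i j, ∀ y ∈ B,
      chartForm (coeffForm (ofCoeff hE x₀ fun I i j => b i j I) (stdFrame n N E hE x₀) I i j) x₀ y =
        b i j I y := fun I i j y hy => chartForm_coeffForm_ofCoeff _ I i j hy.1
  have hβ : LocDecomp (ofCoeff hE x₀ fun I i j => b i j I) V :=
    locDecomp_of_std hVo subset_rfl fun I i j =>
      smoothFormOn_of_chart hVo (stdTriv_source_subset x₀) ((hb i j I).congr (hc I i j))
  refine ⟨_, hβ, fun x hx => ?_⟩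
  have hxs := stdTriv_source_subset x₀ hx
  have hp : extChartAt (𝓡 n) x₀ x ∈ B := by
    refine ⟨(extChartAt (𝓡 n) x₀).map_source hxs, ?_⟩
    rw [Set.mem_preimage, (extChartAt (𝓡 n) x₀).left_inv hxs]
    exact hx
  refine form_ext_chart (hE := hE) hxs fun I i j => ?_
  rw [hβ.chartForm_nabRough hVo subset_rfl hp.1 hp.2, ← hbα i j I _ hp]
  have h4 : chartForm (coeffForm (ofCoeff hE x₀ fun I i j => b i j I)
      (stdFrame n N E hE x₀) I i j) x₀ =ᶠ[𝓝 (extChartAt (𝓡 n) x₀ x)] b i j I := by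
    filter_upwards [hBo.mem_nhds hp] with y hy using hc I i j y hy
  rw [h4.extDeriv_eq]
  simp_rw [hc _ _ _ _ hp]

variable [SigmaCompactSpace M]

/-- Closed forms of positive degree have primitives. -/
theorem LocDecomp.exists_primitive_univ {α : RoughForm n (fun x => JE n N E x) (k + 1)}
    (h : LocDecomp α Set.univ) (h0 : ∀ x, EndJet.nabRough hE α x = 0) :
    ∃ β : RoughForm n (fun x => JE n N E x) k,
      LocDecomp β Set.univ ∧ ∀ x, EndJet.nabRough hE β x = α x := by
  have h1 := fun x₀ => LocDecomp.exists_primitive (x₀ := x₀) (hE := hE)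
    (h.mono (Set.subset_univ _)) fun x _ => h0 x
  choose β hβ hβα using h1
  obtain ⟨ρ, hρ⟩ := SmoothPartitionOfUnity.exists_isSubordinate (𝓡 n) isClosed_univ
    (fun x₀ => (stdTriv n N E hE x₀).chart.source)
    (fun x₀ => (stdTriv n N E hE x₀).chart.open_source)
    fun x _ => Set.mem_iUnion_of_mem x (self_mem_stdTriv_source x)
  -- The local primitives are multiplied by the full jets of `ρ i • 1`, not by the values of `ρ i`:
  -- then `∇(J(ρ_i) β_i) = J(ρ_i) α`, without a term `dρ_i ∧ β_i`.
  let g : M → Sec n N E := fun i => smulSec hE (ρ i).contMDiff 1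
  let f : M → RoughForm n (fun x => JE n N E x) k := fun i => EndJet.mulForm (g i) (β i)
  have hg : ∀ i x, x ∉ tsupport (ρ i) → jetJE (g i) x = 0 := by
    intro i x hx
    refine jetJE_eq_zero hE ?_
    filter_upwards [(isClosed_tsupport (ρ i)).isOpen_compl.mem_nhds hx] with z hz
    change ((ρ i z : ℝ) : ℂ) • (1 : EndFib E z) = 0
    rw [image_eq_zero_of_notMem_tsupport hz, Complex.ofReal_zero, zero_smul]
  have hf0 : ∀ i x, x ∉ tsupport (ρ i) → f i x = 0 := by
    intro i x hx
    ext v : 1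
    change jetJE (g i) x * β i x v = 0
    rw [hg i x hx, zero_mul]
  have hf : ∀ i, LocDecomp (f i) Set.univ := by
    intro i
    refine LocDecomp.of_locally fun x _ => ?_
    by_cases hx : x ∈ tsupport (ρ i)
    · exact ⟨_, (stdTriv n N E hE i).chart.open_source, hρ i hx, _, (hβ i).mulForm (g i),
        fun _ _ => rfl⟩
    · exact ⟨_, (isClosed_tsupport (ρ i)).isOpen_compl, hx, 0, locDecomp_zero,
        fun y hy => hf0 i y hy⟩
  have hfα : ∀ i x, EndJet.nabRough hE (f i) x = EndJet.mulForm (g i) α x := by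
    intro i x
    by_cases hx : x ∈ tsupport (ρ i)
    · refine ((hβ i).nabRough_mulForm (g i) (hρ i hx)).trans ?_
      ext v : 1
      rw [mulForm_apply, mulForm_apply, hβα i x (hρ i hx)]
    · rw [locDecomp_zero.nabRough_congr (isClosed_tsupport (ρ i)).isOpen_compl
        (fun y hy => hf0 i y hy) hx, nabRough_zero]
      ext v : 1
      rw [mulForm_apply, hg i x hx, zero_mul]
      rfl
  have hloc : ∀ x : M, ∃ V, IsOpen V ∧ x ∈ V ∧ ∃ t : Finset M,
      ∀ y ∈ V, (∑ᶠ i, f i y) = (∑ i ∈ t, f i) y ∧ ∑ i ∈ t, ρ i y = 1 := by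
    intro x
    obtain ⟨W, hW, hfin⟩ := ρ.locallyFinite x
    refine ⟨interior W, isOpen_interior, mem_interior_iff_mem_nhds.2 hW, hfin.toFinset,
      fun y hy => ⟨?_, ?_⟩⟩
    · rw [Finset.sum_apply]
      refine finsum_eq_sum_of_support_subset _ fun i hi => ?_
      rw [Set.Finite.coe_toFinset]
      by_contra hi'
      refine hi (hf0 i y fun hyt => ?_)
      obtain ⟨z, hz, hz'⟩ := mem_closure_iff_nhds.1 hyt _ (isOpen_interior.mem_nhds hy)
      exact hi' ⟨z, hz', interior_subset hz⟩
    · rw [← ρ.sum_eq_one (Set.mem_univ y)]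
      refine (finsum_eq_sum_of_support_subset _ fun i hi => ?_).symm
      rw [Set.Finite.coe_toFinset]
      exact ⟨y, hi, interior_subset hy⟩
  have hsum : ∀ t : Finset M, LocDecomp (∑ i ∈ t, f i) Set.univ := fun t =>
    LocDecomp.sum fun i _ => hf i
  refine ⟨fun x => ∑ᶠ i, f i x, LocDecomp.of_locally fun x _ => ?_, fun x => ?_⟩
  · obtain ⟨V, hV, hxV, t, ht⟩ := hloc x
    exact ⟨V, hV, hxV, _, (hsum t).mono (Set.subset_univ V), fun y hy => (ht y hy).1⟩
  · obtain ⟨V, hV, hxV, t, ht⟩ := hloc x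
    rw [((hsum t).mono (Set.subset_univ V)).nabRough_congr hV (fun y hy => (ht y hy).1) hxV,
      LocDecomp.nabRough_sum (fun i _ => hf i) (Set.mem_univ x)]
    simp_rw [hfα]
    -- The finite sum of the `ρ i` is `1` on a whole neighbourhood of `x`, so its jet, not only its
    -- value, is that of the unit section.
    have h2 : ∑ i ∈ t, jetJE (g i) x = 1 := by
      simp_rw [← jetJEHom_apply]
      rw [← map_sum, ← map_one (jetJEHom n N E x)]
      refine jetJE_congr hE ?_
      filter_upwards [hV.mem_nhds hxV] with z hz
      have h3 : (∑ i ∈ t, g i).1 z = ∑ i ∈ t, ((ρ i z : ℝ) : ℂ) • (1 : EndFib E z) := by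
        rw [AddSubmonoidClass.coe_finsetSum, Finset.sum_apply]
        rfl
      rw [h3, ← Finset.sum_smul, ← Complex.ofReal_sum, (ht z hz).2, Complex.ofReal_one, one_smul]
      rfl
    ext v : 1
    let ev : ((TangentSpace (𝓡 n) x) [⋀^Fin (k + 1)]→ₗ[ℝ] JE n N E x) →+ JE n N E x :=
      { toFun := fun g => g v, map_zero' := rfl, map_add' := fun _ _ => rfl }
    refine (map_sum ev _ t).trans ?_
    change ∑ i ∈ t, jetJE (g i) x * α x v = α x v
    rw [← Finset.sum_mul, h2, one_mul]

theorem exact_nabla (hE : IsSmoothBundle n N E) (k : ℕ) :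
    Function.Exact (nabla hE k) (nabla hE (k + 1)) := by
  intro α
  constructor
  · intro hα
    obtain ⟨β, hβ, hβα⟩ := (locDecomp_of_mem_omega hE α.2).exists_primitive_univ (hE := hE)
      fun x => congrFun (congrArg Subtype.val hα) x
    exact ⟨⟨β, hβ.mem_omega⟩, Subtype.ext (funext hβα)⟩
  · rintro ⟨β, rfl⟩
    exact LinearMap.congr_fun (nabla_comp_nabla hE k) β

end LocalExact

/-! ### Parallel sections of the jet bundle -/

section Parallel

variable {n N : ℕ} {M : Type*} [TopologicalSpace M] [ChartedSpace (Eucl n) M]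
  {E : M → Type*} [∀ x, AddCommGroup (E x)] [∀ x, Module ℂ (E x)]
  [∀ x, TopologicalSpace (E x)] [TopologicalSpace (TotalSpace (Fib N) E)]
  [FiberBundle (Fib N) E] [VectorBundle ℂ (Fib N) E]
  [∀ x, IsTopologicalAddGroup (E x)] [∀ x, ContinuousSMul ℂ (E x)]

/-- The jets of a section as a form of degree `0`. -/
def jetForm (γ : Sec n N E) : RoughForm n (fun x => JE n N E x) 0 := fun x =>
  AlternatingMap.constOfIsEmpty ℝ (TangentSpace (𝓡 n) x) (Fin 0) (jetJE γ x)

/-- The function `1` as a form of degree `0`. -/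
def oneForm (n : ℕ) (M : Type*) [TopologicalSpace M] [ChartedSpace (Eucl n) M] :
    RoughForm n (fun _ : M => ℂ) 0 := fun x =>
  AlternatingMap.constOfIsEmpty ℝ (TangentSpace (𝓡 n) x) (Fin 0) (1 : ℂ)

theorem chartForm_oneForm (x₀ : M) : chartForm (oneForm n M) x₀ =
    fun _ => toCont (AlternatingMap.constOfIsEmpty ℝ (Eucl n) (Fin 0) (1 : ℂ)) := rfl

theorem extD_oneForm (x : M) : extD (oneForm n M) x = 0 := by
  have h : extDeriv (chartForm (oneForm n M) x) (extChartAt (𝓡 n) x x) = 0 := by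
    rw [chartForm_oneForm, extDeriv, fderiv_fun_const]
    exact (ContinuousAlternatingMap.alternatizeUncurryFinCLM (n := 0) ℝ (Eucl n) ℂ).map_zero
  unfold extD
  rw [h]
  rfl

variable [IsManifold (𝓡 n) ∞ M]

theorem isDecomp_jetForm (γ : Sec n N E) (d : ℕ) : IsDecomp (jetForm γ) d Set.univ
    (fun _ : Unit => oneForm n M) fun _ => γ := by
  refine ⟨fun _ x₀ => ?_, fun x _ v Φ => ?_⟩
  · rw [chartForm_oneForm]
    exact contDiffOn_const
  · rw [Fintype.sum_unique]
    have h : oneForm n M x v • Φ.toEquiv.symm (jet n N E x γ) = (jetForm γ x v).1 Φ :=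
      one_smul ℂ (Φ.toEquiv.symm (jet n N E x γ))
    rw [h, sub_self]
    exact Submodule.zero_mem _

theorem locDecomp_jetForm (γ : Sec n N E) : LocDecomp (jetForm γ) Set.univ := fun _ _ d =>
  ⟨Set.univ, isOpen_univ, Set.mem_univ _, Unit, inferInstance, _, _, isDecomp_jetForm γ d⟩

variable [T2Space M] {hE : IsSmoothBundle n N E}

theorem nabRough_jetForm (γ : Sec n N E) (x : M) : nabRough hE (jetForm γ) x = 0 := by
  refine nabRough_ext fun d => ⟨Set.univ, isOpen_univ, Set.mem_univ _, Unit, inferInstance, _, _,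
    isDecomp_jetForm γ (d + 1), fun v Φ => ?_⟩
  rw [Fintype.sum_unique, extD_oneForm]
  have h : (0 : ℂ) • Φ.toEquiv.symm (jet n N E x γ) = 0 := zero_smul ℂ _
  change 0 - (0 : ℂ) • Φ.toEquiv.symm (jet n N E x γ) ∈ adicSub n N d
  rw [h, sub_zero]
  exact Submodule.zero_mem _

/-- Taylor expansion of sections, as a map into the parallel sections of the jet bundle. -/
def taylorMap (hE : IsSmoothBundle n N E) : Sec n N E →ₗ[ℂ] LinearMap.ker (nabla hE 0) where
  toFun γ := ⟨⟨jetForm γ, (locDecomp_jetForm γ).mem_omega⟩,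
    Subtype.ext (funext fun x => nabRough_jetForm γ x)⟩
  map_add' γ γ' := Subtype.ext <| Subtype.ext <| funext fun x => AlternatingMap.ext fun _ =>
    map_add (jetJEHom n N E x) γ γ'
  map_smul' c γ := Subtype.ext <| Subtype.ext <| funext fun x => AlternatingMap.ext fun _ =>
    map_smul (jetJEHom n N E x) c γ

theorem jetJE_injective (hE : IsSmoothBundle n N E) {γ : Sec n N E}
    (h : ∀ x, jetJE γ x = 0) : γ = 0 := by
  refine Subtype.ext (funext fun x => ?_)
  have hx := self_mem_stdTriv_source (hE := hE) x
  have h1 : taylor ((stdTriv n N E hE x).pull γ) ((stdTriv n N E hE x).chart x) = 0 :=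
    (stdFrame_symm_jet hx γ).symm.trans
      (congrArg (fun s : JE n N E x => s.1 (stdFrame n N E hE x x)) (h x))
  have h2 : (stdTriv n N E hE x).fibre x (γ.1 x) = 0 := by
    rw [← (stdTriv n N E hE x).pull_apply_chart γ hx]
    ext i j
    refine (coeffEntry_zero_taylor _ _ i j).symm.trans ?_
    rw [h1]
    exact map_zero (coeffEntry 0 i j)
  exact (map_eq_zero_iff _ ((stdTriv n N E hE x).fibre x).injective).1 h2

/-- The value of an element of the jet bundle does not depend on frames. -/
theorem stdFibre_symm_eval {x₀ x₁ x : M} (h₀ : x ∈ (stdTriv n N E hE x₀).chart.source)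
    (h₁ : x ∈ (stdTriv n N E hE x₁).chart.source) (s : JE n N E x) :
    (stdFibre x₀ x).symm (Matrix.of fun i j => coeffEntry 0 i j (s.1 (stdFrame n N E hE x₀ x))) =
      (stdFibre (E := E) x₁ x).symm
        (Matrix.of fun i j => coeffEntry 0 i j (s.1 (stdFrame n N E hE x₁ x))) := by
  -- Each constant term is the value at `x` of a section representing the image of `s` in `Γ(End E)
  -- / I_x`, and this image does not depend on the frame.
  obtain ⟨γ₀, hγ₀, h₀'⟩ := stdFrame_eval h₀ (s.1 (stdFrame n N E hE x₀ x))
  obtain ⟨γ₁, hγ₁, h₁'⟩ := stdFrame_eval h₁ (s.1 (stdFrame n N E hE x₁ x))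
  have h2 : (stdFrame n N E hE x₁ x).toEquiv (s.1 (stdFrame n N E hE x₁ x)) =
      (stdFrame n N E hE x₀ x).toEquiv (s.1 (stdFrame n N E hE x₀ x)) := by
    obtain ⟨g, hg⟩ := (stdFrame n N E hE x₀ x).exists_comp_eq (stdFrame n N E hE x₁ x)
    rw [← hg, s.2]
    exact congrArg (stdFrame n N E hE x₀ x).toEquiv (g.1.apply_symm_apply _)
  rw [h2, hγ₀] at hγ₁
  have h3 : γ₀.1 x = γ₁.1 x := by
    have h4 := Ideal.Quotient.eq.1 hγ₁
    rw [Submodule.pow_one] at h4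
    exact sub_eq_zero.1 (mem_vanIdeal_iff.1 h4)
  have h5 : (Matrix.of fun i j => coeffEntry 0 i j (s.1 (stdFrame n N E hE x₀ x))) =
      stdFibre x₀ x (γ₀.1 x) := by
    ext i j
    exact (h₀' i j).symm
  have h6 : (Matrix.of fun i j => coeffEntry 0 i j (s.1 (stdFrame n N E hE x₁ x))) =
      stdFibre x₁ x (γ₁.1 x) := by
    ext i j
    exact (h₁' i j).symm
  rw [h5, h6, AlgEquiv.symm_apply_apply, AlgEquiv.symm_apply_apply, h3]

/-- The series of a form of degree `0` in the standard frame field and in the chart at `x₀`. -/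
def localSeries (hE : IsSmoothBundle n N E) (s : RoughForm n (fun x => JE n N E x) 0) (x₀ : M)
    (y : Eucl n) : MatPS n N := Matrix.of fun i j => ((fun I =>
      chartForm (coeffForm s (stdFrame n N E hE x₀) I i j) x₀ y ![]) : PS n)

theorem coeffEntry_localSeries (s : RoughForm n (fun x => JE n N E x) 0) (x₀ : M) (y : Eucl n)
    (I : Fin n →₀ ℕ) (i j : Fin N) : coeffEntry I i j (localSeries hE s x₀ y) =
      chartForm (coeffForm s (stdFrame n N E hE x₀) I i j) x₀ y ![] := rfl

theorem localSeries_chart (s : RoughForm n (fun x => JE n N E x) 0) {x₀ x : M}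
    (hx : x ∈ (extChartAt (𝓡 n) x₀).source) (v : Fin 0 → TangentSpace (𝓡 n) x) :
    localSeries hE s x₀ (extChartAt (𝓡 n) x₀ x) = (s x v).1 (stdFrame n N E hE x₀ x) := by
  refine matPS_ext fun I i j => ?_
  rw [coeffEntry_localSeries, ← coeffForm_apply, ← chartForm_toChart _ hx]
  congr 1
  exact Subsingleton.elim _ _

/-- Evaluated on the basis vector `e_t`, the equation `∇s = 0` in the standard frame field reads
`∂_t c_I = (I_t + 1) c_{I + e_t}`. -/
theorem isParallelOn_localSeries {s : RoughForm n (fun x => JE n N E x) 0}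
    (hs : LocDecomp s Set.univ) (h0 : ∀ x, nabRough hE s x = 0) (x₀ : M) :
    IsParallelOn ((extChartAt (𝓡 n) x₀).target ∩
      (extChartAt (𝓡 n) x₀).symm ⁻¹' (stdTriv n N E hE x₀).chart.source)
      (localSeries hE s x₀) := by
  set V := (stdTriv n N E hE x₀).chart.source with hV
  have hVo : IsOpen V := (stdTriv n N E hE x₀).chart.open_source
  have hBo := isOpen_chartDomain (n := n) x₀ hVo
  have hsm : ∀ I i j, ContDiffOn ℝ ∞ (chartForm (coeffForm s (stdFrame n N E hE x₀) I i j) x₀)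
      ((extChartAt (𝓡 n) x₀).target ∩ (extChartAt (𝓡 n) x₀).symm ⁻¹' V) := by
    intro I i j
    have h1 : SmoothFormOn (coeffForm s (stdFrame n N E hE x₀) I i j) V := by
      simpa using hs.smoothFormOn hVo (smoothFrameOn_stdFrame x₀) I i j
    exact h1 x₀
  intro I i j
  refine ⟨ContDiffOn.form_apply (hsm I i j) fun a => a.elim0, fun y hy t => ?_⟩
  have h2 := (hs.mono (Set.subset_univ V)).chartForm_nabRough (hE := hE) hVo subset_rfl
    hy.1 hy.2 I i j
  have h3 : chartForm (coeffForm (nabRough hE s) (stdFrame n N E hE x₀) I i j) x₀ y = 0 := by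
    ext v
    change coeffEntry I i j ((nabRough hE s _ _).1 _) = 0
    rw [h0]
    exact map_zero (coeffEntry I i j)
  have h4 := congrArg (fun f : (Eucl n) [⋀^Fin 1]→L[ℝ] ℂ => f ![EuclideanSpace.single t 1])
    (sub_eq_zero.1 (h2.symm.trans h3))
  rw [extDeriv_apply (((hsm I i j).contDiffAt (hBo.mem_nhds hy)).differentiableAt (by simp)),
    koszul_apply, Fin.sum_univ_one, Fin.sum_univ_one] at h4
  rw [coeffEntry_apply, coeff_matPderiv, ← coeffEntry_apply]
  simp only [Fin.val_zero, pow_zero, one_smul, one_mul, Matrix.cons_val_zero] at h4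
  rw [Finset.sum_eq_single t (fun b _ hb => by simp [hb]) (by simp)] at h4
  have h5 : ∀ w : Fin 1 → Eucl n, Fin.removeNth 0 w = (![] : Fin 0 → Eucl n) :=
    fun _ => Subsingleton.elim _ _
  simp only [h5, PiLp.single_apply, if_true, Complex.ofReal_one,
    one_mul] at h4
  exact h4

/-- The constant terms of `s` in the standard frames are the values of one global section, by
`stdFibre_symm_eval`. Being parallel, `s` is in each standard frame field the Taylor series of its
constant terms, that is, the jet of this section. -/
theorem exists_sec_of_parallel {s : RoughForm n (fun x => JE n N E x) 0}
    (hs : LocDecomp s Set.univ) (h0 : ∀ x, nabRough hE s x = 0) :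
    ∃ γ : Sec n N E, ∀ x v, s x v = jetJE γ x := by
  let a : M → Eucl n → Mat N := fun x₀ y =>
    Matrix.of fun i j => coeffEntry 0 i j (localSeries hE s x₀ y)
  let γ₀ : ∀ x, EndFib E x := fun x => (stdFibre x x).symm (a x (extChartAt (𝓡 n) x x))
  have h1 : ∀ x₀ x, x ∈ (stdTriv n N E hE x₀).chart.source →
      stdFibre x₀ x (γ₀ x) = a x₀ (extChartAt (𝓡 n) x₀ x) := by
    intro x₀ x hx
    have h2 := stdFibre_symm_eval hx (self_mem_stdTriv_source (hE := hE) x) (s x ![])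
    rw [← localSeries_chart s (stdTriv_source_subset x₀ hx),
      ← localSeries_chart s (mem_extChartAt_source x)] at h2
    exact (AlgEquiv.symm_apply_eq _).1 h2 |>.symm
  have hγ : IsSmoothSection n N γ₀ := by
    refine isSmoothSection_of_stdFibre hE fun x => ?_
    have hx := self_mem_stdTriv_source (hE := hE) x
    refine ⟨x, (mem_stdTriv_source.1 hx).2, fun i j => ?_⟩
    have h3 := (isParallelOn_localSeries hs h0 x 0 i j).1.contDiffAt
      ((isOpen_chartDomain x (stdTriv n N E hE x).chart.open_source).mem_nhds
        (x := extChartAt (𝓡 n) x x) ⟨mem_extChartAt_target x, by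
          rw [Set.mem_preimage, extChartAt_to_inv]; exact hx⟩)
    refine (h3.contMDiffAt.comp x (contMDiffAt_extChartAt (n := ∞))).congr_of_eventuallyEq ?_
    filter_upwards [(stdTriv n N E hE x).chart.open_source.mem_nhds hx] with z hz
    exact congrFun (congrFun (h1 x z hz) i) j
  refine ⟨⟨γ₀, hγ⟩, fun x v => JE.ext_frame (stdFrame n N E hE x x) ?_⟩
  have hx := self_mem_stdTriv_source (hE := hE) x
  have hBo := isOpen_chartDomain (n := n) x (stdTriv n N E hE x).chart.open_source
  have hp : extChartAt (𝓡 n) x x ∈ (extChartAt (𝓡 n) x).target ∩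
      (extChartAt (𝓡 n) x).symm ⁻¹' (stdTriv n N E hE x).chart.source :=
    ⟨mem_extChartAt_target x, by rw [Set.mem_preimage, extChartAt_to_inv]; exact hx⟩
  rw [← localSeries_chart s (mem_extChartAt_source x) v,
    (isParallelOn_localSeries hs h0 x).eq_taylor hBo (a := a x) (fun _ _ _ _ => rfl) hp]
  refine Eq.trans ?_ (stdFrame_symm_jet hx ⟨γ₀, hγ⟩).symm
  refine taylor_congr ?_
  filter_upwards [hBo.mem_nhds hp] with y hy
  have h4 := h1 x _ hy.2
  rw [(extChartAt (𝓡 n) x).right_inv hy.1] at h4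
  exact h4.symm

/-- Taylor expansion identifies sections and parallel sections of the jet bundle. -/
def taylorEquiv (hE : IsSmoothBundle n N E) : Sec n N E ≃ₗ[ℂ] LinearMap.ker (nabla hE 0) :=
  LinearEquiv.ofBijective (taylorMap hE) <| by
    constructor
    · rw [injective_iff_map_eq_zero]
      intro γ hγ
      refine jetJE_injective hE fun x => ?_
      exact congrArg (fun s : LinearMap.ker (nabla hE 0) => s.1.1 x ![]) hγ
    · rintro ⟨s, hs⟩
      obtain ⟨γ, hγ⟩ := exists_sec_of_parallel (locDecomp_of_mem_omega hE s.2)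
        fun x => congrFun (congrArg Subtype.val hs) x
      exact ⟨γ, Subtype.ext <| Subtype.ext <| funext fun x => AlternatingMap.ext fun v =>
        (hγ x v).symm⟩

end Parallel

end EndJet

end

/-! ### The theorem -/

theorem mainTheorem7 {n N : ℕ} {M : Type*} [TopologicalSpace M] [ChartedSpace (EndJet.Eucl n) M]
    [IsManifold (𝓡 n) ∞ M] [T2Space M] [SigmaCompactSpace M]
    (E : M → Type*) [∀ x, AddCommGroup (E x)] [∀ x, Module ℂ (E x)]
    [∀ x, TopologicalSpace (E x)] [∀ x, IsTopologicalAddGroup (E x)]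
    [∀ x, ContinuousSMul ℂ (E x)] [TopologicalSpace (TotalSpace (EndJet.Fib N) E)]
    [FiberBundle (EndJet.Fib N) E] [VectorBundle ℂ (EndJet.Fib N) E]
    (hE : EndJet.IsSmoothBundle n N E) :
    (∀ m : M, Nonempty (EndJet.Frame n N E m)) ∧
    ∃ nabla : ∀ k : ℕ, EndJet.Omega n N E k →ₗ[ℂ] EndJet.Omega n N E (k + 1),
      EndJet.IsInducedConnection n N E nabla ∧
      (∀ nabla', EndJet.IsInducedConnection n N E nabla' → nabla' = nabla) ∧
      (∀ k, nabla (k + 1) ∘ₗ nabla k = 0) ∧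
      (∀ k, Function.Exact (nabla k) (nabla (k + 1))) ∧
      ∃ j : EndJet.Sec n N E ≃ₗ[ℂ] LinearMap.ker (nabla 0),
        ∀ (γ : EndJet.Sec n N E) (m : M) (Φ : EndJet.Frame n N E m)
          (v : Fin 0 → TangentSpace (𝓡 n) m),
          ((j γ).1.1 m v).1 Φ = Φ.toEquiv.symm (EndJet.jet n N E m γ) := by
  exact ⟨fun m => ⟨EndJet.stdFrame n N E hE m m⟩, EndJet.nabla hE,
    EndJet.isInducedConnection_nabla hE, fun _ h => h.eq_nabla hE, EndJet.nabla_comp_nabla hE,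
    EndJet.exact_nabla hE, EndJet.taylorEquiv hE, fun _ _ _ _ => rfl⟩
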